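/- **Conventions.** A *ternary $\mathbb Z$-lattice* $L$ is a finitely generated $\mathbb Z$-submodule of full rank of a three-dimensional positive definite quadratic space $V$ over $\mathbb Q$, with quadratic map $Q$ and bilinear map $B$, $B(x,x)=Q(x)$, such that $Q(L)\subseteq\mathbb Z$. For a rational number $a>0$, $L^a$ denotes $L$ with $B$ scaled by $a$, and $dL=\det(B(x_i,x_j))$ for a $\mathbb Z$-basis $(x_i)$ of $L$. The genus $\mathrm{gen}(L)$ is the set of lattices $L'$ on $V$ such that for every prime $p$ there is $\sigma_p\in O(V_p)$ with $L'_p=\sigma_pL_p$. The spinor genus $\mathrm{spn}(L)$ is the set of lattices $L'$ on $V$ for which there is $\sigma\in O(V)$ such that for every prime $p$ we have $L'_p=\sigma\Sigma_pL_p$ for some rotation $\Sigma_p$ of $V_p$ of spinor norm $1$. Let $g(L)$ be the number of spinor genera in $\mathrm{gen}(L)$. Let $n$ be a positive integer. A pair $([N],[M])$ of isometry classes of lattices is a *representable pair by scaling $n$* if there is a representation $\phi:M^n\to N$ with $[N:\phi(M^n)]=n$. A set $\mathfrak C$ of representable pairs by scaling $n$ in $\mathrm{gen}(N)\times\mathrm{gen}(M)$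 *respects spinor genus* if for any $([N_1],[M_1]),([N_2],[M_2])\in\mathfrak C$ one has $N_1\in\mathrm{spn}(N_2)$ if and only if $M_1\in\mathrm{spn}(M_2)$. **The number $g_{N,M}$.** Let $n$ be square-free, let $([N],[M])$ be a representable pair of ternary $\mathbb Z$-lattices by scaling $n$, and let $\phi:M^n\to N$ be a representation. Choose a basis $x_1,x_2,x_3$ of $N$ with $\phi(M^n)=\mathbb Zx_1+\mathbb Zx_2+\mathbb Z(nx_3)$. Let $n_2$ be the product of the primes $p\mid n$ such that the $\tfrac12\mathbb Z_p$-modular component in a Jordan decomposition of $N_p$ has rank two, and let $n_1=n/n_2$. Let $n_2(e)$ be the product of the primes $q\mid n_2$ such that $\mathrm{ord}_q(4\,dN)$ is even. Put $$L_{N,M}=\bigl(\mathbb Zx_1+\mathbb Zx_2+\mathbb Z(n_1n_2(e)x_3)\bigr)^{\frac1{n_1n_2(e)}},\qquad g_{N,M}=g(L_{N,M}).$$ **Statement.** Let $n$ be a square-free positive integer and let $([N],[M])$ be a representable pair of ternary $\mathbb Z$-lattices by scaling $n$. Assume that for every prime $p\mid n$ the norm ideal of $N$ is not contained in $p\mathbb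 Z$ (for instance, that $N$ is primitive), and that $g(N)=g(M)$. Then a representation $\phi:M^n\to N$ and a basis of $N$ as above exist, and for every such choice, $g(N)=g_{N,M}$ if and only if the genus-correspondence consisting of all representable pairs by scaling $n$ in $\mathrm{gen}(N)\times\mathrm{gen}(M)$ respects spinor genus. -/

import Mathlib

open scoped TensorProduct

noncomputable section

namespace TernaryLattice

/-! ### Quadratic spaces and reflections

The quadratic map `Q` and the symmetric bilinear map `B` are normalised by `B(x, x) = Q(x)`; so
`B = QuadraticMap.associated Q` and `QuadraticMap.polar Q x y = 2 B(x, y)`. -/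

/-- The reflection `x ↦ x - (2 B(x, v) / Q(v)) v` in a vector `v` (used only when `Q v ≠ 0`). -/
def reflection {K : Type*} [Field K] {X : Type*} [AddCommGroup X] [Module K X]
    (Q : QuadraticForm K X) (v : X) : Module.End K X :=
  LinearMap.id - (((Q v)⁻¹ • QuadraticMap.polarBilin Q v).smulRight v)

/-- The group `O'` of rotations of spinor norm one: products of an even number of reflections in
anisotropic vectors `v₁, …, vₖ` for which `Q(v₁) ⋯ Q(vₖ)` is a square. -/
def spinorKernel {K : Type*} [Field K] {X : Type*} [AddCommGroup X] [Module K X]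
    (Q : QuadraticForm K X) : Set (Q.IsometryEquiv Q) :=
  {σ | ∃ l : List X, Even l.length ∧ (∀ v ∈ l, Q v ≠ 0) ∧ IsSquare (l.map Q).prod ∧
    (σ.toLinearEquiv : X →ₗ[K] X) = (l.map (reflection Q)).prod}

/-! ### Lattices -/

/-- `L` is a positive definite non-classic integral ternary `ℤ`-lattice on the quadratic space
`(V, Q)`: the space is positive definite of dimension three, `L` is finitely generated of full
rank, and `Q` takes integral values on `L`. -/
structure IsTernaryLattice {V : Type*} [AddCommGroup V] [Module ℚ V]
    (Q : QuadraticForm ℚ V) (L : Submodule ℤ V) : Prop where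
  finrank_eq : Module.finrank ℚ V = 3
  posDef : Q.PosDef
  isLattice : Submodule.IsLattice ℚ L
  integral : ∀ x ∈ L, ∃ a : ℤ, Q x = a

/-- `L` is primitive at `p`: not all values of `Q` on `L` are divisible by `p`. For an integral
lattice this says that its norm ideal is not contained in `pℤ`. -/
def PrimitiveAt {V : Type*} [AddCommGroup V] [Module ℚ V]
    (p : ℕ) (Q : QuadraticForm ℚ V) (L : Submodule ℤ V) : Prop :=
  ∃ x ∈ L, ∀ a : ℤ, Q x ≠ (p : ℚ) * a

/-- The discriminant `det (B(xᵢ, xⱼ))` of the lattice with basis `x`. -/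
def discr {V : Type*} [AddCommGroup V] [Module ℚ V] (Q : QuadraticForm ℚ V)
    {L : Submodule ℤ V} (x : Module.Basis (Fin 3) ℤ L) : ℚ :=
  (Matrix.of fun i j => QuadraticMap.associated Q (x i : V) (x j : V)).det

/-! ### Completions -/

/-- The quadratic form on `V_p = ℚ_p ⊗ V`. -/
def localForm {V : Type*} [AddCommGroup V] [Module ℚ V] (p : ℕ) [Fact p.Prime]
    (Q : QuadraticForm ℚ V) : QuadraticForm ℚ_[p] (ℚ_[p] ⊗[ℚ] V) :=
  Q.baseChange ℚ_[p]

/-- The completion `L_p`, the `ℤ_p`-span of `L` in `V_p`. -/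
def localization {V : Type*} [AddCommGroup V] [Module ℚ V] (p : ℕ) [Fact p.Prime]
    (L : Submodule ℤ V) : Submodule ℤ_[p] (ℚ_[p] ⊗[ℚ] V) :=
  Submodule.span ℤ_[p] ((fun v : V => (1 : ℚ_[p]) ⊗ₜ[ℚ] v) '' (L : Set V))

/-- The image of a `ℤ_p`-submodule of `V_p` under a linear map. -/
def localImage {V : Type*} [AddCommGroup V] [Module ℚ V] (p : ℕ) [Fact p.Prime]
    (f : (ℚ_[p] ⊗[ℚ] V) →ₗ[ℚ_[p]] (ℚ_[p] ⊗[ℚ] V))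
    (L : Submodule ℤ_[p] (ℚ_[p] ⊗[ℚ] V)) : Submodule ℤ_[p] (ℚ_[p] ⊗[ℚ] V) :=
  L.map (f.restrictScalars ℤ_[p])

/-! ### Genus and spinor genus -/

/-- `gen(L)`: the lattices `L'` on `V` such that, for every prime `p`, `L'_p = σ L_p` for some
`σ ∈ O(V_p)`. -/
def gen {V : Type*} [AddCommGroup V] [Module ℚ V]
    (Q : QuadraticForm ℚ V) (L : Submodule ℤ V) : Set (Submodule ℤ V) :=
  {L' | Submodule.IsLattice ℚ L' ∧ ∀ (p : ℕ) [Fact p.Prime],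
    ∃ σ : (localForm p Q).IsometryEquiv (localForm p Q),
      localization p L' = localImage p (σ.toLinearEquiv : (ℚ_[p] ⊗[ℚ] V) →ₗ[ℚ_[p]] (ℚ_[p] ⊗[ℚ] V)) (localization p L)}

/-- `spn(L)`: the lattices `L'` on `V` for which there is `σ ∈ O(V)` such that, for every prime `p`,
`L'_p = σ Σ_p L_p` for some `Σ_p ∈ O'(V_p)`. -/
def spn {V : Type*} [AddCommGroup V] [Module ℚ V]
    (Q : QuadraticForm ℚ V) (L : Submodule ℤ V) : Set (Submodule ℤ V) :=
  {L' | Submodule.IsLattice ℚ L' ∧ ∃ σ : Q.IsometryEquiv Q, ∀ (p : ℕ) [Fact p.Prime],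
    ∃ τ ∈ spinorKernel (localForm p Q),
      localization p L' =
        localImage p ((σ.toLinearEquiv : V →ₗ[ℚ] V).baseChange ℚ_[p])
          (localImage p (τ.toLinearEquiv : (ℚ_[p] ⊗[ℚ] V) →ₗ[ℚ_[p]] (ℚ_[p] ⊗[ℚ] V)) (localization p L))}

/-- `gen(L)_S`: the set of spinor genera in the genus of `L`. -/
def spinorGenera {V : Type*} [AddCommGroup V] [Module ℚ V]
    (Q : QuadraticForm ℚ V) (L : Submodule ℤ V) : Set (Set (Submodule ℤ V)) :=
  spn Q '' gen Q L

/-- `g(L)`: the number of spinor genera in the genus of `L`. -/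
def numSpinorGenera {V : Type*} [AddCommGroup V] [Module ℚ V]
    (Q : QuadraticForm ℚ V) (L : Submodule ℤ V) : ℕ :=
  (spinorGenera Q L).ncard

/-! ### Representable pairs and the genus-correspondence -/

/-- `φ` is a representation `Mⁿ → N`: it multiplies the quadratic form by `n` and maps `M`
into `N`. -/
def IsRepresentation {V W : Type*} [AddCommGroup V] [Module ℚ V] [AddCommGroup W] [Module ℚ W]
    (n : ℕ) (QN : QuadraticForm ℚ V) (N : Submodule ℤ V)
    (QM : QuadraticForm ℚ W) (M : Submodule ℤ W) (φ : W →ₗ[ℚ] V) : Prop :=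
  (∀ x, QN (φ x) = n * QM x) ∧ M.map (φ.restrictScalars ℤ) ≤ N

/-- `([N], [M])` is a representable pair by scaling `n`: there is a representation
`φ : Mⁿ → N` with `[N : φ(Mⁿ)] = n`. -/
def IsRepresentablePair {V W : Type*} [AddCommGroup V] [Module ℚ V] [AddCommGroup W] [Module ℚ W]
    (n : ℕ) (QN : QuadraticForm ℚ V) (N : Submodule ℤ V)
    (QM : QuadraticForm ℚ W) (M : Submodule ℤ W) : Prop :=
  ∃ φ : W →ₗ[ℚ] V, IsRepresentation n QN N QM M φ ∧
    (M.map (φ.restrictScalars ℤ)).toAddSubgroup.relIndex N.toAddSubgroup = n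

/-- The set of all representable pairs by scaling `n` in `gen(N) × gen(M)`. -/
def fullCorrespondence {V W : Type*} [AddCommGroup V] [Module ℚ V] [AddCommGroup W] [Module ℚ W]
    (n : ℕ) (QN : QuadraticForm ℚ V) (N : Submodule ℤ V)
    (QM : QuadraticForm ℚ W) (M : Submodule ℤ W) : Set (Submodule ℤ V × Submodule ℤ W) :=
  {P | P.1 ∈ gen QN N ∧ P.2 ∈ gen QM M ∧ IsRepresentablePair n QN P.1 QM P.2}

/-- The correspondence `C` respects spinor genus. -/
def RespectsSpinorGenus {V W : Type*} [AddCommGroup V] [Module ℚ V] [AddCommGroup W] [Module ℚ W]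
    (QN : QuadraticForm ℚ V) (QM : QuadraticForm ℚ W)
    (C : Set (Submodule ℤ V × Submodule ℤ W)) : Prop :=
  ∀ P₁ ∈ C, ∀ P₂ ∈ C, P₁.1 ∈ spn QN P₂.1 ↔ P₁.2 ∈ spn QM P₂.2

/-! ### The lattice `L_{N,M}` -/

/-- The `½ℤ_p`-modular component in a Jordan decomposition of the ternary lattice `L_p` has rank
two: `L_p` has a `ℤ_p`-basis `z₀, z₁, z₂` with `z₂` orthogonal to `z₀, z₁`, the Gram matrix
`(B(zᵢ, zⱼ))` of `z₀, z₁` is `½` times a matrix in `GL₂(ℤ_p)`, and `ℤ_p z₂` is not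
`½ℤ_p`-modular. -/
def HalfModularRankTwo {V : Type*} [AddCommGroup V] [Module ℚ V] (p : ℕ) [Fact p.Prime]
    (Q : QuadraticForm ℚ V) (L : Submodule ℤ V) : Prop :=
  ∃ (z : Module.Basis (Fin 3) ℤ_[p] (localization p L)) (G : Matrix (Fin 2) (Fin 2) ℤ_[p]),
    (∀ i : Fin 2, QuadraticMap.polar (localForm p Q) (z i.castSucc) (z 2) = 0) ∧
    (∀ i j : Fin 2,
      QuadraticMap.polar (localForm p Q) (z i.castSucc) (z j.castSucc) = (G i j : ℚ_[p])) ∧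
    IsUnit G.det ∧
    ‖QuadraticMap.polar (localForm p Q) (z 2) (z 2)‖ ≠ 1

open Classical in
/-- `n₂`: the product of the primes `p ∣ n` for which the `½ℤ_p`-modular component of `N_p` has
rank two. -/
def n₂ {V : Type*} [AddCommGroup V] [Module ℚ V] (n : ℕ)
    (Q : QuadraticForm ℚ V) (N : Submodule ℤ V) : ℕ :=
  ∏ p ∈ n.primeFactors with ∃ h : p.Prime, @HalfModularRankTwo V _ _ p ⟨h⟩ Q N, p

/-- `n₁`: the integer with `n = n₁ n₂`. -/
def n₁ {V : Type*} [AddCommGroup V] [Module ℚ V] (n : ℕ)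
    (Q : QuadraticForm ℚ V) (N : Submodule ℤ V) : ℕ :=
  n / n₂ n Q N

/-- `n₂(e)`: the product of the primes `q ∣ n₂` with `ord_q (4 dN)` even. -/
def n₂e {V : Type*} [AddCommGroup V] [Module ℚ V] (n : ℕ)
    (Q : QuadraticForm ℚ V) {N : Submodule ℤ V} (x : Module.Basis (Fin 3) ℤ N) : ℕ :=
  ∏ q ∈ (n₂ n Q N).primeFactors with Even (padicValRat q (4 * discr Q x)), q

/-- The basis `x₁, x₂, x₃` of `N` is adapted to `φ : Mⁿ → N`:
`φ(Mⁿ) = ℤ x₁ + ℤ x₂ + ℤ (n x₃)`. -/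
def IsAdaptedBasis {V W : Type*} [AddCommGroup V] [Module ℚ V] [AddCommGroup W] [Module ℚ W]
    (n : ℕ) {N : Submodule ℤ V} (M : Submodule ℤ W) (φ : W →ₗ[ℚ] V)
    (x : Module.Basis (Fin 3) ℤ N) : Prop :=
  M.map (φ.restrictScalars ℤ) = Submodule.span ℤ {(x 0 : V), (x 1 : V), n • (x 2 : V)}

/-- `g_{N,M} = g(L_{N,M})`, where `L_{N,M}` is the lattice `ℤ x₁ + ℤ x₂ + ℤ (n₁ n₂(e) x₃)` with its
form scaled by `1 / (n₁ n₂(e))`, for an adapted basis `x₁, x₂, x₃` of `N`. -/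
def gNM {V : Type*} [AddCommGroup V] [Module ℚ V] (n : ℕ)
    (Q : QuadraticForm ℚ V) {N : Submodule ℤ V} (x : Module.Basis (Fin 3) ℤ N) : ℕ :=
  numSpinorGenera (((n₁ n Q N * n₂e n Q x : ℕ) : ℚ)⁻¹ • Q)
    (Submodule.span ℤ {(x 0 : V), (x 1 : V), (n₁ n Q N * n₂e n Q x) • (x 2 : V)})

end TernaryLattice

end

/-!
Write `O'_p` for the group of rotations of `V_p` of spinor norm one and `O(K)` for the stabiliser
of a local lattice `K`. The spinor genera in the genus of a lattice `L` on `V` are the cosets, in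
the group `A` of adelic isometries, of `H_L = O(V) ∏ O'_p O(L_p)`; this subgroup contains all
commutators, because isometries are products of reflections. So `g(L) = [A : H_L ∩ A]`
(`numSpinorGenera_eq_relIndex`), and this index is finite by reduction theory
(`finite_spinorGenera`). Similitudes and scaling of the form change none of this, so `M` may be
replaced by `φ(M)`, a lattice on the space of `N` (`numSpinorGenera_mapLattice`).

The local input concerns the primes `p ∣ n`. Either `N_p` splits off a hyperbolic plane and
`N_p = ⟨e, f, z⟩`, `M_p = ⟨e, p f, z⟩` with `B(e, f) = 1/2`; this is the case where the
`½ℤ_p`-modular component has rank two. Then, with `c = Q(z)`, the reflections in `z` and in the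
vectors `e + u f` give `O'_p O(N_p) = O(V_p)` when `ord_p c` is odd and, after `f` is replaced by
`p f`, `O'_p O(M_p) = O(V_p)` when `ord_p c` is even (`spinorStabilizer_eq_top`). Or the form modulo
`p` is a unit times the square of the third coordinate, `M_p` is the set of vectors of `N_p` whose
length is divisible by `p`, and `O(N_p) ⊆ O(M_p)`. The lattice `L = L_{N,M}` has `L_p = M_p` or
`L_p = N_p` according to whether `p ∣ n₁ n₂(e)`, and that choice makes `O'_p O(L_p)` contain both
`O'_p O(N_p)` and `O'_p O(M_p)` (`spinorStabilizer_le`). Globally `H_N, H_M ≤ H_L`, while `H_L ∩ A`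
is generated by `H_N ∩ A` and `H_M ∩ A`. As `[A : H_N ∩ A]` and `[A : H_M ∩ A]` are equal and
finite, `g(N) = g(L)` holds if and only if `H_N ∩ A = H_M ∩ A`
(`numSpinorGenera_eq_scaledLattice_iff`).

On the other side, the stabiliser of `N_p` acts transitively on the isometric copies of `M_p` inside
`N_p` (`exists_stabilizer_localAct_eq`). Therefore every representable pair in the two genera is, up
to a global isometry, of the form `(s N, s M)` with `s ∈ A`, and all such pairs are representable.
The correspondence respects spinor genus exactly when `s ∈ H_N` and `s ∈ H_M` are equivalent for
`s ∈ A` (`respectsSpinorGenus_iff`), which is the same condition `H_N ∩ A = H_M ∩ A`.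

An adapted basis exists because the elementary divisors of a sublattice of square-free index are
pairwise coprime and can be combined into one (`exists_basis_mem_iff_dvd_repr`).
-/

noncomputable section

namespace TernaryLattice

/-! ### Orthogonal groups and the spinor kernel -/

section Orthogonal

variable {K : Type*} [Field K] {X : Type*} [AddCommGroup X] [Module K X]

/-- The orthogonal group `O(X, Q)`, as a subgroup of the linear automorphisms of `X`. -/
def orthogonalGroup (Q : QuadraticForm K X) : Subgroup (X ≃ₗ[K] X) where
  carrier := {f | ∀ x, Q (f x) = Q x}
  mul_mem' {f g} hf hg x := by rw [LinearEquiv.mul_apply, hf, hg]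
  one_mem' _ := rfl
  inv_mem' {f} hf x := by
    rw [← hf (f⁻¹ x)]
    exact congrArg Q (f.apply_symm_apply x)

/-- An element of the orthogonal group as an isometry in the sense of Mathlib. -/
def toIsometryEquiv {Q : QuadraticForm K X} (σ : orthogonalGroup Q) : Q.IsometryEquiv Q :=
  { (σ : X ≃ₗ[K] X) with map_app' := σ.2 }

/-- An isometry in the sense of Mathlib as an element of the orthogonal group. -/
def ofIsometryEquiv {Q : QuadraticForm K X} (σ : Q.IsometryEquiv Q) : orthogonalGroup Q :=
  ⟨σ.toLinearEquiv, σ.map_app'⟩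

theorem polar_orthogonalGroup {Q : QuadraticForm K X} {f : X ≃ₗ[K] X}
    (hf : f ∈ orthogonalGroup Q) (x y : X) :
    QuadraticMap.polar Q (f x) (f y) = QuadraticMap.polar Q x y := by
  rw [QuadraticMap.polar, QuadraticMap.polar, ← map_add, hf, hf, hf]

theorem reflection_apply (Q : QuadraticForm K X) (v x : X) :
    reflection Q v x = x - ((Q v)⁻¹ * QuadraticMap.polar Q v x) • v := by
  simp [reflection]

theorem map_reflection (Q : QuadraticForm K X) {v : X} (hv : Q v ≠ 0) (x : X) :
    Q (reflection Q v x) = Q x := by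
  rw [reflection_apply, sub_eq_add_neg, ← neg_smul, QuadraticMap.map_add Q, QuadraticMap.map_smul,
    QuadraticMap.polar_smul_right, QuadraticMap.polar_comm Q x v, smul_eq_mul, smul_eq_mul]
  field_simp
  ring

theorem reflection_reflection (Q : QuadraticForm K X) {v : X} (hv : Q v ≠ 0) (x : X) :
    reflection Q v (reflection Q v x) = x := by
  rw [reflection_apply Q v (reflection Q v x), reflection_apply, QuadraticMap.polar_sub_right,
    QuadraticMap.polar_smul_right, QuadraticMap.polar_self, sub_sub, ← add_smul]
  have : (Q v)⁻¹ * QuadraticMap.polar Q v x + (Q v)⁻¹ * (QuadraticMap.polar Q v x -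
      ((Q v)⁻¹ * QuadraticMap.polar Q v x) • 2 • Q v) = 0 := by
    simp only [smul_eq_mul, nsmul_eq_mul, Nat.cast_ofNat]
    field_simp
    ring
  rw [this, zero_smul, sub_zero]

theorem reflection_mul_reflection (Q : QuadraticForm K X) {v : X} (hv : Q v ≠ 0) :
    reflection Q v * reflection Q v = 1 :=
  LinearMap.ext fun x => reflection_reflection Q hv x

/-- The reflection in an anisotropic vector, as an element of the orthogonal group. -/
def reflectionEquiv (Q : QuadraticForm K X) (v : X) (hv : Q v ≠ 0) : orthogonalGroup Q :=
  ⟨LinearEquiv.ofInvolutive (reflection Q v) (reflection_reflection Q hv),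
    fun x => map_reflection Q hv x⟩

@[simp]
theorem reflectionEquiv_apply (Q : QuadraticForm K X) (v : X) (hv : Q v ≠ 0) (x : X) :
    (reflectionEquiv Q v hv : X ≃ₗ[K] X) x = reflection Q v x := rfl

theorem reflection_self (Q : QuadraticForm K X) {v : X} (hv : Q v ≠ 0) :
    reflection Q v v = -v := by
  rw [reflection_apply, QuadraticMap.polar_self, nsmul_eq_mul, mul_left_comm, inv_mul_cancel₀ hv,
    Nat.cast_ofNat, mul_one, two_smul]
  abel

theorem reflection_of_polar_eq_zero (Q : QuadraticForm K X) {v x : X}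
    (h : QuadraticMap.polar Q v x = 0) : reflection Q v x = x := by
  rw [reflection_apply, h, mul_zero, zero_smul, sub_zero]

/-- Two vectors of the same length are exchanged by the reflection in their difference. -/
theorem reflection_sub (Q : QuadraticForm K X) {w v : X} (h : Q w = Q v) (hne : Q (w - v) ≠ 0) :
    reflection Q (w - v) w = v := by
  have h1 : QuadraticMap.polar Q (w - v) w = Q (w - v) := by
    have h2 : Q (w - v) = Q w + Q v - QuadraticMap.polar Q w v := by
      rw [sub_eq_add_neg, QuadraticMap.map_add Q, QuadraticMap.map_neg, QuadraticMap.polar_neg_right]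
      ring
    rw [QuadraticMap.polar_sub_left, QuadraticMap.polar_self, h2, QuadraticMap.polar_comm Q v w,
      two_nsmul, h]
  rw [reflection_apply, h1, inv_mul_cancel₀ hne, one_smul, sub_sub_cancel]

theorem reflection_prod_mul_reverse (Q : QuadraticForm K X) {l : List X} (hl : ∀ v ∈ l, Q v ≠ 0) :
    (l.map (reflection Q)).prod * (l.reverse.map (reflection Q)).prod = 1 := by
  induction l with
  | nil => simp
  | cons a l ih =>
    have h1 := ih fun v hv => hl v (List.mem_cons_of_mem _ hv)
    have h2 := reflection_mul_reflection Q (hl a List.mem_cons_self)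
    simp only [List.map_cons, List.prod_cons, List.reverse_cons, List.map_append, List.prod_append,
      List.map_nil, List.prod_nil, mul_one]
    rw [mul_assoc, ← mul_assoc (List.prod _) (List.prod _), h1, one_mul, h2]

/-- If an isometry is the product of a list of reflections, its inverse is the product of the
reversed list. -/
theorem coe_inv_eq_reflection_prod {Q : QuadraticForm K X} {σ : orthogonalGroup Q} {l : List X}
    (hl : ∀ v ∈ l, Q v ≠ 0)
    (h : ((σ : X ≃ₗ[K] X) : Module.End K X) = (l.map (reflection Q)).prod) :
    (((σ⁻¹ : orthogonalGroup Q) : X ≃ₗ[K] X) : Module.End K X) =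
      (l.reverse.map (reflection Q)).prod := by
  have h1 := reflection_prod_mul_reverse Q hl
  rw [← h] at h1
  have h2 : (((σ⁻¹ : orthogonalGroup Q) : X ≃ₗ[K] X) : Module.End K X) *
      ((σ : X ≃ₗ[K] X) : Module.End K X) = 1 :=
    LinearMap.ext fun x => (σ : X ≃ₗ[K] X).symm_apply_apply x
  calc _ = (((σ⁻¹ : orthogonalGroup Q) : X ≃ₗ[K] X) : Module.End K X) * 1 := (mul_one _).symm
    _ = _ := by rw [← h1, ← mul_assoc, h2, one_mul]

/-- The group `O'` of rotations of spinor norm one, as a subgroup of the orthogonal group. -/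
def spinorSubgroup (Q : QuadraticForm K X) : Subgroup (orthogonalGroup Q) where
  carrier := {σ | ∃ l : List X, Even l.length ∧ (∀ v ∈ l, Q v ≠ 0) ∧ IsSquare (l.map Q).prod ∧
    ((σ : X ≃ₗ[K] X) : Module.End K X) = (l.map (reflection Q)).prod}
  mul_mem' := by
    rintro σ τ ⟨l, h1, h2, h3, h4⟩ ⟨m, k1, k2, k3, k4⟩
    refine ⟨l ++ m, by simpa using h1.add k1, ?_, ?_, ?_⟩
    · intro v hv
      rcases List.mem_append.1 hv with hv | hv
      exacts [h2 v hv, k2 v hv]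
    · simpa using h3.mul k3
    · rw [List.map_append, List.prod_append, ← h4, ← k4]
      rfl
  one_mem' := ⟨[], by simp, by simp, by simp, rfl⟩
  inv_mem' := by
    rintro σ ⟨l, h1, h2, h3, h4⟩
    refine ⟨l.reverse, by simpa using h1, by simpa using h2, ?_, coe_inv_eq_reflection_prod h2 h4⟩
    rw [List.map_reverse, List.prod_reverse]
    exact h3

/-- `Q` is diagonalised, with non-zero diagonal entries, by the basis `b`. -/
def IsDiagonal (Q : QuadraticForm K X) {ι : Type*} (b : Module.Basis ι K X) : Prop :=
  (∀ i j, i ≠ j → QuadraticMap.polar Q (b i) (b j) = 0) ∧ ∀ i, Q (b i) ≠ 0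

/-- A weak form of the Cartan–Dieudonné theorem: isometries are products of reflections. -/
theorem exists_eq_reflection_prod {Q : QuadraticForm K X} (h2 : (2 : K) ≠ 0) {n : ℕ}
    {b : Module.Basis (Fin n) K X} (hb : IsDiagonal Q b) (σ : orthogonalGroup Q) :
    ∃ l : List X, (∀ v ∈ l, Q v ≠ 0) ∧
      ((σ : X ≃ₗ[K] X) : Module.End K X) = (l.map (reflection Q)).prod := by
  -- downward induction on the number of basis vectors fixed by the isometry
  suffices H : ∀ k ≤ n, ∀ σ : orthogonalGroup Q,
      (∀ i : Fin n, (i : ℕ) < n - k → (σ : X ≃ₗ[K] X) (b i) = b i) →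
      ∃ l : List X, (∀ v ∈ l, Q v ≠ 0) ∧
        ((σ : X ≃ₗ[K] X) : Module.End K X) = (l.map (reflection Q)).prod from
    H n le_rfl σ (by simp)
  intro k
  induction k with
  | zero =>
    intro _ σ hσ
    refine ⟨[], by simp, ?_⟩
    refine b.ext fun i => ?_
    simpa using hσ i (by simp)
  | succ k ih =>
    intro hk σ hσ
    let j : Fin n := ⟨n - (k + 1), by omega⟩
    set w := (σ : X ≃ₗ[K] X) (b j) with hw
    have hQw : Q w = Q (b j) := σ.2 _
    have hpw : ∀ i : Fin n, (i : ℕ) < n - (k + 1) → QuadraticMap.polar Q w (b i) = 0 := by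
      intro i hi
      have : QuadraticMap.polar Q w (b i) = QuadraticMap.polar Q (b j) (b i) := by
        conv_lhs => rw [← hσ i hi]
        exact polar_orthogonalGroup σ.2 _ _
      rw [this]
      refine hb.1 _ _ fun h => ?_
      have := congrArg Fin.val h
      simp only [j] at this
      omega
    have hpv : ∀ i : Fin n, (i : ℕ) < n - (k + 1) → QuadraticMap.polar Q (b j) (b i) = 0 := by
      intro i hi
      refine hb.1 _ _ fun h => ?_
      have := congrArg Fin.val h
      simp only [j] at this
      omega
    -- it suffices to move `w` back to `b j` by reflections fixing the previous vectors
    suffices H : ∃ m : List X, (∀ v ∈ m, Q v ≠ 0) ∧ ∃ τ : orthogonalGroup Q,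
        ((τ : X ≃ₗ[K] X) : Module.End K X) = (m.map (reflection Q)).prod ∧
        (τ : X ≃ₗ[K] X) w = b j ∧
        ∀ i : Fin n, (i : ℕ) < n - (k + 1) → (τ : X ≃ₗ[K] X) (b i) = b i by
      obtain ⟨m, hm, τ, hτ, hτw, hτi⟩ := H
      obtain ⟨l, hl, hl'⟩ := ih (by omega) (τ * σ) (by
        intro i hi
        change (τ : X ≃ₗ[K] X) ((σ : X ≃ₗ[K] X) (b i)) = b i
        by_cases hij : (i : ℕ) < n - (k + 1)
        · rw [hσ i hij, hτi i hij]
        · have : i = j := Fin.ext (by simp only [j]; omega)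
          rw [this, ← hw, hτw])
      refine ⟨m.reverse ++ l, ?_, ?_⟩
      · intro v hv
        rcases List.mem_append.1 hv with hv | hv
        exacts [hm v (List.mem_reverse.1 hv), hl v hv]
      · rw [List.map_append, List.prod_append, ← hl', ← coe_inv_eq_reflection_prod hm hτ]
        refine LinearMap.ext fun x => ?_
        exact ((τ : X ≃ₗ[K] X).symm_apply_apply _).symm
    by_cases hne : Q (w - b j) = 0
    · have hne' : Q (w - -b j) ≠ 0 := by
        intro h0
        have e1 : Q (w - b j) = Q w + Q (b j) - QuadraticMap.polar Q w (b j) := by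
          rw [sub_eq_add_neg, QuadraticMap.map_add Q, QuadraticMap.map_neg,
            QuadraticMap.polar_neg_right]
          ring
        have e2 : Q (w - -b j) = Q w + Q (b j) + QuadraticMap.polar Q w (b j) := by
          rw [sub_neg_eq_add, QuadraticMap.map_add Q]
        have : (2 * 2) * Q (b j) = 0 := by
          linear_combination h0 + hne - e1 - e2 - 2 * hQw
        exact hb.2 j ((mul_eq_zero.1 this).resolve_left (mul_ne_zero h2 h2))
      refine ⟨[b j, w - -b j], by
        intro v hv
        simp only [List.mem_cons, List.not_mem_nil, or_false] at hv
        rcases hv with rfl | rfl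
        exacts [hb.2 j, hne'],
        reflectionEquiv Q (b j) (hb.2 j) * reflectionEquiv Q _ hne', ?_, ?_, ?_⟩
      · simp only [List.map_cons, List.map_nil, List.prod_cons, List.prod_nil, mul_one]
        rfl
      · change reflection Q (b j) (reflection Q (w - -b j) w) = b j
        rw [reflection_sub Q (by rw [QuadraticMap.map_neg, hQw]) hne', map_neg,
          reflection_self Q (hb.2 j), neg_neg]
      · intro i hi
        change reflection Q (b j) (reflection Q (w - -b j) (b i)) = b i
        rw [reflection_of_polar_eq_zero Q (v := w - -b j), reflection_of_polar_eq_zero Q (hpv i hi)]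
        rw [QuadraticMap.polar_sub_left, QuadraticMap.polar_neg_left, hpw i hi, hpv i hi]
        simp
    · refine ⟨[w - b j], by simpa using hne, reflectionEquiv Q _ hne, ?_, ?_, ?_⟩
      · simp only [List.map_cons, List.map_nil, List.prod_cons, List.prod_nil, mul_one]
        rfl
      · exact reflection_sub Q hQw hne
      · intro i hi
        refine reflection_of_polar_eq_zero Q ?_
        rw [QuadraticMap.polar_sub_left, hpw i hi, hpv i hi, sub_zero]

/-- Commutators have spinor norm one: in `σ τ σ⁻¹ τ⁻¹` every reflection occurs twice. -/
theorem commutator_le_spinorSubgroup {Q : QuadraticForm K X} (h2 : (2 : K) ≠ 0) {n : ℕ}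
    {b : Module.Basis (Fin n) K X} (hb : IsDiagonal Q b) :
    commutator (orthogonalGroup Q) ≤ spinorSubgroup Q := by
  rw [commutator_def, Subgroup.commutator_le]
  intro σ _ τ _
  obtain ⟨l, hl, hl'⟩ := exists_eq_reflection_prod h2 hb σ
  obtain ⟨m, hm, hm'⟩ := exists_eq_reflection_prod h2 hb τ
  refine ⟨l ++ m ++ l.reverse ++ m.reverse, ?_, ?_, ?_, ?_⟩
  · simp only [List.length_append, List.length_reverse]
    exact ⟨l.length + m.length, by ring⟩
  · intro v hv
    simp only [List.mem_append, List.mem_reverse] at hv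
    rcases hv with ((hv | hv) | hv) | hv
    exacts [hl v hv, hm v hv, hl v hv, hm v hv]
  · simp only [List.map_append, List.prod_append, List.map_reverse, List.prod_reverse]
    exact ⟨(l.map Q).prod * (m.map Q).prod, by ring⟩
  · simp only [List.map_append, List.prod_append]
    rw [← hl', ← hm', ← coe_inv_eq_reflection_prod hl hl', ← coe_inv_eq_reflection_prod hm hm']
    rfl

end Orthogonal

/-! ### Lattices and their completions -/

section Lattices

variable {V : Type*} [AddCommGroup V] [Module ℚ V]

/-- A full lattice in a three-dimensional space is spanned by a basis of the space. -/
theorem exists_basis_of_isLattice (h3 : Module.finrank ℚ V = 3) (L : Submodule ℤ V)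
    [Submodule.IsLattice ℚ L] :
    ∃ b : Module.Basis (Fin 3) ℚ V, L = Submodule.span ℤ (Set.range b) := by
  have hV : Module.Finite ℚ V := Module.finite_of_finrank_pos (by omega)
  have hT : Module.IsTorsionFree ℤ V := Module.IsTorsionFree.trans ℚ
  have hr : Module.finrank ℤ L = 3 := by
    rw [Module.finrank, Submodule.IsLattice.rank' ℚ L, ← h3, Module.finrank]
  let x : Module.Basis (Fin 3) ℤ L := Module.finBasisOfFinrankEq ℤ L hr
  refine ⟨x.extendOfIsLattice ℚ, ?_⟩
  have : Set.range (x.extendOfIsLattice ℚ) = L.subtype '' Set.range x := by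
    rw [← Set.range_comp]
    congr 1
    ext i
    simp
  rw [this, Submodule.span_image, x.span_eq, Submodule.map_top, Submodule.range_subtype]

theorem isLattice_span_basis (b : Module.Basis (Fin 3) ℚ V) :
    Submodule.IsLattice ℚ (Submodule.span ℤ (Set.range b)) where
  fg := Submodule.fg_span (Set.finite_range b)
  span_eq_top := by
    rw [Submodule.span_span_of_tower]
    exact b.span_eq

theorem mem_span_basis_int {b : Module.Basis (Fin 3) ℚ V} {v : V} :
    v ∈ Submodule.span ℤ (Set.range b) ↔ ∀ i, ∃ k : ℤ, (k : ℚ) = b.repr v i := by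
  rw [Module.Basis.mem_span_iff_repr_mem]
  simp

theorem mem_span_basis_padic {p : ℕ} [Fact p.Prime] {X : Type*} [AddCommGroup X]
    [Module ℚ_[p] X] [Module ℤ_[p] X] [IsScalarTower ℤ_[p] ℚ_[p] X]
    {e : Module.Basis (Fin 3) ℚ_[p] X} {v : X} :
    v ∈ Submodule.span ℤ_[p] (Set.range e) ↔ ∀ i, ‖e.repr v i‖ ≤ 1 := by
  rw [Module.Basis.mem_span_iff_repr_mem]
  refine forall_congr' fun i => ⟨?_, fun h => ⟨⟨_, h⟩, rfl⟩⟩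
  rintro ⟨k, hk⟩
  rw [← hk]
  exact k.2

/-- The `ℚ_p`-basis of `V_p` given by a basis of `V`. -/
abbrev localBasis (p : ℕ) [Fact p.Prime] (b : Module.Basis (Fin 3) ℚ V) :
    Module.Basis (Fin 3) ℚ_[p] (ℚ_[p] ⊗[ℚ] V) := b.baseChange ℚ_[p]

theorem localization_span (p : ℕ) [Fact p.Prime] (s : Set V) :
    localization p (Submodule.span ℤ s) =
      Submodule.span ℤ_[p] ((fun v : V => (1 : ℚ_[p]) ⊗ₜ[ℚ] v) '' s) := by
  refine le_antisymm (Submodule.span_le.2 ?_) (Submodule.span_mono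
    (Set.image_mono Submodule.subset_span))
  rintro _ ⟨v, hv, rfl⟩
  let g : V →ₗ[ℤ] ℚ_[p] ⊗[ℚ] V := (TensorProduct.mk ℚ ℚ_[p] V 1).restrictScalars ℤ
  have h1 : Submodule.span ℤ s ≤ ((Submodule.span ℤ_[p]
      ((fun v : V => (1 : ℚ_[p]) ⊗ₜ[ℚ] v) '' s)).toAddSubgroup.toIntSubmodule).comap g :=
    Submodule.span_le.2 fun w hw => Submodule.subset_span ⟨w, hw, rfl⟩
  exact h1 hv

theorem localization_span_basis (p : ℕ) [Fact p.Prime] (b : Module.Basis (Fin 3) ℚ V) :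
    localization p (Submodule.span ℤ (Set.range b)) =
      Submodule.span ℤ_[p] (Set.range (localBasis p b)) := by
  rw [localization_span, ← Set.range_comp]
  congr 2
  ext i
  simp [Function.comp]

theorem mem_localization_iff {p : ℕ} [Fact p.Prime] {b : Module.Basis (Fin 3) ℚ V}
    {v : ℚ_[p] ⊗[ℚ] V} :
    v ∈ localization p (Submodule.span ℤ (Set.range b)) ↔
      ∀ i, ‖(localBasis p b).repr v i‖ ≤ 1 := by
  rw [localization_span_basis, mem_span_basis_padic]

theorem tmul_mem_localization_iff {p : ℕ} [Fact p.Prime] {b : Module.Basis (Fin 3) ℚ V} {v : V} :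
    (1 : ℚ_[p]) ⊗ₜ[ℚ] v ∈ localization p (Submodule.span ℤ (Set.range b)) ↔
      ∀ i, ‖((b.repr v i : ℚ) : ℚ_[p])‖ ≤ 1 := by
  rw [mem_localization_iff]
  simp [Module.Basis.baseChange_repr_tmul, Rat.smul_def]

theorem tmul_mem_localization {p : ℕ} [Fact p.Prime] {L : Submodule ℤ V} {v : V} (hv : v ∈ L) :
    (1 : ℚ_[p]) ⊗ₜ[ℚ] v ∈ localization p L :=
  Submodule.subset_span ⟨v, hv, rfl⟩

theorem localization_mono (p : ℕ) [Fact p.Prime] {L L' : Submodule ℤ V} (h : L ≤ L') :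
    localization p L ≤ localization p L' :=
  Submodule.span_mono (Set.image_mono h)

/-- A rational number that is integral at `p` has denominator prime to `p`. -/
theorem not_dvd_den_of_norm_le_one {p : ℕ} [hp : Fact p.Prime] {q : ℚ} (h : ‖(q : ℚ_[p])‖ ≤ 1) :
    ¬ p ∣ q.den := by
  intro hd
  have h1 : ‖((q.den : ℕ) : ℚ_[p])‖ < 1 := Padic.norm_natCast_lt_one_iff.2 hd
  have h2 : ‖((q.num : ℤ) : ℚ_[p])‖ < 1 := by
    have : ((q.num : ℤ) : ℚ_[p]) = (q : ℚ_[p]) * ((q.den : ℕ) : ℚ_[p]) := by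
      exact_mod_cast (congrArg (fun t : ℚ => (t : ℚ_[p])) (Rat.mul_den_eq_num q)).symm
    rw [this, norm_mul]
    calc _ ≤ 1 * ‖((q.den : ℕ) : ℚ_[p])‖ := by gcongr
      _ < 1 := by rwa [one_mul]
  rw [Padic.norm_intCast_lt_one_iff] at h2
  have h3 : p ∣ q.num.natAbs := Int.natCast_dvd.1 h2
  exact hp.out.one_lt.ne' (Nat.dvd_one.1 (q.reduced ▸ Nat.dvd_gcd h3 hd))

theorem eq_intCast_of_forall_norm_le_one {q : ℚ}
    (h : ∀ (p : ℕ) [Fact p.Prime], ‖(q : ℚ_[p])‖ ≤ 1) : ∃ k : ℤ, (k : ℚ) = q := by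
  refine ⟨q.num, (Rat.eq_num_of_isInt ?_).symm⟩
  rw [Rat.isInt, beq_iff_eq]
  by_contra hne
  obtain ⟨p, hp, hd⟩ := Nat.exists_prime_and_dvd hne
  have : Fact p.Prime := ⟨hp⟩
  exact not_dvd_den_of_norm_le_one (h p) hd

/-- Lattices may be compared locally. -/
theorem le_of_forall_localization_le (h3 : Module.finrank ℚ V = 3) {L L' : Submodule ℤ V}
    [Submodule.IsLattice ℚ L']
    (h : ∀ (p : ℕ) [Fact p.Prime], localization p L ≤ localization p L') : L ≤ L' := by
  obtain ⟨b, rfl⟩ := exists_basis_of_isLattice h3 L'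
  intro v hv
  rw [mem_span_basis_int]
  intro i
  refine eq_intCast_of_forall_norm_le_one fun p _ => ?_
  exact tmul_mem_localization_iff.1 (h p (tmul_mem_localization hv)) i

theorem exists_nsmul_mem (h3 : Module.finrank ℚ V = 3) (L L' : Submodule ℤ V)
    [hL : Submodule.IsLattice ℚ L] [Submodule.IsLattice ℚ L'] :
    ∃ D : ℕ, D ≠ 0 ∧ ∀ x ∈ L, D • x ∈ L' := by
  obtain ⟨b, rfl⟩ := exists_basis_of_isLattice h3 L'
  obtain ⟨s, hs⟩ := hL.fg
  refine ⟨∏ v ∈ s, ∏ i, (b.repr v i).den, ?_, ?_⟩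
  · exact Finset.prod_ne_zero_iff.2 fun v _ => Finset.prod_ne_zero_iff.2 fun i _ => Rat.den_nz _
  · set D := ∏ v ∈ s, ∏ i, (b.repr v i).den with hD
    intro x hx
    rw [← hs] at hx
    have h1 : Submodule.span ℤ (s : Set V) ≤
        (Submodule.span ℤ (Set.range b)).comap (LinearMap.lsmul ℤ V D) := by
      refine Submodule.span_le.2 fun v hv => ?_
      change (D : ℤ) • v ∈ Submodule.span ℤ (Set.range b)
      rw [mem_span_basis_int]
      intro i
      obtain ⟨c, hc⟩ : (b.repr v i).den ∣ D :=
        (Finset.dvd_prod_of_mem (fun i => (b.repr v i).den) (Finset.mem_univ i)).trans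
          (Finset.dvd_prod_of_mem (fun v : V => ∏ i, (b.repr v i).den) (Finset.mem_coe.1 hv))
      refine ⟨(b.repr v i).num * c, ?_⟩
      rw [natCast_zsmul, map_nsmul, Finsupp.smul_apply, nsmul_eq_mul, hc]
      push_cast
      rw [← Rat.mul_den_eq_num]
      ring
    have := h1 hx
    change (D : ℤ) • x ∈ Submodule.span ℤ (Set.range b) at this
    rwa [natCast_zsmul] at this

theorem isLattice_of_nsmul_mem {L L' : Submodule ℤ V} [hL : Submodule.IsLattice ℚ L] {D D' : ℕ}
    (hD : D ≠ 0) (hD' : D' ≠ 0) (h : ∀ x ∈ L, D • x ∈ L') (h' : ∀ x ∈ L', D' • x ∈ L) :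
    Submodule.IsLattice ℚ L' where
  fg := by
    have hT : Module.IsTorsionFree ℤ V := Module.IsTorsionFree.trans ℚ
    have hn : IsNoetherian ℤ L := isNoetherian_of_fg_of_noetherian _ hL.fg
    let f : L' →ₗ[ℤ] L := LinearMap.codRestrict L ((LinearMap.lsmul ℤ V D').comp L'.subtype)
      fun x => by
        change (D' : ℤ) • (x : V) ∈ L
        rw [natCast_zsmul]
        exact h' x x.2
    have hf : Function.Injective f := by
      intro x y hxy
      have h1 : (D' : ℤ) • (x : V) = (D' : ℤ) • (y : V) := congrArg Subtype.val hxy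
      exact Subtype.ext (smul_right_injective V (Int.natCast_ne_zero.2 hD') h1)
    have := isNoetherian_of_injective f hf
    exact Module.Finite.iff_fg.1 inferInstance
  span_eq_top := by
    rw [eq_top_iff, ← hL.span_eq_top]
    refine Submodule.span_le.2 fun x hx => ?_
    have h1 : ((D : ℚ)⁻¹) • ((D : ℚ) • x) ∈ Submodule.span ℚ (L' : Set V) :=
      Submodule.smul_mem _ _ (Submodule.subset_span (by
        rw [Nat.cast_smul_eq_nsmul]
        exact h x hx))
    rwa [inv_smul_smul₀ (Nat.cast_ne_zero.2 hD)] at h1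

theorem localization_le_of_nsmul_mem {p : ℕ} [hp : Fact p.Prime] {L L' : Submodule ℤ V} {D : ℕ}
    (hD : ¬ p ∣ D) (h : ∀ x ∈ L, D • x ∈ L') : localization p L ≤ localization p L' := by
  refine Submodule.span_le.2 ?_
  rintro _ ⟨v, hv, rfl⟩
  have hu : IsUnit (D : ℤ_[p]) := by
    rw [PadicInt.isUnit_iff, PadicInt.norm_def]
    simpa using Padic.norm_natCast_eq_one_iff.2 ((Nat.Prime.coprime_iff_not_dvd hp.out).2 hD)
  obtain ⟨u, hu⟩ := hu
  have h1 : (u⁻¹ : ℤ_[p]ˣ) • ((D : ℤ_[p]) • ((1 : ℚ_[p]) ⊗ₜ[ℚ] v)) ∈ localization p L' := by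
    refine Submodule.smul_mem _ ((u⁻¹ : ℤ_[p]ˣ) : ℤ_[p]) ?_
    rw [Nat.cast_smul_eq_nsmul, ← TensorProduct.tmul_smul]
    exact tmul_mem_localization (h v hv)
  rw [← hu] at h1
  change u⁻¹ • (u • ((1 : ℚ_[p]) ⊗ₜ[ℚ] v)) ∈ _ at h1
  rwa [inv_smul_smul] at h1

/-- Two lattices on `V` have the same completion at almost all primes. -/
theorem exists_forall_localization_eq (h3 : Module.finrank ℚ V = 3) (L L' : Submodule ℤ V)
    [Submodule.IsLattice ℚ L] [Submodule.IsLattice ℚ L'] :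
    ∃ D : ℕ, D ≠ 0 ∧ ∀ (p : ℕ) [Fact p.Prime], ¬ p ∣ D → localization p L = localization p L' := by
  obtain ⟨D, hD, h⟩ := exists_nsmul_mem h3 L L'
  obtain ⟨D', hD', h'⟩ := exists_nsmul_mem h3 L' L
  refine ⟨D * D', mul_ne_zero hD hD', fun p _ hp => le_antisymm ?_ ?_⟩
  · exact localization_le_of_nsmul_mem (fun hd => hp (hd.mul_right _)) h
  · exact localization_le_of_nsmul_mem (fun hd => hp (hd.mul_left _)) h'

theorem exists_pow_smul_mem_span {p : ℕ} [hp : Fact p.Prime] {X : Type*} [AddCommGroup X]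
    [Module ℚ_[p] X] [Module ℤ_[p] X] [IsScalarTower ℤ_[p] ℚ_[p] X]
    (e e' : Module.Basis (Fin 3) ℚ_[p] X) :
    ∃ k : ℕ, ∀ x ∈ Submodule.span ℤ_[p] (Set.range e),
      (p : ℤ_[p]) ^ k • x ∈ Submodule.span ℤ_[p] (Set.range e') := by
  obtain ⟨k, hk⟩ := pow_unbounded_of_one_lt (∑ i, ∑ j, ‖e'.repr (e i) j‖)
    (Nat.one_lt_cast.2 hp.out.one_lt : (1 : ℝ) < p)
  refine ⟨k, fun x hx => ?_⟩
  have h1 : Submodule.span ℤ_[p] (Set.range e) ≤ (Submodule.span ℤ_[p] (Set.range e')).comap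
      (LinearMap.lsmul ℤ_[p] X ((p : ℤ_[p]) ^ k)) := by
    refine Submodule.span_le.2 ?_
    rintro _ ⟨i, rfl⟩
    change (p : ℤ_[p]) ^ k • e i ∈ Submodule.span ℤ_[p] (Set.range e')
    rw [mem_span_basis_padic]
    intro j
    have h2 : (p : ℤ_[p]) ^ k • e i = ((p : ℚ_[p]) ^ k) • e i := by
      rw [← algebraMap_smul ℚ_[p] ((p : ℤ_[p]) ^ k) (e i)]
      simp
    rw [h2, map_smul, Finsupp.smul_apply, smul_eq_mul, norm_mul, norm_pow, Padic.norm_p, inv_pow]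
    have h4 : ‖e'.repr (e i) j‖ ≤ (p : ℝ) ^ k := by
      refine le_trans ?_ hk.le
      refine le_trans ?_ (Finset.single_le_sum (f := fun i => ∑ j, ‖e'.repr (e i) j‖)
        (fun i _ => Finset.sum_nonneg fun j _ => norm_nonneg _) (Finset.mem_univ i))
      exact Finset.single_le_sum (f := fun j => ‖e'.repr (e i) j‖)
        (fun j _ => norm_nonneg _) (Finset.mem_univ j)
    exact inv_mul_le_one_of_le₀ h4 (by positivity)
  exact h1 hx

/-- The local image of a lattice under a linear automorphism is spanned by a basis. -/
theorem localImage_span_basis {p : ℕ} [Fact p.Prime] (b : Module.Basis (Fin 3) ℚ V)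
    (f : (ℚ_[p] ⊗[ℚ] V) ≃ₗ[ℚ_[p]] (ℚ_[p] ⊗[ℚ] V)) :
    localImage p (f : (ℚ_[p] ⊗[ℚ] V) →ₗ[ℚ_[p]] (ℚ_[p] ⊗[ℚ] V))
      (localization p (Submodule.span ℤ (Set.range b))) =
      Submodule.span ℤ_[p] (Set.range ((localBasis p b).map f)) := by
  rw [localImage, localization_span_basis, Submodule.map_span, ← Set.range_comp]
  congr 2

/-- The completion of a lattice at a single prime may be prescribed. -/
theorem exists_lattice_modify_at (h3 : Module.finrank ℚ V = 3) (L : Submodule ℤ V)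
    [Submodule.IsLattice ℚ L] (p : ℕ) [hp : Fact p.Prime]
    (f : (ℚ_[p] ⊗[ℚ] V) ≃ₗ[ℚ_[p]] (ℚ_[p] ⊗[ℚ] V)) :
    ∃ L' : Submodule ℤ V, Submodule.IsLattice ℚ L' ∧
      localization p L' = localImage p (f : (ℚ_[p] ⊗[ℚ] V) →ₗ[ℚ_[p]] (ℚ_[p] ⊗[ℚ] V))
        (localization p L) ∧
      ∀ (q : ℕ) [Fact q.Prime], q ≠ p → localization q L' = localization q L := by
  obtain ⟨b, rfl⟩ := exists_basis_of_isLattice h3 L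
  rw [localImage_span_basis]
  set e := localBasis p b with he
  set K := Submodule.span ℤ_[p] (Set.range (e.map f)) with hK
  set L := Submodule.span ℤ (Set.range b) with hL
  have hLe : localization p L = Submodule.span ℤ_[p] (Set.range e) := localization_span_basis p b
  obtain ⟨k₁, hk₁⟩ := exists_pow_smul_mem_span e (e.map f)
  obtain ⟨k₂, hk₂⟩ := exists_pow_smul_mem_span (e.map f) e
  obtain ⟨k, hk, hk'⟩ : ∃ k : ℕ, (∀ x ∈ localization p L, (p : ℤ_[p]) ^ k • x ∈ K) ∧
      ∀ x ∈ K, (p : ℤ_[p]) ^ k • x ∈ localization p L := by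
    refine ⟨k₁ + k₂, fun x hx => ?_, fun x hx => ?_⟩
    · rw [add_comm, pow_add, mul_smul]
      exact Submodule.smul_mem _ _ (hk₁ x (hLe ▸ hx))
    · rw [pow_add, mul_smul, hLe]
      exact Submodule.smul_mem _ _ (hk₂ x hx)
  have hcast : ∀ (j : ℕ) (v : V), (p : ℤ_[p]) ^ j • ((1 : ℚ_[p]) ⊗ₜ[ℚ] v) =
      (1 : ℚ_[p]) ⊗ₜ[ℚ] (p ^ j • v) := by
    intro j v
    rw [← Nat.cast_pow, Nat.cast_smul_eq_nsmul, ← TensorProduct.tmul_smul]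
  -- the vectors of `ℤ[1/p] L` that lie in `K`
  let L' : Submodule ℤ V :=
    { carrier := {v | (1 : ℚ_[p]) ⊗ₜ[ℚ] v ∈ K ∧ ∃ j : ℕ, p ^ j • v ∈ L}
      add_mem' := by
        rintro v w ⟨hv, i, hi⟩ ⟨hw, j, hj⟩
        refine ⟨by rw [TensorProduct.tmul_add]; exact add_mem hv hw, i + j, ?_⟩
        rw [smul_add]
        refine add_mem ?_ ?_
        · rw [pow_add, mul_comm, mul_smul]
          exact nsmul_mem hi _
        · rw [pow_add, mul_smul]
          exact nsmul_mem hj _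
      zero_mem' := ⟨by rw [TensorProduct.tmul_zero]; exact zero_mem _, 0, by simp⟩
      smul_mem' := by
        rintro c v ⟨hv, i, hi⟩
        refine ⟨?_, i, ?_⟩
        · rw [TensorProduct.tmul_smul]
          exact zsmul_mem hv c
        · rw [smul_comm]
          exact L.smul_mem c hi }
  have hmem : ∀ v, v ∈ L' ↔ (1 : ℚ_[p]) ⊗ₜ[ℚ] v ∈ K ∧ ∃ j : ℕ, p ^ j • v ∈ L := fun v => Iff.rfl
  have hLL' : ∀ x ∈ L, p ^ k • x ∈ L' := by
    intro x hx
    refine ⟨?_, 0, by simpa using nsmul_mem hx _⟩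
    rw [← hcast]
    exact hk _ (tmul_mem_localization hx)
  have hL'L : ∀ x ∈ L', p ^ k • x ∈ L := by
    rintro x ⟨hx, j, hj⟩
    have : Submodule.IsLattice ℚ L := isLattice_span_basis b
    have hle : Submodule.span ℤ {p ^ k • x} ≤ L := by
      refine le_of_forall_localization_le h3 fun q hq => ?_
      by_cases hqp : q = p
      · subst hqp
        rw [localization_span, Set.image_singleton, Submodule.span_singleton_le_iff_mem, ← hcast]
        exact hk' _ hx
      · refine localization_le_of_nsmul_mem (D := p ^ j) (fun hd => hqp ?_) ?_
        · exact (Nat.prime_dvd_prime_iff_eq hq.out hp.out).1 (hq.out.dvd_of_dvd_pow hd)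
        · intro y hy
          obtain ⟨c, rfl⟩ := Submodule.mem_span_singleton.1 hy
          rw [smul_comm, smul_comm (p ^ j)]
          exact L.smul_mem c (nsmul_mem hj _)
    exact hle (Submodule.mem_span_singleton_self _)
  have hpk : p ^ k ≠ 0 := pow_ne_zero _ hp.out.ne_zero
  have : Submodule.IsLattice ℚ L := isLattice_span_basis b
  refine ⟨L', isLattice_of_nsmul_mem hpk hpk hLL' hL'L, le_antisymm ?_ ?_, ?_⟩
  · refine Submodule.span_le.2 ?_
    rintro _ ⟨v, hv, rfl⟩
    exact ((hmem v).1 hv).1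
  · intro y hy
    have hy' := hk' y hy
    have hpne : (p : ℚ_[p]) ≠ 0 := Nat.cast_ne_zero.2 hp.out.ne_zero
    have hpow : ∀ (j : ℕ) (x : ℚ_[p] ⊗[ℚ] V), (p : ℤ_[p]) ^ j • x = (p : ℚ_[p]) ^ j • x := by
      intro j x
      rw [← algebraMap_smul ℚ_[p] ((p : ℤ_[p]) ^ j) x]
      simp
    rw [hpow, mem_localization_iff] at hy'
    -- approximate the coordinates of `p ^ k • y` by integers
    have happ : ∀ i, ∃ m : ℤ, ‖(p : ℚ_[p]) ^ k * e.repr y i - m‖ ≤ (p : ℝ) ^ (-(2 * k : ℕ) : ℤ) := by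
      intro i
      have h1 := hy' i
      rw [map_smul, Finsupp.smul_apply, smul_eq_mul] at h1
      obtain ⟨z, hz⟩ : ∃ z : ℤ_[p], (z : ℚ_[p]) = (p : ℚ_[p]) ^ k * e.repr y i := ⟨⟨_, h1⟩, rfl⟩
      refine ⟨(PadicInt.appr z (2 * k) : ℕ), ?_⟩
      have h2 := (PadicInt.norm_le_pow_iff_mem_span_pow _ (2 * k)).2 (PadicInt.appr_spec (2 * k) z)
      rw [PadicInt.norm_def, PadicInt.coe_sub, PadicInt.coe_natCast, hz] at h2
      exact h2
    choose m hm using happ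
    set v : V := ∑ i, ((m i : ℚ) * ((p : ℚ) ^ k)⁻¹) • b i with hv
    have hrepr : ∀ i, b.repr v i = (m i : ℚ) * ((p : ℚ) ^ k)⁻¹ := by
      intro i
      rw [hv, b.repr_sum_self]
    have hpk' : (p : ℚ) ^ k ≠ 0 := pow_ne_zero _ (Nat.cast_ne_zero.2 hp.out.ne_zero)
    set w := y - (1 : ℚ_[p]) ⊗ₜ[ℚ] v with hw
    have hwL : ((p : ℚ_[p]) ^ k)⁻¹ • w ∈ localization p L := by
      rw [mem_localization_iff]
      intro i
      have h1 : (localBasis p b).repr (((p : ℚ_[p]) ^ k)⁻¹ • w) i =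
          ((p : ℚ_[p]) ^ (2 * k))⁻¹ * ((p : ℚ_[p]) ^ k * e.repr y i - m i) := by
        rw [map_smul, Finsupp.smul_apply, hw, map_sub, Finsupp.sub_apply,
          Module.Basis.baseChange_repr_tmul, hrepr, smul_eq_mul, Rat.smul_def]
        push_cast
        field_simp
        rw [he]
        ring
      rw [h1, norm_mul, norm_inv, norm_pow, Padic.norm_p]
      calc _ ≤ ((p : ℝ)⁻¹ ^ (2 * k))⁻¹ * (p : ℝ) ^ (-(2 * k : ℕ) : ℤ) := by
            gcongr
            exact hm i
        _ = 1 := by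
            rw [inv_pow, inv_inv, zpow_neg, zpow_natCast]
            exact mul_inv_cancel₀ (pow_ne_zero _ (Nat.cast_ne_zero.2 hp.out.ne_zero))
    have hweq : w = (p : ℤ_[p]) ^ k • (((p : ℚ_[p]) ^ k)⁻¹ • w) := by
      rw [hpow, smul_inv_smul₀ (pow_ne_zero _ hpne)]
    have hwK : w ∈ K := by
      rw [hweq]
      exact hk _ hwL
    have hvL' : v ∈ L' := by
      refine ⟨?_, k, ?_⟩
      · have : (1 : ℚ_[p]) ⊗ₜ[ℚ] v = y - w := by rw [hw]; abel
        rw [this]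
        exact sub_mem hy hwK
      · rw [hL, mem_span_basis_int]
        intro i
        refine ⟨m i, ?_⟩
        rw [map_nsmul, Finsupp.smul_apply, hrepr, nsmul_eq_mul]
        push_cast
        field_simp
    have hyw : y = (1 : ℚ_[p]) ⊗ₜ[ℚ] v + w := by rw [hw]; abel
    rw [hyw]
    refine add_mem (tmul_mem_localization hvL') ?_
    have h4 : ∀ x ∈ localization p L, (p : ℤ_[p]) ^ k • x ∈ localization p L' := by
      intro x hx
      have h5 : localization p L ≤ (localization p L').comap
          (LinearMap.lsmul ℤ_[p] _ ((p : ℤ_[p]) ^ k)) := by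
        refine Submodule.span_le.2 ?_
        rintro _ ⟨u, hu, rfl⟩
        change (p : ℤ_[p]) ^ k • ((1 : ℚ_[p]) ⊗ₜ[ℚ] u) ∈ localization p L'
        rw [hcast]
        exact tmul_mem_localization (hLL' u hu)
      exact h5 hx
    rw [hweq]
    exact h4 _ hwL
  · intro q hq hqp
    have hnd : ¬ q ∣ p ^ k := fun hd =>
      hqp ((Nat.prime_dvd_prime_iff_eq hq.out hp.out).1 (hq.out.dvd_of_dvd_pow hd))
    exact le_antisymm (localization_le_of_nsmul_mem hnd hL'L)
      (localization_le_of_nsmul_mem hnd hLL')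

end Lattices

/-! ### Adelic isometries and spinor genera -/

section LocalForms

variable {V W : Type*} [AddCommGroup V] [Module ℚ V] [AddCommGroup W] [Module ℚ W]

theorem localForm_tmul (p : ℕ) [Fact p.Prime] (Q : QuadraticForm ℚ V) (v : V) :
    localForm p Q ((1 : ℚ_[p]) ⊗ₜ[ℚ] v) = ((Q v : ℚ) : ℚ_[p]) := by
  rw [localForm, QuadraticForm.baseChange_tmul, mul_one, Rat.smul_def, mul_one]

theorem polar_localForm_tmul (p : ℕ) [Fact p.Prime] (Q : QuadraticForm ℚ V) (v w : V) :
    QuadraticMap.polar (localForm p Q) ((1 : ℚ_[p]) ⊗ₜ[ℚ] v) ((1 : ℚ_[p]) ⊗ₜ[ℚ] w) =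
      ((QuadraticMap.polar Q v w : ℚ) : ℚ_[p]) := by
  rw [QuadraticMap.polar, QuadraticMap.polar, ← TensorProduct.tmul_add, localForm_tmul,
    localForm_tmul, localForm_tmul]
  push_cast
  rfl

/-- Similitudes extend to the completions. -/
theorem localForm_baseChange (p : ℕ) [Fact p.Prime] {QV : QuadraticForm ℚ V}
    {QW : QuadraticForm ℚ W} {c : ℚ} {f : W →ₗ[ℚ] V} (h : ∀ x, QV (f x) = c * QW x)
    (x : ℚ_[p] ⊗[ℚ] W) : localForm p QV (f.baseChange ℚ_[p] x) = c * localForm p QW x := by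
  have : (localForm p QV).comp (f.baseChange ℚ_[p]) = (c : ℚ_[p]) • localForm p QW := by
    refine baseChange_ext fun m => ?_
    rw [QuadraticMap.comp_apply, LinearMap.baseChange_tmul, localForm_tmul, h,
      smul_apply, localForm_tmul]
    push_cast
    rfl
  exact congrArg (fun q : QuadraticForm ℚ_[p] (ℚ_[p] ⊗[ℚ] W) => q x) this

theorem polar_eq_two_mul_associated (Q : QuadraticForm ℚ V) (x y : V) :
    QuadraticMap.polar Q x y = 2 * QuadraticMap.associated Q x y := by
  have h := LinearMap.congr_fun (LinearMap.congr_fun (QuadraticMap.two_nsmul_associated ℚ Q) x) y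
  change 2 • QuadraticMap.associated Q x y = QuadraticMap.polar Q x y at h
  rw [← h, nsmul_eq_mul, Nat.cast_ofNat]

theorem exists_isDiagonal_of_posDef (h3 : Module.finrank ℚ V = 3) {Q : QuadraticForm ℚ V}
    (hQ : Q.PosDef) : ∃ b : Module.Basis (Fin 3) ℚ V, IsDiagonal Q b := by
  have hV : Module.Finite ℚ V := Module.finite_of_finrank_pos (by omega)
  obtain ⟨v, hv⟩ := LinearMap.BilinForm.exists_orthogonal_basis
    (B := QuadraticMap.associated Q) ⟨fun x y => QuadraticMap.associated_isSymm ℚ Q x y⟩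
  refine ⟨v.reindex (finCongr h3), fun i j hij => ?_, fun i => ?_⟩
  · have h1 := LinearMap.isOrthoᵢ_def.1 hv ((finCongr h3).symm i) ((finCongr h3).symm j)
      (fun h => hij ((finCongr h3).symm.injective h))
    rw [Module.Basis.reindex_apply, Module.Basis.reindex_apply, polar_eq_two_mul_associated,
      h1, mul_zero]
  · exact (hQ _ (Module.Basis.ne_zero _ i)).ne'

theorem IsDiagonal.localBasis {Q : QuadraticForm ℚ V} {b : Module.Basis (Fin 3) ℚ V}
    (hb : IsDiagonal Q b) (p : ℕ) [Fact p.Prime] :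
    IsDiagonal (localForm p Q) (localBasis p b) := by
  refine ⟨fun i j hij => ?_, fun i => ?_⟩
  · rw [Module.Basis.baseChange_apply, Module.Basis.baseChange_apply, polar_localForm_tmul,
      hb.1 i j hij, Rat.cast_zero]
  · rw [Module.Basis.baseChange_apply, localForm_tmul]
    exact Rat.cast_ne_zero.2 (hb.2 i)

end LocalForms

section Adelic

variable {V : Type*} [AddCommGroup V] [Module ℚ V]

instance (p : Nat.Primes) : Fact (p : ℕ).Prime := ⟨p.2⟩

/-- The group `O(V_p)`. -/
abbrev localGroup (p : ℕ) [Fact p.Prime] (Q : QuadraticForm ℚ V) :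
    Subgroup ((ℚ_[p] ⊗[ℚ] V) ≃ₗ[ℚ_[p]] (ℚ_[p] ⊗[ℚ] V)) := orthogonalGroup (localForm p Q)

/-- The image of a local lattice under an element of `O(V_p)`. -/
def localAct {p : ℕ} [Fact p.Prime] {Q : QuadraticForm ℚ V} (σ : localGroup p Q)
    (K : Submodule ℤ_[p] (ℚ_[p] ⊗[ℚ] V)) : Submodule ℤ_[p] (ℚ_[p] ⊗[ℚ] V) :=
  localImage p ((σ : (ℚ_[p] ⊗[ℚ] V) ≃ₗ[ℚ_[p]] (ℚ_[p] ⊗[ℚ] V)) :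
    (ℚ_[p] ⊗[ℚ] V) →ₗ[ℚ_[p]] (ℚ_[p] ⊗[ℚ] V)) K

theorem mem_localAct {p : ℕ} [Fact p.Prime] {Q : QuadraticForm ℚ V} {σ : localGroup p Q}
    {K : Submodule ℤ_[p] (ℚ_[p] ⊗[ℚ] V)} {v : ℚ_[p] ⊗[ℚ] V} :
    v ∈ localAct σ K ↔ ∃ w ∈ K, (σ : (ℚ_[p] ⊗[ℚ] V) ≃ₗ[ℚ_[p]] (ℚ_[p] ⊗[ℚ] V)) w = v := Iff.rfl

theorem localAct_mul {p : ℕ} [Fact p.Prime] {Q : QuadraticForm ℚ V} (σ τ : localGroup p Q)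
    (K : Submodule ℤ_[p] (ℚ_[p] ⊗[ℚ] V)) : localAct (σ * τ) K = localAct σ (localAct τ K) := by
  rw [localAct, localAct, localAct, localImage, localImage, localImage, ← Submodule.map_comp]
  rfl

@[simp]
theorem localAct_one {p : ℕ} [Fact p.Prime] {Q : QuadraticForm ℚ V}
    (K : Submodule ℤ_[p] (ℚ_[p] ⊗[ℚ] V)) : localAct (1 : localGroup p Q) K = K :=
  Submodule.map_id K

theorem localAct_eq_iff {p : ℕ} [Fact p.Prime] {Q : QuadraticForm ℚ V} {σ τ : localGroup p Q}
    {K K' : Submodule ℤ_[p] (ℚ_[p] ⊗[ℚ] V)} :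
    localAct σ K = localAct τ K' ↔ localAct (τ⁻¹ * σ) K = K' := by
  constructor
  · intro h
    rw [localAct_mul, h, ← localAct_mul, inv_mul_cancel, localAct_one]
  · intro h
    rw [← h, ← localAct_mul, mul_inv_cancel_left]

/-- The stabiliser `O(K)` of a local lattice. -/
def stabilizer {p : ℕ} [Fact p.Prime] (Q : QuadraticForm ℚ V)
    (K : Submodule ℤ_[p] (ℚ_[p] ⊗[ℚ] V)) : Subgroup (localGroup p Q) where
  carrier := {σ | localAct σ K = K}
  mul_mem' {σ τ} hσ hτ := by
    change localAct (σ * τ) K = K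
    rw [localAct_mul, hτ, hσ]
  one_mem' := localAct_one K
  inv_mem' {σ} hσ := by
    change localAct σ⁻¹ K = K
    have h := localAct_eq_iff (σ := (1 : localGroup p Q)) (τ := σ) (K := K) (K' := K)
    rw [mul_one] at h
    exact h.1 (by rw [localAct_one, hσ])

theorem mem_stabilizer {p : ℕ} [Fact p.Prime] {Q : QuadraticForm ℚ V}
    {K : Submodule ℤ_[p] (ℚ_[p] ⊗[ℚ] V)} {σ : localGroup p Q} :
    σ ∈ stabilizer Q K ↔ localAct σ K = K := Iff.rfl

/-- The subgroup `O'(V_p) O(K)` of `O(V_p)`. -/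
def spinorStabilizer {p : ℕ} [Fact p.Prime] (Q : QuadraticForm ℚ V)
    (K : Submodule ℤ_[p] (ℚ_[p] ⊗[ℚ] V)) : Subgroup (localGroup p Q) :=
  stabilizer Q K ⊔ spinorSubgroup (localForm p Q)

/-- The full product of the groups `O(V_p)`. -/
abbrev LocalIsometries (Q : QuadraticForm ℚ V) : Type _ := ∀ p : Nat.Primes, localGroup p Q

/-- The group `∏ O'(V_p) O(L_p)`. -/
def integralSubgroup (Q : QuadraticForm ℚ V) (L : Submodule ℤ V) :
    Subgroup (LocalIsometries Q) :=
  Subgroup.pi Set.univ fun p => spinorStabilizer Q (localization p L)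

/-- The diagonal embedding of `O(V)` into the product of the groups `O(V_p)`. -/
def principal (Q : QuadraticForm ℚ V) : orthogonalGroup Q →* LocalIsometries Q where
  toFun σ p := ⟨(σ : V ≃ₗ[ℚ] V).baseChange ℚ ℚ_[p] V V, fun x => by
    have h := localForm_baseChange p (QV := Q) (QW := Q) (c := 1)
      (f := ((σ : V ≃ₗ[ℚ] V) : V →ₗ[ℚ] V)) (fun x => by rw [one_mul]; exact σ.2 x) x
    rwa [Rat.cast_one, one_mul] at h⟩
  map_one' := by
    funext p
    exact Subtype.ext (LinearEquiv.baseChange_one ..)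
  map_mul' σ τ := by
    funext p
    exact Subtype.ext (LinearEquiv.baseChange_mul ..)

/-- The group `O(V) ∏ O'(V_p) O(L_p)`, whose cosets in the group of adelic isometries are the spinor
genera in the genus of `L`. -/
def spinorGenusSubgroup (Q : QuadraticForm ℚ V) (L : Submodule ℤ V) :
    Subgroup (LocalIsometries Q) :=
  (principal Q).range ⊔ integralSubgroup Q L

/-- The group of adelic isometries: families of local isometries fixing `L_p` for almost all `p`.
It is the same for all lattices `L` on `V`. -/
def adelicSubgroup (Q : QuadraticForm ℚ V) (L : Submodule ℤ V) : Subgroup (LocalIsometries Q) where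
  carrier := {a | {p : Nat.Primes | ¬ a p ∈ stabilizer Q (localization p L)}.Finite}
  mul_mem' {a b} ha hb := by
    refine (Set.Finite.union ha hb).subset fun p hp => ?_
    by_contra h
    simp only [Set.mem_union, Set.mem_ofPred_eq, not_or, not_not] at h
    exact hp (mul_mem h.1 h.2)
  one_mem' := by
    refine Set.finite_empty.subset fun p hp => ?_
    exact hp (one_mem _)
  inv_mem' {a} ha := by
    refine Set.Finite.subset ha fun p hp h => hp ?_
    exact inv_mem h

theorem mem_adelicSubgroup {Q : QuadraticForm ℚ V} {L : Submodule ℤ V} {a : LocalIsometries Q} :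
    a ∈ adelicSubgroup Q L ↔ {p : Nat.Primes | ¬ a p ∈ stabilizer Q (localization p L)}.Finite :=
  Iff.rfl

theorem finite_setOf_prime_dvd {D : ℕ} (hD : D ≠ 0) : {p : Nat.Primes | (p : ℕ) ∣ D}.Finite := by
  refine Set.Finite.of_finite_image (f := ((↑) : Nat.Primes → ℕ)) ?_
    Nat.Primes.coe_nat_injective.injOn
  refine (Set.finite_le_nat D).subset ?_
  rintro _ ⟨p, hp, rfl⟩
  exact Nat.le_of_dvd (Nat.pos_of_ne_zero hD) hp

theorem adelicSubgroup_le (h3 : Module.finrank ℚ V = 3) (Q : QuadraticForm ℚ V)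
    (L L' : Submodule ℤ V) [Submodule.IsLattice ℚ L] [Submodule.IsLattice ℚ L'] :
    adelicSubgroup Q L ≤ adelicSubgroup Q L' := by
  obtain ⟨D, hD, h⟩ := exists_forall_localization_eq h3 L L'
  intro a ha
  refine (Set.Finite.union ha (finite_setOf_prime_dvd hD)).subset fun p hp => ?_
  by_contra hn
  simp only [Set.mem_union, Set.mem_ofPred_eq, not_or, not_not] at hn
  rw [h p hn.2] at hn
  exact hp hn.1

theorem adelicSubgroup_eq (h3 : Module.finrank ℚ V = 3) (Q : QuadraticForm ℚ V)
    (L L' : Submodule ℤ V) [Submodule.IsLattice ℚ L] [Submodule.IsLattice ℚ L'] :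
    adelicSubgroup Q L = adelicSubgroup Q L' :=
  le_antisymm (adelicSubgroup_le h3 Q L L') (adelicSubgroup_le h3 Q L' L)

/-- `L'` is the lattice `a L`. -/
def IsTranslate (Q : QuadraticForm ℚ V) (L : Submodule ℤ V) (a : LocalIsometries Q)
    (L' : Submodule ℤ V) : Prop :=
  Submodule.IsLattice ℚ L' ∧ ∀ p : Nat.Primes, localization p L' = localAct (a p) (localization p L)

theorem exists_isTranslate (h3 : Module.finrank ℚ V = 3) {Q : QuadraticForm ℚ V}
    {L : Submodule ℤ V} [hL : Submodule.IsLattice ℚ L] {a : LocalIsometries Q}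
    (ha : a ∈ adelicSubgroup Q L) : ∃ L', IsTranslate Q L a L' := by
  classical
  -- one prime at a time
  have key : ∀ S : Finset Nat.Primes, ∃ L' : Submodule ℤ V, Submodule.IsLattice ℚ L' ∧
      ∀ p : Nat.Primes, localization p L' =
        if p ∈ S then localAct (a p) (localization p L) else localization p L := by
    intro S
    induction S using Finset.induction_on with
    | empty => exact ⟨L, hL, fun p => by simp⟩
    | insert q S hq ih =>
      obtain ⟨L₁, hL₁, h₁⟩ := ih
      obtain ⟨L', hL', h, h'⟩ := exists_lattice_modify_at h3 L₁ q
        (a q : (ℚ_[q] ⊗[ℚ] V) ≃ₗ[ℚ_[q]] (ℚ_[q] ⊗[ℚ] V))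
      refine ⟨L', hL', fun p => ?_⟩
      by_cases hpq : p = q
      · subst hpq
        rw [if_pos (Finset.mem_insert_self _ _), h, h₁, if_neg hq]
        rfl
      · rw [h' p (fun h => hpq (Nat.Primes.coe_nat_injective h)), h₁]
        simp [Finset.mem_insert, hpq]
  obtain ⟨L', hL', h⟩ := key (mem_adelicSubgroup.1 ha).toFinset
  refine ⟨L', hL', fun p => ?_⟩
  rw [h]
  split_ifs with hp
  · rfl
  · simp only [Set.Finite.mem_toFinset, Set.mem_ofPred_eq, not_not] at hp
    exact (mem_stabilizer.1 hp).symm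

theorem IsTranslate.mem_adelicSubgroup (h3 : Module.finrank ℚ V = 3) {Q : QuadraticForm ℚ V}
    {L L' : Submodule ℤ V} [Submodule.IsLattice ℚ L] {a : LocalIsometries Q}
    (h : IsTranslate Q L a L') : a ∈ adelicSubgroup Q L := by
  have := h.1
  obtain ⟨D, hD, hD'⟩ := exists_forall_localization_eq h3 L L'
  refine (finite_setOf_prime_dvd hD).subset fun p hp => ?_
  by_contra hn
  exact hp (by rw [mem_stabilizer, ← h.2, hD' p hn])

theorem mem_gen_iff {Q : QuadraticForm ℚ V} {L L' : Submodule ℤ V} :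
    L' ∈ gen Q L ↔ ∃ a : LocalIsometries Q, IsTranslate Q L a L' := by
  constructor
  · rintro ⟨hL', h⟩
    choose σ hσ using fun p : Nat.Primes => h p
    exact ⟨fun p => ofIsometryEquiv (σ p), hL', hσ⟩
  · rintro ⟨a, hL', h⟩
    exact ⟨hL', fun p hp => ⟨toIsometryEquiv (a ⟨p, hp.out⟩), h ⟨p, hp.out⟩⟩⟩

theorem mem_spn_iff {Q : QuadraticForm ℚ V} {L L' : Submodule ℤ V} :
    L' ∈ spn Q L ↔ ∃ (γ : orthogonalGroup Q) (τ : LocalIsometries Q),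
      (∀ p : Nat.Primes, τ p ∈ spinorSubgroup (localForm p Q)) ∧
      IsTranslate Q L (principal Q γ * τ) L' := by
  constructor
  · rintro ⟨hL', σ, h⟩
    choose τ hτ hτ' using fun p : Nat.Primes => h p
    refine ⟨ofIsometryEquiv σ, fun p => ofIsometryEquiv (τ p), hτ, hL', fun p => ?_⟩
    rw [hτ' p, Pi.mul_apply, localAct_mul]
    rfl
  · rintro ⟨γ, τ, hτ, hL', h⟩
    refine ⟨hL', toIsometryEquiv γ, fun p hp => ⟨toIsometryEquiv (τ ⟨p, hp.out⟩),
      hτ ⟨p, hp.out⟩, ?_⟩⟩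
    have := h ⟨p, hp.out⟩
    exact this.trans (localAct_mul _ _ _)

end Adelic

section Cosets

variable {V : Type*} [AddCommGroup V] [Module ℚ V] {Q : QuadraticForm ℚ V}
  {b : Module.Basis (Fin 3) ℚ V}

theorem commutator_localGroup_le (hb : IsDiagonal Q b) (p : ℕ) [Fact p.Prime] :
    commutator (localGroup p Q) ≤ spinorSubgroup (localForm p Q) :=
  commutator_le_spinorSubgroup two_ne_zero (hb.localBasis p)

theorem spinorSubgroup_normal (hb : IsDiagonal Q b) (p : ℕ) [Fact p.Prime] :
    (spinorSubgroup (localForm p Q)).Normal :=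
  Subgroup.Normal.of_commutator_le _ (commutator_localGroup_le hb p)

theorem commutator_le_integralSubgroup (hb : IsDiagonal Q b) (L : Submodule ℤ V) :
    commutator (LocalIsometries Q) ≤ integralSubgroup Q L := by
  rw [commutator_def, Subgroup.commutator_le]
  intro σ _ τ _
  refine (Subgroup.mem_pi _).2 fun p _ => ?_
  have h1 := Subgroup.commutator_mem_commutator (Subgroup.mem_top (σ p)) (Subgroup.mem_top (τ p))
  exact (commutator_localGroup_le hb p).trans le_sup_right h1

theorem integralSubgroup_normal (hb : IsDiagonal Q b) (L : Submodule ℤ V) :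
    (integralSubgroup Q L).Normal :=
  Subgroup.Normal.of_commutator_le _ (commutator_le_integralSubgroup hb L)

theorem spinorGenusSubgroup_normal (hb : IsDiagonal Q b) (L : Submodule ℤ V) :
    (spinorGenusSubgroup Q L).Normal :=
  Subgroup.Normal.of_commutator_le _ ((commutator_le_integralSubgroup hb L).trans le_sup_right)

/-- Two lattices `a L` and `c L` belong to the same spinor genus if and only if `a` and `c` belong
to the same coset of `O(V) ∏ O'(V_p) O(L_p)`. -/
theorem mem_spn_iff_mul_inv_mem (hb : IsDiagonal Q b) {L L₁ L₂ : Submodule ℤ V}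
    {a c : LocalIsometries Q} (h₁ : IsTranslate Q L a L₁) (h₂ : IsTranslate Q L c L₂) :
    L₁ ∈ spn Q L₂ ↔ a * c⁻¹ ∈ spinorGenusSubgroup Q L := by
  have hn := integralSubgroup_normal hb L
  constructor
  · intro h
    obtain ⟨γ, τ, hτ, h⟩ := mem_spn_iff.1 h
    have hs : (principal Q γ * τ * c)⁻¹ * a ∈ integralSubgroup Q L := by
      refine (Subgroup.mem_pi _).2 fun p _ => ?_
      have h3 : (principal Q γ * τ * c)⁻¹ p * a p ∈ stabilizer Q (localization p L) := by
        rw [mem_stabilizer, Pi.inv_apply, ← localAct_eq_iff, ← h₁.2, h.2 p, h₂.2, ← localAct_mul]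
        rfl
      exact le_sup_left (a := stabilizer Q (localization p L)) h3
    have hτ' : τ ∈ integralSubgroup Q L :=
      (Subgroup.mem_pi _).2 fun p _ => le_sup_right (a := stabilizer Q (localization p L)) (hτ p)
    have e : a * c⁻¹ = principal Q γ * (τ * (c * ((principal Q γ * τ * c)⁻¹ * a) * c⁻¹)) := by
      group
    rw [e]
    exact mul_mem (Subgroup.mem_sup_left ⟨γ, rfl⟩)
      (Subgroup.mem_sup_right (mul_mem hτ' (hn.conj_mem _ hs c)))
  · intro h
    obtain ⟨_, ⟨γ, rfl⟩, d, hd, hγ⟩ := Subgroup.mem_sup_of_normal_right.1 h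
    have hd' : c⁻¹ * d * c ∈ integralSubgroup Q L := by
      have := hn.conj_mem _ hd c⁻¹
      rwa [inv_inv] at this
    have key : ∀ p : Nat.Primes, ∃ τ ∈ spinorSubgroup (localForm p Q),
        ∃ s ∈ stabilizer Q (localization p L), τ * s = (c⁻¹ * d * c) p := by
      intro p
      have hsn := spinorSubgroup_normal hb p
      have := (Subgroup.mem_pi _).1 hd' p (Set.mem_univ _)
      rw [spinorStabilizer, sup_comm] at this
      exact Subgroup.mem_sup_of_normal_left.1 this
    choose τ hτ s hs hτs using key
    refine mem_spn_iff.2 ⟨γ, c * τ * c⁻¹, fun p => ?_, h₁.1, fun p => ?_⟩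
    · exact (spinorSubgroup_normal hb p).conj_mem _ (hτ p) (c p)
    · rw [h₂.2, ← localAct_mul, h₁.2, localAct_eq_iff]
      have e : ((principal Q γ * (c * τ * c⁻¹)) p * c p)⁻¹ * a p = s p := by
        have e1 : a p = principal Q γ p * d p * c p := by
          have := congrFun hγ p
          simp only [Pi.mul_apply, Pi.inv_apply] at this
          rw [this, inv_mul_cancel_right]
        have e2 : d p = c p * (τ p * s p) * (c p)⁻¹ := by
          rw [hτs p]
          simp only [Pi.mul_apply, Pi.inv_apply]
          group
        rw [e1, e2]
        simp only [Pi.mul_apply, Pi.inv_apply]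
        group
      rw [e]
      exact hs p

theorem IsTranslate.of_mem_spn {L L₁ L₂ : Submodule ℤ V} {c : LocalIsometries Q}
    (h₂ : IsTranslate Q L c L₂) (h : L₁ ∈ spn Q L₂) :
    ∃ a : LocalIsometries Q, IsTranslate Q L a L₁ := by
  obtain ⟨γ, τ, -, hL, h⟩ := mem_spn_iff.1 h
  refine ⟨principal Q γ * τ * c, hL, fun p => ?_⟩
  rw [h p, h₂.2 p, ← localAct_mul]
  rfl

theorem spn_eq_iff (hb : IsDiagonal Q b) {L L₁ L₂ : Submodule ℤ V}
    {a c : LocalIsometries Q} (h₁ : IsTranslate Q L a L₁) (h₂ : IsTranslate Q L c L₂) :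
    spn Q L₁ = spn Q L₂ ↔ a * c⁻¹ ∈ spinorGenusSubgroup Q L := by
  have key : ∀ {L₁ L₂ : Submodule ℤ V} {a c : LocalIsometries Q}, IsTranslate Q L a L₁ →
      IsTranslate Q L c L₂ → a * c⁻¹ ∈ spinorGenusSubgroup Q L → spn Q L₁ ⊆ spn Q L₂ := by
    intro L₁ L₂ a c h₁ h₂ h L' hL'
    obtain ⟨d, hd⟩ := h₁.of_mem_spn hL'
    rw [mem_spn_iff_mul_inv_mem hb hd h₁] at hL'
    rw [mem_spn_iff_mul_inv_mem hb hd h₂]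
    have := mul_mem hL' h
    rwa [mul_assoc, inv_mul_cancel_left] at this
  constructor
  · intro h
    rw [← mem_spn_iff_mul_inv_mem hb h₁ h₂, ← h, mem_spn_iff_mul_inv_mem hb h₁ h₁, mul_inv_cancel]
    exact one_mem _
  · intro h
    refine (key h₁ h₂ h).antisymm (key h₂ h₁ ?_)
    have := inv_mem h
    rwa [mul_inv_rev, inv_inv] at this

/-- The number of spinor genera in a genus as the index of a group. -/
theorem numSpinorGenera_eq_relIndex (h3 : Module.finrank ℚ V = 3) (hb : IsDiagonal Q b)
    (L : Submodule ℤ V) [Submodule.IsLattice ℚ L] :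
    numSpinorGenera Q L = (spinorGenusSubgroup Q L).relIndex (adelicSubgroup Q L) := by
  have hn := spinorGenusSubgroup_normal hb L
  choose F hF using fun a : adelicSubgroup Q L => exists_isTranslate h3 a.2
  let f : adelicSubgroup Q L → spinorGenera Q L := fun a =>
    ⟨spn Q (F a), F a, mem_gen_iff.2 ⟨a, hF a⟩, rfl⟩
  have hf : ∀ a c : adelicSubgroup Q L, f a = f c ↔
      (QuotientGroup.leftRel ((spinorGenusSubgroup Q L).subgroupOf (adelicSubgroup Q L))) a c := by
    intro a c
    rw [QuotientGroup.leftRel_apply, Subgroup.mem_subgroupOf]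
    rw [show f a = f c ↔ spn Q (F a) = spn Q (F c) from Subtype.ext_iff, spn_eq_iff hb (hF a) (hF c), ← inv_mem_iff, mul_inv_rev, inv_inv, hn.mem_comm_iff]
    rfl
  rw [numSpinorGenera, ← Nat.card_coe_set_eq, Subgroup.relIndex, Subgroup.index_eq_card]
  symm
  refine Nat.card_congr (Equiv.ofBijective
    (Quotient.lift f fun a c h => (hf a c).2 h) ⟨?_, ?_⟩)
  · intro x y
    induction x using Quotient.inductionOn
    induction y using Quotient.inductionOn
    exact fun h => Quotient.sound ((hf _ _).1 h)
  · rintro ⟨_, L', hL', rfl⟩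
    obtain ⟨a, ha⟩ := mem_gen_iff.1 hL'
    let a' : adelicSubgroup Q L := ⟨a, ha.mem_adelicSubgroup h3⟩
    refine ⟨Quotient.mk _ a', Subtype.ext ?_⟩
    change spn Q (F a') = spn Q L'
    rw [spn_eq_iff hb (hF a') ha, mul_inv_cancel]
    exact one_mem _

end Cosets

/-! ### Transport along similitudes -/

section FieldSimilitude

variable {K : Type*} [Field K] {X Y : Type*} [AddCommGroup X] [Module K X] [AddCommGroup Y]
  [Module K Y] {QX : QuadraticForm K X} {QY : QuadraticForm K Y} {e : X ≃ₗ[K] Y} {c : K}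

/-- Conjugation of an isometry by a similitude. -/
def conjIsometry (he : ∀ x, QY (e x) = c * QX x) (σ : QX.IsometryEquiv QX) :
    QY.IsometryEquiv QY :=
  { e.symm.trans (σ.toLinearEquiv.trans e) with
    map_app' := fun y => by
      change QY (e (σ (e.symm y))) = QY y
      rw [he, σ.map_app, ← he, e.apply_symm_apply] }

theorem conjIsometry_apply (he : ∀ x, QY (e x) = c * QX x) (σ : QX.IsometryEquiv QX)
    (x : X) : (conjIsometry he σ).toLinearEquiv (e x) = e (σ.toLinearEquiv x) := by
  change e (σ.toLinearEquiv (e.symm (e x))) = _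
  rw [e.symm_apply_apply]

theorem reflection_similitude (hc : c ≠ 0) (he : ∀ x, QY (e x) = c * QX x) (v x : X) :
    reflection QY (e v) (e x) = e (reflection QX v x) := by
  have hp : QuadraticMap.polar QY (e v) (e x) = c * QuadraticMap.polar QX v x := by
    rw [QuadraticMap.polar, QuadraticMap.polar, ← map_add, he, he, he]
    ring
  rw [reflection_apply, reflection_apply, map_sub, map_smul, hp, he]
  congr 2
  rw [mul_inv, mul_mul_mul_comm, inv_mul_cancel₀ hc, one_mul]

/-- A similitude does not affect the spinor norm of a rotation: its factor enters an even number of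
times. -/
theorem conjIsometry_mem_spinorKernel (hc : c ≠ 0) (he : ∀ x, QY (e x) = c * QX x)
    {σ : QX.IsometryEquiv QX} (hσ : σ ∈ spinorKernel QX) :
    conjIsometry he σ ∈ spinorKernel QY := by
  obtain ⟨l, h1, h2, h3, h4⟩ := hσ
  refine ⟨l.map e, by simpa using h1, ?_, ?_, ?_⟩
  · intro v hv
    obtain ⟨w, hw, rfl⟩ := List.mem_map.1 hv
    rw [he]
    exact mul_ne_zero hc (h2 w hw)
  · have h5 : ((l.map e).map QY).prod = c ^ l.length * (l.map QX).prod := by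
      clear h1 h2 h3 h4
      induction l with
      | nil => simp
      | cons a l ih =>
        simp only [List.map_cons, List.prod_cons, List.length_cons, ih, he]
        ring
    rw [h5]
    exact (h1.isSquare_pow c).mul h3
  · refine LinearMap.ext fun y => ?_
    obtain ⟨x, rfl⟩ := e.surjective y
    have h5 : ∀ x, (((l.map e).map (reflection QY)).prod : Module.End K Y) (e x) =
        e ((l.map (reflection QX)).prod x) := by
      clear h1 h2 h3 h4
      induction l with
      | nil => intro x; simp
      | cons a l ih =>
        intro x
        simp only [List.map_cons, List.prod_cons, Module.End.mul_apply]
        rw [ih, reflection_similitude hc he]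
    rw [h5, ← h4]
    exact conjIsometry_apply he σ x

end FieldSimilitude

section Similitude

variable {V W : Type*} [AddCommGroup V] [Module ℚ V] [AddCommGroup W] [Module ℚ W]

/-- The image of a lattice under a linear map. -/
abbrev mapLattice (e : W →ₗ[ℚ] V) (L : Submodule ℤ W) : Submodule ℤ V :=
  L.map (e.restrictScalars ℤ)

theorem mapLattice_symm (e : W ≃ₗ[ℚ] V) (L : Submodule ℤ W) :
    mapLattice (e.symm : V →ₗ[ℚ] W) (mapLattice (e : W →ₗ[ℚ] V) L) = L := by
  ext x
  constructor
  · rintro ⟨_, ⟨y, hy, rfl⟩, rfl⟩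
    change e.symm (e y) ∈ L
    rwa [e.symm_apply_apply]
  · intro hx
    exact ⟨e x, ⟨x, hx, rfl⟩, e.symm_apply_apply x⟩

theorem mapLattice_symm' (e : W ≃ₗ[ℚ] V) (L : Submodule ℤ V) :
    mapLattice (e : W →ₗ[ℚ] V) (mapLattice (e.symm : V →ₗ[ℚ] W) L) = L :=
  mapLattice_symm e.symm L

theorem isLattice_mapLattice (e : W ≃ₗ[ℚ] V) (L : Submodule ℤ W) [hL : Submodule.IsLattice ℚ L] :
    Submodule.IsLattice ℚ (mapLattice (e : W →ₗ[ℚ] V) L) where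
  fg := hL.fg.map _
  span_eq_top := by
    have h : ((mapLattice (e : W →ₗ[ℚ] V) L : Submodule ℤ V) : Set V) =
        (e : W →ₗ[ℚ] V) '' (L : Set W) := rfl
    rw [h, Submodule.span_image, hL.span_eq_top, Submodule.map_top]
    exact LinearEquiv.range e

theorem localization_mapLattice (p : ℕ) [Fact p.Prime] (e : W →ₗ[ℚ] V) (L : Submodule ℤ W) :
    localization p (mapLattice e L) =
      (localization p L).map ((e.baseChange ℚ_[p]).restrictScalars ℤ_[p]) := by
  rw [localization, localization, Submodule.map_span, ← Set.image_comp]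
  congr 1
  change (fun v : V => (1 : ℚ_[p]) ⊗ₜ[ℚ] v) '' (e '' (L : Set W)) = _
  rw [← Set.image_comp]
  refine Set.image_congr fun x _ => ?_
  change _ = (e.baseChange ℚ_[p]) ((1 : ℚ_[p]) ⊗ₜ[ℚ] x)
  rw [LinearMap.baseChange_tmul]
  rfl

theorem localForm_baseChange_equiv (p : ℕ) [Fact p.Prime] {QV : QuadraticForm ℚ V}
    {QW : QuadraticForm ℚ W} {c : ℚ} {e : W ≃ₗ[ℚ] V} (he : ∀ x, QV (e x) = c * QW x)
    (x : ℚ_[p] ⊗[ℚ] W) :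
    localForm p QV (e.baseChange ℚ ℚ_[p] W V x) = (c : ℚ_[p]) * localForm p QW x :=
  localForm_baseChange p (f := (e : W →ₗ[ℚ] V)) he x

theorem localImage_conj (p : ℕ) [Fact p.Prime] {QV : QuadraticForm ℚ V}
    {QW : QuadraticForm ℚ W} {c : ℚ} {e : W ≃ₗ[ℚ] V}
    (he : ∀ x, QV (e x) = c * QW x) (σ : (localForm p QW).IsometryEquiv (localForm p QW))
    (K : Submodule ℤ_[p] (ℚ_[p] ⊗[ℚ] W)) :
    localImage p ((conjIsometry (localForm_baseChange_equiv p he) σ).toLinearEquiv :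
        (ℚ_[p] ⊗[ℚ] V) →ₗ[ℚ_[p]] (ℚ_[p] ⊗[ℚ] V))
      (K.map (((e : W →ₗ[ℚ] V).baseChange ℚ_[p]).restrictScalars ℤ_[p])) =
    (localImage p (σ.toLinearEquiv : (ℚ_[p] ⊗[ℚ] W) →ₗ[ℚ_[p]] (ℚ_[p] ⊗[ℚ] W)) K).map
      (((e : W →ₗ[ℚ] V).baseChange ℚ_[p]).restrictScalars ℤ_[p]) := by
  rw [localImage, localImage, ← Submodule.map_comp, ← Submodule.map_comp]
  congr 1
  refine LinearMap.ext fun x => ?_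
  exact conjIsometry_apply (localForm_baseChange_equiv p he) σ x

theorem mapLattice_mem_gen {QV : QuadraticForm ℚ V} {QW : QuadraticForm ℚ W} {c : ℚ}
    {e : W ≃ₗ[ℚ] V} (he : ∀ x, QV (e x) = c * QW x) {L L' : Submodule ℤ W}
    (h : L' ∈ gen QW L) :
    mapLattice (e : W →ₗ[ℚ] V) L' ∈ gen QV (mapLattice (e : W →ₗ[ℚ] V) L) := by
  obtain ⟨hL', h⟩ := h
  refine ⟨isLattice_mapLattice e L', fun p _ => ?_⟩
  obtain ⟨σ, hσ⟩ := h p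
  refine ⟨conjIsometry (localForm_baseChange_equiv p he) σ, ?_⟩
  rw [localization_mapLattice, localization_mapLattice, localImage_conj p he, hσ]

theorem mapLattice_mem_spn {QV : QuadraticForm ℚ V} {QW : QuadraticForm ℚ W} {c : ℚ} (hc : c ≠ 0)
    {e : W ≃ₗ[ℚ] V} (he : ∀ x, QV (e x) = c * QW x) {L L' : Submodule ℤ W}
    (h : L' ∈ spn QW L) :
    mapLattice (e : W →ₗ[ℚ] V) L' ∈ spn QV (mapLattice (e : W →ₗ[ℚ] V) L) := by
  obtain ⟨hL', σ, h⟩ := h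
  refine ⟨isLattice_mapLattice e L', conjIsometry he σ, fun p _ => ?_⟩
  obtain ⟨τ, hτ, hτ'⟩ := h p
  have hcp : (c : ℚ_[p]) ≠ 0 := Rat.cast_ne_zero.2 hc
  refine ⟨conjIsometry (localForm_baseChange_equiv p he) τ,
    conjIsometry_mem_spinorKernel hcp _ hτ, ?_⟩
  rw [localization_mapLattice, localization_mapLattice, localImage_conj p he, hτ']
  generalize localImage p (τ.toLinearEquiv : (ℚ_[p] ⊗[ℚ] W) →ₗ[ℚ_[p]] (ℚ_[p] ⊗[ℚ] W))
    (localization p L) = K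
  rw [localImage, localImage, ← Submodule.map_comp, ← Submodule.map_comp]
  congr 1
  refine LinearMap.ext fun x => ?_
  change ((e : W →ₗ[ℚ] V).baseChange ℚ_[p]) (((σ.toLinearEquiv : W →ₗ[ℚ] W).baseChange ℚ_[p]) x) =
    (((conjIsometry he σ).toLinearEquiv : V →ₗ[ℚ] V).baseChange ℚ_[p])
      ((e : W →ₗ[ℚ] V).baseChange ℚ_[p] x)
  rw [← LinearMap.comp_apply, ← LinearMap.comp_apply, ← LinearMap.baseChange_comp,
    ← LinearMap.baseChange_comp]
  congr 2
  refine LinearMap.ext fun y => ?_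
  exact (conjIsometry_apply he σ y).symm

theorem similitude_symm {QV : QuadraticForm ℚ V} {QW : QuadraticForm ℚ W} {c : ℚ} (hc : c ≠ 0)
    {e : W ≃ₗ[ℚ] V} (he : ∀ x, QV (e x) = c * QW x) (y : V) : QW (e.symm y) = c⁻¹ * QV y := by
  rw [← e.apply_symm_apply y, he, e.symm_apply_apply, inv_mul_cancel_left₀ hc]

theorem mapLattice_mem_gen_iff {QV : QuadraticForm ℚ V} {QW : QuadraticForm ℚ W} {c : ℚ}
    (hc : c ≠ 0) {e : W ≃ₗ[ℚ] V} (he : ∀ x, QV (e x) = c * QW x) {L L' : Submodule ℤ W} :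
    mapLattice (e : W →ₗ[ℚ] V) L' ∈ gen QV (mapLattice (e : W →ₗ[ℚ] V) L) ↔ L' ∈ gen QW L := by
  refine ⟨fun h => ?_, mapLattice_mem_gen he⟩
  have := mapLattice_mem_gen (similitude_symm hc he) h
  rwa [mapLattice_symm, mapLattice_symm] at this

theorem mapLattice_mem_spn_iff {QV : QuadraticForm ℚ V} {QW : QuadraticForm ℚ W} {c : ℚ}
    (hc : c ≠ 0) {e : W ≃ₗ[ℚ] V} (he : ∀ x, QV (e x) = c * QW x) {L L' : Submodule ℤ W} :
    mapLattice (e : W →ₗ[ℚ] V) L' ∈ spn QV (mapLattice (e : W →ₗ[ℚ] V) L) ↔ L' ∈ spn QW L := by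
  refine ⟨fun h => ?_, mapLattice_mem_spn hc he⟩
  have := mapLattice_mem_spn (inv_ne_zero hc) (similitude_symm hc he) h
  rwa [mapLattice_symm, mapLattice_symm] at this

theorem spn_mapLattice {QV : QuadraticForm ℚ V} {QW : QuadraticForm ℚ W} {c : ℚ}
    (hc : c ≠ 0) {e : W ≃ₗ[ℚ] V} (he : ∀ x, QV (e x) = c * QW x) (L : Submodule ℤ W) :
    spn QV (mapLattice (e : W →ₗ[ℚ] V) L) = mapLattice (e : W →ₗ[ℚ] V) '' spn QW L := by
  ext L'
  rw [← mapLattice_symm' e L', mapLattice_mem_spn_iff hc he]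
  constructor
  · intro h
    exact ⟨_, h, rfl⟩
  · rintro ⟨L'', h, h'⟩
    have := congrArg (mapLattice (e.symm : V →ₗ[ℚ] W)) h'
    rw [mapLattice_symm, mapLattice_symm] at this
    rwa [← this]

/-- The number of spinor genera is invariant under similitudes. -/
theorem numSpinorGenera_mapLattice {QV : QuadraticForm ℚ V} {QW : QuadraticForm ℚ W} {c : ℚ}
    (hc : c ≠ 0) {e : W ≃ₗ[ℚ] V} (he : ∀ x, QV (e x) = c * QW x) (L : Submodule ℤ W) :
    numSpinorGenera QV (mapLattice (e : W →ₗ[ℚ] V) L) = numSpinorGenera QW L := by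
  have hinj : Function.Injective (mapLattice (e : W →ₗ[ℚ] V)) := fun L₁ L₂ h => by
    have := congrArg (mapLattice (e.symm : V →ₗ[ℚ] W)) h
    rwa [mapLattice_symm, mapLattice_symm] at this
  have : spinorGenera QV (mapLattice (e : W →ₗ[ℚ] V) L) =
      Set.image (mapLattice (e : W →ₗ[ℚ] V)) '' spinorGenera QW L := by
    rw [spinorGenera, spinorGenera, ← Set.image_comp]
    ext S
    constructor
    · rintro ⟨L', h, rfl⟩
      rw [← mapLattice_symm' e L', mapLattice_mem_gen_iff hc he] at h
      refine ⟨_, h, ?_⟩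
      change mapLattice (e : W →ₗ[ℚ] V) '' spn QW _ = _
      rw [← spn_mapLattice hc he, mapLattice_symm']
    · rintro ⟨L', h, rfl⟩
      exact ⟨_, (mapLattice_mem_gen_iff hc he).2 h, spn_mapLattice hc he L'⟩
  rw [numSpinorGenera, numSpinorGenera, this,
    Set.ncard_image_of_injective _ (Set.image_injective.2 hinj)]

end Similitude

/-! ### Gram determinants -/

section Gram

variable {K : Type*} [Field K] {X : Type*} [AddCommGroup X] [Module K X]

/-- The Gram matrix of three vectors for the polar form `2 B`. -/
def polarGram (Q : QuadraticForm K X) (x : Fin 3 → X) : Matrix (Fin 3) (Fin 3) K :=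
  Matrix.of fun i j => QuadraticMap.polar Q (x i) (x j)

theorem polarGram_eq_mul (Q : QuadraticForm K X) (e : Module.Basis (Fin 3) K X) (x : Fin 3 → X) :
    polarGram Q x = (e.toMatrix x).transpose * polarGram Q e * e.toMatrix x := by
  ext i j
  have h : ∀ i, x i = ∑ k, e.toMatrix x k i • e k := fun i => (e.sum_toMatrix_smul_self x i).symm
  rw [polarGram, Matrix.of_apply, h i, h j, ← QuadraticMap.polarBilin_apply_apply]
  simp only [map_sum, map_smul, LinearMap.sum_apply, LinearMap.smul_apply, Matrix.mul_apply,
    Matrix.transpose_apply, polarGram, Matrix.of_apply, QuadraticMap.polarBilin_apply_apply,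
    smul_eq_mul, Finset.sum_mul, Finset.mul_sum]
  refine Finset.sum_congr rfl fun k _ => Finset.sum_congr rfl fun l _ => ?_
  ring

theorem det_polarGram_eq (Q : QuadraticForm K X) (e : Module.Basis (Fin 3) K X) (x : Fin 3 → X) :
    (polarGram Q x).det = (e.toMatrix x).det ^ 2 * (polarGram Q e).det := by
  rw [polarGram_eq_mul Q e x, Matrix.det_mul, Matrix.det_mul, Matrix.det_transpose]
  ring

theorem polarGram_map {Q : QuadraticForm K X} {f : X ≃ₗ[K] X} (hf : f ∈ orthogonalGroup Q)
    (x : Fin 3 → X) : polarGram Q (fun i => f (x i)) = polarGram Q x := by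
  ext i j
  exact polar_orthogonalGroup hf _ _

theorem det_polarGram_of_isDiagonal {Q : QuadraticForm K X} {b : Module.Basis (Fin 3) K X}
    (hb : IsDiagonal Q b) : (polarGram Q b).det = 8 * (Q (b 0) * Q (b 1) * Q (b 2)) := by
  have h : ∀ i j, i ≠ j → polarGram Q b i j = 0 := hb.1
  have h' : ∀ i, polarGram Q b i i = 2 * Q (b i) := fun i => by
    rw [polarGram, Matrix.of_apply, QuadraticMap.polar_self, nsmul_eq_mul, Nat.cast_ofNat]
  rw [Matrix.det_fin_three, h', h', h', h 0 1 (by decide), h 0 2 (by decide), h 1 0 (by decide),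
    h 1 2 (by decide), h 2 0 (by decide), h 2 1 (by decide)]
  ring

theorem det_polarGram_eq_explicit (Q : QuadraticForm K X) (x : Fin 3 → X) :
    (polarGram Q x).det = 8 * (Q (x 0) * Q (x 1) * Q (x 2)) +
      2 * (QuadraticMap.polar Q (x 1) (x 2) * QuadraticMap.polar Q (x 0) (x 2) *
        QuadraticMap.polar Q (x 0) (x 1)) - 2 * Q (x 0) * QuadraticMap.polar Q (x 1) (x 2) ^ 2 -
      2 * Q (x 1) * QuadraticMap.polar Q (x 0) (x 2) ^ 2 -
      2 * Q (x 2) * QuadraticMap.polar Q (x 0) (x 1) ^ 2 := by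
  have h' : ∀ i, polarGram Q x i i = 2 * Q (x i) := fun i => by
    rw [polarGram, Matrix.of_apply, QuadraticMap.polar_self, nsmul_eq_mul, Nat.cast_ofNat]
  have h : ∀ i j, polarGram Q x i j = QuadraticMap.polar Q (x i) (x j) := fun i j => rfl
  rw [Matrix.det_fin_three, h', h', h', h, h, h, h, h, h, QuadraticMap.polar_comm Q (x 1) (x 0),
    QuadraticMap.polar_comm Q (x 2) (x 0), QuadraticMap.polar_comm Q (x 2) (x 1)]
  ring

end Gram

section GramPadic

variable {p : ℕ} [hp : Fact p.Prime] {X : Type*} [AddCommGroup X] [Module ℚ_[p] X]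
  [Module ℤ_[p] X] [IsScalarTower ℤ_[p] ℚ_[p] X]

theorem padic_norm_sub_le_max (x y : ℚ_[p]) : ‖x - y‖ ≤ max ‖x‖ ‖y‖ := by
  rw [sub_eq_add_neg, ← norm_neg y]
  exact IsUltrametricDist.norm_add_le_max x (-y)

theorem norm_det_le_one {A : Matrix (Fin 3) (Fin 3) ℚ_[p]} (h : ∀ i j, ‖A i j‖ ≤ 1) :
    ‖A.det‖ ≤ 1 := by
  let B : Matrix (Fin 3) (Fin 3) ℤ_[p] := fun i j => ⟨A i j, h i j⟩
  have : A = B.map (PadicInt.Coe.ringHom : ℤ_[p] →+* ℚ_[p]) := by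
    ext i j
    rfl
  rw [this, ← RingHom.mapMatrix_apply, ← RingHom.map_det]
  exact B.det.2

theorem norm_det_toMatrix_le_one {e e' : Module.Basis (Fin 3) ℚ_[p] X}
    (h : Submodule.span ℤ_[p] (Set.range e') ≤ Submodule.span ℤ_[p] (Set.range e)) :
    ‖(e.toMatrix e').det‖ ≤ 1 :=
  norm_det_le_one fun i j =>
    mem_span_basis_padic.1 (h (Submodule.subset_span (Set.mem_range_self j))) i

/-- The transition matrix between two bases of a local lattice has a unit as determinant. -/
theorem norm_det_toMatrix_eq_one {e e' : Module.Basis (Fin 3) ℚ_[p] X}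
    (h : Submodule.span ℤ_[p] (Set.range e') = Submodule.span ℤ_[p] (Set.range e)) :
    ‖(e.toMatrix e').det‖ = 1 := by
  have h1 := norm_det_toMatrix_le_one h.le
  have h2 := norm_det_toMatrix_le_one h.ge
  have h3 : ‖(e.toMatrix e').det‖ * ‖(e'.toMatrix e).det‖ = 1 := by
    rw [← norm_mul, ← Matrix.det_mul, Module.Basis.toMatrix_mul_toMatrix_flip, Matrix.det_one,
      norm_one]
  nlinarith [norm_nonneg (e.toMatrix e').det, norm_nonneg (e'.toMatrix e).det]

/-- A local lattice contained in another one, with equal volumes, is equal to it. -/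
theorem span_eq_of_le_of_norm_det {e e' : Module.Basis (Fin 3) ℚ_[p] X}
    (h : Submodule.span ℤ_[p] (Set.range e') ≤ Submodule.span ℤ_[p] (Set.range e))
    (hd : ‖(e.toMatrix e').det‖ = 1) :
    Submodule.span ℤ_[p] (Set.range e') = Submodule.span ℤ_[p] (Set.range e) := by
  refine le_antisymm h (Submodule.span_le.2 ?_)
  rintro _ ⟨j, rfl⟩
  refine mem_span_basis_padic.2 fun i => ?_
  have h0 : ∀ i j, ‖e.toMatrix e' i j‖ ≤ 1 := fun i j =>
    mem_span_basis_padic.1 (h (Submodule.subset_span (Set.mem_range_self j))) i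
  let B : Matrix (Fin 3) (Fin 3) ℤ_[p] := fun i j => ⟨e.toMatrix e' i j, h0 i j⟩
  have hB : e.toMatrix e' = B.map (PadicInt.Coe.ringHom : ℤ_[p] →+* ℚ_[p]) := by
    ext i j
    rfl
  have hu : IsUnit B.det := by
    rw [PadicInt.isUnit_iff, ← hd, hB, ← RingHom.mapMatrix_apply, ← RingHom.map_det]
    rfl
  have h1 : e'.toMatrix e = (B⁻¹).map (PadicInt.Coe.ringHom : ℤ_[p] →+* ℚ_[p]) := by
    have h2 : e.toMatrix e' * (B⁻¹).map (PadicInt.Coe.ringHom : ℤ_[p] →+* ℚ_[p]) = 1 := by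
      rw [hB, ← Matrix.map_mul, Matrix.mul_nonsing_inv _ hu]
      simp
    calc e'.toMatrix e = e'.toMatrix e * (e.toMatrix e' *
          (B⁻¹).map (PadicInt.Coe.ringHom : ℤ_[p] →+* ℚ_[p])) := by rw [h2, mul_one]
      _ = _ := by rw [← mul_assoc, Module.Basis.toMatrix_mul_toMatrix_flip, one_mul]
  change ‖e'.toMatrix e i j‖ ≤ 1
  rw [h1]
  exact (B⁻¹ i j).2

theorem norm_det_polarGram_eq (Q : QuadraticForm ℚ_[p] X) {e e' : Module.Basis (Fin 3) ℚ_[p] X}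
    (h : Submodule.span ℤ_[p] (Set.range e') = Submodule.span ℤ_[p] (Set.range e)) :
    ‖(polarGram Q e').det‖ = ‖(polarGram Q e).det‖ := by
  rw [det_polarGram_eq Q e e', norm_mul, norm_pow, norm_det_toMatrix_eq_one h, one_pow, one_mul]

end GramPadic

section GramRational

variable {V : Type*} [AddCommGroup V] [Module ℚ V]

theorem det_polarGram_localBasis (p : ℕ) [Fact p.Prime] (Q : QuadraticForm ℚ V)
    (b : Module.Basis (Fin 3) ℚ V) :
    (polarGram (localForm p Q) (localBasis p b)).det = (((polarGram Q b).det : ℚ) : ℚ_[p]) := by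
  have : polarGram (localForm p Q) (localBasis p b) =
      (polarGram Q b).map (algebraMap ℚ ℚ_[p]) := by
    ext i j
    rw [polarGram, Matrix.of_apply, Module.Basis.baseChange_apply, Module.Basis.baseChange_apply,
      polar_localForm_tmul]
    rfl
  rw [this, ← RingHom.mapMatrix_apply, ← RingHom.map_det]
  rfl

theorem det_polarGram_ne_zero {Q : QuadraticForm ℚ V} {b : Module.Basis (Fin 3) ℚ V}
    (hb : IsDiagonal Q b) (e : Module.Basis (Fin 3) ℚ V) : (polarGram Q e).det ≠ 0 := by
  rw [det_polarGram_eq Q b e, det_polarGram_of_isDiagonal hb]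
  have h1 : (b.toMatrix e).det ≠ 0 := by
    intro h
    have := congrArg Matrix.det (b.toMatrix_mul_toMatrix_flip e)
    rw [Matrix.det_mul, h, zero_mul, Matrix.det_one] at this
    exact zero_ne_one this
  exact mul_ne_zero (pow_ne_zero 2 h1) (mul_ne_zero (by norm_num)
    (mul_ne_zero (mul_ne_zero (hb.2 0) (hb.2 1)) (hb.2 2)))

theorem det_polarGram_pos (h3 : Module.finrank ℚ V = 3) {Q : QuadraticForm ℚ V} (hQ : Q.PosDef)
    (e : Module.Basis (Fin 3) ℚ V) : 0 < (polarGram Q e).det := by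
  obtain ⟨b, hb⟩ := exists_isDiagonal_of_posDef h3 hQ
  refine lt_of_le_of_ne ?_ (det_polarGram_ne_zero hb e).symm
  rw [det_polarGram_eq Q b e, det_polarGram_of_isDiagonal hb]
  have h := fun i => hQ _ (b.ne_zero i)
  have h0 := h 0
  have h1 := h 1
  have h2 := h 2
  positivity

/-- Positive rational numbers with the same absolute value at every prime are equal. -/
theorem eq_of_forall_padic_norm_eq {q r : ℚ} (hq : 0 < q) (hr : 0 < r)
    (h : ∀ (p : ℕ) [Fact p.Prime], ‖(q : ℚ_[p])‖ = ‖(r : ℚ_[p])‖) : q = r := by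
  have key : ∀ {q r : ℚ}, 0 < q → 0 < r →
      (∀ (p : ℕ) [Fact p.Prime], ‖(q : ℚ_[p])‖ = ‖(r : ℚ_[p])‖) → r ≤ q := by
    intro q r hq hr h
    obtain ⟨k, hk⟩ := eq_intCast_of_forall_norm_le_one (q := q / r) fun p _ => by
      rw [Rat.cast_div, norm_div, h p, div_self]
      exact norm_ne_zero_iff.2 (Rat.cast_ne_zero.2 hr.ne')
    have h1 : (0 : ℚ) < k := by rw [hk]; positivity
    have h2 : (1 : ℚ) ≤ k := by exact_mod_cast (Int.cast_pos.1 h1 : 0 < k)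
    rw [hk, le_div_iff₀ hr, one_mul] at h2
    exact h2
  exact le_antisymm (key hr hq fun p _ => (h p).symm) (key hq hr h)

/-- The discriminant is an invariant of the genus. -/
theorem det_polarGram_eq_of_isTranslate (h3 : Module.finrank ℚ V = 3) {Q : QuadraticForm ℚ V}
    (hQ : Q.PosDef) {b b' : Module.Basis (Fin 3) ℚ V} {a : LocalIsometries Q}
    (h : IsTranslate Q (Submodule.span ℤ (Set.range b)) a (Submodule.span ℤ (Set.range b'))) :
    (polarGram Q b').det = (polarGram Q b).det := by
  refine eq_of_forall_padic_norm_eq (det_polarGram_pos h3 hQ b') (det_polarGram_pos h3 hQ b) ?_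
  intro p hp
  have h1 := h.2 ⟨p, hp.out⟩
  rw [localAct, localImage_span_basis, localization_span_basis] at h1
  rw [← det_polarGram_localBasis, ← det_polarGram_localBasis, norm_det_polarGram_eq _ h1]
  exact congrArg (fun M => ‖Matrix.det M‖) (polarGram_map (a ⟨p, hp.out⟩).2 (localBasis p b))

/-- Integrality (or divisibility) of the values of a form passes to completions. -/
theorem norm_polar_le_of_forall_norm_le {p : ℕ} [Fact p.Prime] {Q : QuadraticForm ℚ V}
    {L : Submodule ℤ V} {r : ℝ} (h : ∀ x ∈ L, ‖((Q x : ℚ) : ℚ_[p])‖ ≤ r)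
    {v w : ℚ_[p] ⊗[ℚ] V} (hv : v ∈ localization p L) (hw : w ∈ localization p L) :
    ‖QuadraticMap.polar (localForm p Q) v w‖ ≤ r := by
  have hr : 0 ≤ r := le_trans (norm_nonneg _) (h 0 (zero_mem _))
  rw [← QuadraticMap.polarBilin_apply_apply]
  induction hv using Submodule.span_induction with
  | mem v hv =>
    obtain ⟨x, hx, rfl⟩ := hv
    induction hw using Submodule.span_induction with
    | mem w hw =>
      obtain ⟨y, hy, rfl⟩ := hw
      change ‖QuadraticMap.polar (localForm p Q) ((1 : ℚ_[p]) ⊗ₜ[ℚ] x) ((1 : ℚ_[p]) ⊗ₜ[ℚ] y)‖ ≤ r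
      rw [polar_localForm_tmul, QuadraticMap.polar]
      push_cast
      exact (padic_norm_sub_le_max _ _).trans (max_le ((padic_norm_sub_le_max _ _).trans
        (max_le (by exact_mod_cast h _ (add_mem hx hy)) (h x hx))) (h y hy))
    | zero => simpa using hr
    | add w₁ w₂ _ _ h₁ h₂ =>
      rw [map_add]
      exact (IsUltrametricDist.norm_add_le_max _ _).trans (max_le h₁ h₂)
    | smul c w _ hw =>
      rw [← algebraMap_smul ℚ_[p] c w, map_smul, smul_eq_mul, norm_mul]
      have hc : ‖algebraMap ℤ_[p] ℚ_[p] c‖ ≤ 1 := c.2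
      nlinarith [norm_nonneg (algebraMap ℤ_[p] ℚ_[p] c)]
  | zero => simpa using hr
  | add w₁ w₂ _ _ h₁ h₂ =>
    rw [map_add, LinearMap.add_apply]
    exact (IsUltrametricDist.norm_add_le_max _ _).trans (max_le h₁ h₂)
  | smul c w _ hw =>
    rw [← algebraMap_smul ℚ_[p] c w, map_smul, LinearMap.smul_apply, smul_eq_mul, norm_mul]
    have hc : ‖algebraMap ℤ_[p] ℚ_[p] c‖ ≤ 1 := c.2
    nlinarith [norm_nonneg (algebraMap ℤ_[p] ℚ_[p] c)]

theorem norm_localForm_le_of_forall_norm_le {p : ℕ} [Fact p.Prime] {Q : QuadraticForm ℚ V}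
    {L : Submodule ℤ V} {r : ℝ} (h : ∀ x ∈ L, ‖((Q x : ℚ) : ℚ_[p])‖ ≤ r)
    {v : ℚ_[p] ⊗[ℚ] V} (hv : v ∈ localization p L) : ‖localForm p Q v‖ ≤ r := by
  have hr : 0 ≤ r := le_trans (norm_nonneg _) (h 0 (zero_mem _))
  induction hv using Submodule.span_induction with
  | mem v hv =>
    obtain ⟨x, hx, rfl⟩ := hv
    change ‖localForm p Q ((1 : ℚ_[p]) ⊗ₜ[ℚ] x)‖ ≤ r
    rw [localForm_tmul]
    exact h x hx
  | zero => simpa using hr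
  | add v w hv hw h₁ h₂ =>
    rw [QuadraticMap.map_add (localForm p Q)]
    refine (IsUltrametricDist.norm_add_le_max _ _).trans (max_le ?_
      (norm_polar_le_of_forall_norm_le h hv hw))
    exact (IsUltrametricDist.norm_add_le_max _ _).trans (max_le h₁ h₂)
  | smul c w _ hw =>
    rw [← algebraMap_smul ℚ_[p] c w, QuadraticMap.map_smul, smul_eq_mul, norm_mul, norm_mul]
    have hc : ‖algebraMap ℤ_[p] ℚ_[p] c‖ ≤ 1 := c.2
    have hc' : ‖algebraMap ℤ_[p] ℚ_[p] c‖ * ‖algebraMap ℤ_[p] ℚ_[p] c‖ ≤ 1 :=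
      mul_le_one₀ hc (norm_nonneg _) hc
    nlinarith [norm_nonneg (localForm p Q w)]

/-- Integrality is a property of the genus. -/
theorem integral_of_isTranslate {Q : QuadraticForm ℚ V} {L L' : Submodule ℤ V}
    (hL : ∀ x ∈ L, ∃ k : ℤ, Q x = k) {a : LocalIsometries Q} (h : IsTranslate Q L a L') :
    ∀ x ∈ L', ∃ k : ℤ, Q x = k := by
  intro x hx
  obtain ⟨k, hk⟩ := eq_intCast_of_forall_norm_le_one (q := Q x) fun p hp => by
    have h1 : (1 : ℚ_[p]) ⊗ₜ[ℚ] x ∈ localization p L' := tmul_mem_localization hx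
    have h2 := h.2 ⟨p, hp.out⟩
    change localization p L' = localAct (a ⟨p, hp.out⟩) (localization p L) at h2
    rw [h2] at h1
    obtain ⟨w, hw, hw'⟩ := mem_localAct.1 h1
    rw [← localForm_tmul, ← hw', (a ⟨p, hp.out⟩).2]
    refine norm_localForm_le_of_forall_norm_le (fun y hy => ?_) hw
    obtain ⟨k, hk⟩ := hL y hy
    rw [hk, Rat.cast_intCast]
    exact Padic.norm_int_le_one k
  exact ⟨k, hk.symm⟩

end GramRational

/-! ### Finiteness of the number of spinor genera -/

section Reduction

/-- For a reduced ternary form `(a, b, c, d, e, f)` the product of the diagonal coefficients is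
bounded by the discriminant. -/
theorem reduced_form_bound {a b c d e f : ℚ} (ha : 0 ≤ a) (hab : a ≤ b) (hbc : b ≤ c)
    (hf : |f| ≤ a) (he : |e| ≤ a) (hd : |d| ≤ b)
    (hs : ∀ s t : ℤ, 0 ≤ s * s * a + t * t * b + s * e + t * d + s * t * f) :
    2 * (a * b * c) ≤ 8 * (a * b * c) + 2 * (d * e * f) - 2 * a * d ^ 2 - 2 * b * e ^ 2 -
      2 * c * f ^ 2 := by
  have hb : 0 ≤ b := ha.trans hab
  have hc : 0 ≤ c := hb.trans hbc
  rw [← sq_abs d, ← sq_abs e, ← sq_abs f]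
  have hd0 := abs_nonneg d
  have he0 := abs_nonneg e
  have hf0 := abs_nonneg f
  have hdef : |d * e * f| = |d| * |e| * |f| := by rw [abs_mul, abs_mul]
  set D := |d| with hD
  set E := |e| with hE
  set F := |f| with hF
  have hac : a ≤ c := hab.trans hbc
  rcases le_or_gt 0 (d * e * f) with h | h
  · have h1 : a * D ^ 2 ≤ a * b * c := by
      calc a * D ^ 2 ≤ a * b ^ 2 := by gcongr
        _ = a * b * b := by ring
        _ ≤ a * b * c := by gcongr
    have h2 : b * E ^ 2 ≤ a * b * c := by
      calc b * E ^ 2 ≤ b * a ^ 2 := by gcongr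
        _ = a * b * a := by ring
        _ ≤ a * b * c := by gcongr
    have h3 : c * F ^ 2 ≤ a * b * c := by
      calc c * F ^ 2 ≤ c * a ^ 2 := by gcongr
        _ = a * a * c := by ring
        _ ≤ a * b * c := by gcongr
    linarith
  · -- the signs of `s` and `t` make all three mixed terms negative
    have h1 : D + E + F ≤ a + b := by
      have hs' := hs
      have key : ∀ s t : ℤ, s * s = 1 → t * t = 1 → (s : ℚ) * e = -E → (t : ℚ) * d = -D →
          (s : ℚ) * t * f = -F → D + E + F ≤ a + b := by
        intro s t hss htt h1 h2 h3
        have := hs s t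
        have e1 : (s : ℚ) * s = 1 := by exact_mod_cast hss
        have e2 : (t : ℚ) * t = 1 := by exact_mod_cast htt
        rw [h1, h2, h3, e1, e2] at this
        linarith
      rcases lt_or_ge d 0 with hd1 | hd1 <;> rcases lt_or_ge e 0 with he1 | he1 <;>
        rcases lt_or_ge f 0 with hf1 | hf1
      · refine key 1 1 (by norm_num) (by norm_num) ?_ ?_ ?_
        · rw [hE, abs_of_neg he1]; push_cast; ring
        · rw [hD, abs_of_neg hd1]; push_cast; ring
        · rw [hF, abs_of_neg hf1]; push_cast; ring
      · exact absurd h (not_lt.2 (mul_nonneg (mul_nonneg_of_nonpos_of_nonpos hd1.le he1.le) hf1))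
      · exact absurd h (not_lt.2 (mul_nonneg_of_nonpos_of_nonpos
          (mul_nonpos_of_nonpos_of_nonneg hd1.le he1) hf1.le))
      · refine key (-1) 1 (by norm_num) (by norm_num) ?_ ?_ ?_
        · rw [hE, abs_of_nonneg he1]; push_cast; ring
        · rw [hD, abs_of_neg hd1]; push_cast; ring
        · rw [hF, abs_of_nonneg hf1]; push_cast; ring
      · exact absurd h (not_lt.2 (mul_nonneg_of_nonpos_of_nonpos
          (mul_nonpos_of_nonneg_of_nonpos hd1 he1.le) hf1.le))
      · refine key 1 (-1) (by norm_num) (by norm_num) ?_ ?_ ?_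
        · rw [hE, abs_of_neg he1]; push_cast; ring
        · rw [hD, abs_of_nonneg hd1]; push_cast; ring
        · rw [hF, abs_of_nonneg hf1]; push_cast; ring
      · refine key (-1) (-1) (by norm_num) (by norm_num) ?_ ?_ ?_
        · rw [hE, abs_of_nonneg he1]; push_cast; ring
        · rw [hD, abs_of_nonneg hd1]; push_cast; ring
        · rw [hF, abs_of_neg hf1]; push_cast; ring
      · exact absurd h (not_lt.2 (mul_nonneg (mul_nonneg hd1 he1) hf1))
    have hdef' : d * e * f = -(D * E * F) := by
      rw [← hdef, abs_of_neg h, neg_neg]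
    have h2 : a * D ^ 2 ≤ a * b * D := by
      calc a * D ^ 2 = a * D * D := by ring
        _ ≤ a * b * D := by gcongr
    have h3 : b * E ^ 2 ≤ a * b * E := by
      calc b * E ^ 2 = E * b * E := by ring
        _ ≤ a * b * E := by gcongr
    have h4 : a * b * (D + E + F) ≤ a * b * (a + b) := by gcongr
    have h5 : c * F ^ 2 ≤ a * c * F := by
      calc c * F ^ 2 = F * c * F := by ring
        _ ≤ a * c * F := by gcongr
    have h6 : D * E * F ≤ b * a * F := by gcongr
    have h7 : a * b * a ≤ a * b * c := by gcongr
    have h8 : a * b * b ≤ a * b * c := by gcongr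
    have h9 : a * c * F ≤ a * c * b := by
      gcongr
      exact hf.trans hab
    linarith

theorem span_update_add {X : Type*} [AddCommGroup X] {L : Submodule ℤ X} {x : Fin 3 → X}
    (hx : Submodule.span ℤ (Set.range x) = L) {i j k : Fin 3} (hij : i ≠ j) (hik : i ≠ k)
    (s t : ℤ) :
    Submodule.span ℤ (Set.range (Function.update x i (x i + (s • x j + t • x k)))) = L := by
  set x' := Function.update x i (x i + (s • x j + t • x k)) with hx'
  have hi : x' i = x i + (s • x j + t • x k) := Function.update_self ..
  have hne : ∀ l, l ≠ i → x' l = x l := fun l hl => Function.update_of_ne hl ..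
  have hj := hne j hij.symm
  have hk := hne k hik.symm
  have hmem : ∀ l, x l ∈ Submodule.span ℤ (Set.range x) :=
    fun l => Submodule.subset_span (Set.mem_range_self l)
  have hmem' : ∀ l, x' l ∈ Submodule.span ℤ (Set.range x') :=
    fun l => Submodule.subset_span (Set.mem_range_self l)
  rw [← hx]
  refine le_antisymm (Submodule.span_le.2 ?_) (Submodule.span_le.2 ?_)
  · rintro _ ⟨l, rfl⟩
    by_cases hl : l = i
    · rw [hl, hi]
      exact add_mem (hmem i) (add_mem (Submodule.smul_mem _ _ (hmem j))
        (Submodule.smul_mem _ _ (hmem k)))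
    · rw [hne l hl]
      exact hmem l
  · rintro _ ⟨l, rfl⟩
    by_cases hl : l = i
    · have : x i = x' i - (s • x' j + t • x' k) := by rw [hi, hj, hk]; abel
      rw [hl, this]
      exact sub_mem (hmem' i) (add_mem (Submodule.smul_mem _ _ (hmem' j))
        (Submodule.smul_mem _ _ (hmem' k)))
    · rw [← hne l hl]
      exact hmem' l

variable {V : Type*} [AddCommGroup V] [Module ℚ V]

theorem quadratic_add_zsmul (Q : QuadraticForm ℚ V) (x y z : V) (s t : ℤ) :
    Q (z + (s • x + t • y)) = Q z + (s * s * Q x + t * t * Q y + s * QuadraticMap.polar Q x z +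
      t * QuadraticMap.polar Q y z + s * t * QuadraticMap.polar Q x y) := by
  rw [← Int.cast_smul_eq_zsmul ℚ s, ← Int.cast_smul_eq_zsmul ℚ t, QuadraticMap.map_add Q,
    QuadraticMap.map_add Q, QuadraticMap.map_smul, QuadraticMap.map_smul,
    QuadraticMap.polar_add_right, QuadraticMap.polar_smul_right, QuadraticMap.polar_smul_right,
    QuadraticMap.polar_smul_right, QuadraticMap.polar_smul_left, QuadraticMap.polar_comm Q z x,
    QuadraticMap.polar_comm Q z y]
  simp only [smul_eq_mul]
  ring

/-- A lattice has a basis that minimises the sum of the values of the form, ordered by these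
values. -/
theorem exists_reduced_basis (h3 : Module.finrank ℚ V = 3) {Q : QuadraticForm ℚ V} (hQ : Q.PosDef)
    {L : Submodule ℤ V} [hL : Submodule.IsLattice ℚ L] (hint : ∀ x ∈ L, ∃ k : ℤ, Q x = k) :
    ∃ b : Module.Basis (Fin 3) ℚ V, Submodule.span ℤ (Set.range b) = L ∧
      Q (b 0) ≤ Q (b 1) ∧ Q (b 1) ≤ Q (b 2) ∧
      ∀ i j k, i ≠ j → i ≠ k → ∀ s t : ℤ, Q (b i) ≤ Q (b i + (s • b j + t • b k)) := by
  have hfin : Module.Finite ℚ V := Module.finite_of_finrank_pos (by omega)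
  obtain ⟨b₀, hb₀⟩ := exists_basis_of_isLattice h3 L
  let S : Type _ := {x : Fin 3 → V // Submodule.span ℤ (Set.range x) = L}
  let f : S → ℕ := fun x => ⌊∑ i, Q (x.1 i)⌋₊
  obtain ⟨x, -, hx⟩ := (measure f).wf.has_min Set.univ ⟨⟨b₀, hb₀.symm⟩, trivial⟩
  have hsum : ∀ x : S, ∃ m : ℕ, ∑ i, Q (x.1 i) = m := by
    intro x
    have h1 : ∀ i, ∃ m : ℕ, Q (x.1 i) = m := by
      intro i
      obtain ⟨k, hk⟩ := hint (x.1 i) (x.2.le (Submodule.subset_span (Set.mem_range_self i)))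
      have h0 : (0 : ℚ) ≤ k := hk ▸ hQ.nonneg _
      lift k to ℕ using (by exact_mod_cast h0)
      exact ⟨k, by simpa using hk⟩
    choose m hm using h1
    exact ⟨∑ i, m i, by simp [hm]⟩
  have hmin : ∀ y : S, ∑ i, Q (x.1 i) ≤ ∑ i, Q (y.1 i) := by
    intro y
    have h1 : f x ≤ f y := not_lt.1 (hx y trivial)
    obtain ⟨m, hm⟩ := hsum x
    obtain ⟨m', hm'⟩ := hsum y
    simp only [f, hm, hm', Nat.floor_natCast] at h1
    rw [hm, hm']
    exact_mod_cast h1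
  set π := Tuple.sort fun i => Q (x.1 i) with hπ
  have hmono : Monotone ((fun i => Q (x.1 i)) ∘ π) := Tuple.monotone_sort _
  have hspan : Submodule.span ℤ (Set.range (x.1 ∘ π)) = L := by
    rw [π.surjective.range_comp, x.2]
  have htop : ⊤ ≤ Submodule.span ℚ (Set.range (x.1 ∘ π)) := by
    rw [← hL.span_eq_top]
    exact Submodule.span_le.2 fun v hv => Submodule.span_subset_span ℤ ℚ _ (hspan.ge hv)
  let b := basisOfTopLeSpanOfCardEqFinrank (x.1 ∘ π) htop (by rw [h3]; rfl)
  have hb : ⇑b = x.1 ∘ π := coe_basisOfTopLeSpanOfCardEqFinrank ..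
  refine ⟨b, by rw [hb, hspan], ?_, ?_, ?_⟩
  · rw [hb]
    exact hmono (by decide)
  · rw [hb]
    exact hmono (by decide)
  · intro i j k hij hik s t
    rw [hb]
    have h1 := hmin ⟨_, span_update_add hspan hij hik s t⟩
    have h2 : ∑ i, Q (x.1 i) = ∑ i, Q ((x.1 ∘ π) i) := (Equiv.sum_comp π fun i => Q (x.1 i)).symm
    rw [h2] at h1
    rw [← Finset.add_sum_erase _ _ (Finset.mem_univ i),
      ← Finset.add_sum_erase _ _ (Finset.mem_univ i)] at h1
    have h4 : ∑ l ∈ Finset.univ.erase i, Q (Function.update (x.1 ∘ π) i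
        ((x.1 ∘ π) i + (s • (x.1 ∘ π) j + t • (x.1 ∘ π) k)) l) =
        ∑ l ∈ Finset.univ.erase i, Q ((x.1 ∘ π) l) := by
      refine Finset.sum_congr rfl fun l hl => ?_
      rw [Function.update_of_ne (Finset.ne_of_mem_erase hl)]
    simp only [h4, Function.update_self] at h1
    linarith

/-- The entries of the Gram matrix of a reduced basis are bounded by the discriminant. -/
theorem exists_bounded_basis (h3 : Module.finrank ℚ V = 3) {Q : QuadraticForm ℚ V} (hQ : Q.PosDef)
    {L : Submodule ℤ V} [hL : Submodule.IsLattice ℚ L] (hint : ∀ x ∈ L, ∃ k : ℤ, Q x = k) :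
    ∃ b : Module.Basis (Fin 3) ℚ V, Submodule.span ℤ (Set.range b) = L ∧
      ∀ i j, |QuadraticMap.polar Q (b i) (b j)| ≤ 2 * (polarGram Q b).det := by
  obtain ⟨b, hb, h01, h12, hmin⟩ := exists_reduced_basis h3 hQ hint
  refine ⟨b, hb, ?_⟩
  have hpos : ∀ i, 1 ≤ Q (b i) := by
    intro i
    obtain ⟨k, hk⟩ := hint (b i) (hb.le (Submodule.subset_span (Set.mem_range_self i)))
    have h0 : (0 : ℚ) < k := hk ▸ hQ _ (b.ne_zero i)
    have h1 : (1 : ℤ) ≤ k := by exact_mod_cast h0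
    rw [hk]
    exact_mod_cast h1
  have habs : ∀ i j, i ≠ j → |QuadraticMap.polar Q (b j) (b i)| ≤ Q (b j) := by
    intro i j hij
    have h1 := hmin i j j hij hij 1 0
    have h2 := hmin i j j hij hij (-1) 0
    rw [quadratic_add_zsmul] at h1 h2
    push_cast at h1 h2
    rw [abs_le]
    constructor <;> linarith
  have hs : ∀ s t : ℤ, (0 : ℚ) ≤ s * s * Q (b 0) + t * t * Q (b 1) +
      s * QuadraticMap.polar Q (b 0) (b 2) + t * QuadraticMap.polar Q (b 1) (b 2) +
      s * t * QuadraticMap.polar Q (b 0) (b 1) := by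
    intro s t
    have := hmin 2 0 1 (by decide) (by decide) s t
    rw [quadratic_add_zsmul] at this
    linarith
  have hred := reduced_form_bound (zero_le_one.trans (hpos 0)) h01 h12 (habs 1 0 (by decide))
    (habs 2 0 (by decide)) (habs 2 1 (by decide)) hs
  have hdet := det_polarGram_eq_explicit Q b
  have hle : Q (b 2) ≤ (polarGram Q b).det := by
    have h1 : 1 * 1 * Q (b 2) ≤ Q (b 0) * Q (b 1) * Q (b 2) := by
      have := hpos 0
      have := hpos 1
      have := hpos 2
      gcongr
    have := hpos 2
    linarith
  have hQle : ∀ i, Q (b i) ≤ (polarGram Q b).det := by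
    intro i
    fin_cases i
    exacts [(h01.trans h12).trans hle, h12.trans hle, hle]
  intro i j
  by_cases hij : j = i
  · rw [hij, QuadraticMap.polar_self, nsmul_eq_mul, Nat.cast_ofNat,
      abs_of_nonneg (mul_nonneg zero_le_two (hQ.nonneg _))]
    have := hQle i
    linarith
  · have h1 := (habs j i hij).trans (hQle i)
    have h2 := hpos i
    have h3 := hQle i
    linarith

/-- Bases with the same Gram matrix are exchanged by an isometry. -/
theorem exists_isometry_of_polarGram_eq {Q : QuadraticForm ℚ V} {b b' : Module.Basis (Fin 3) ℚ V}
    (h : polarGram Q b = polarGram Q b') :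
    ∃ σ : orthogonalGroup Q, ∀ i, (σ : V ≃ₗ[ℚ] V) (b i) = b' i := by
  let f := b.equiv b' (Equiv.refl _)
  have hf : ∀ i, f (b i) = b' i := fun i => by simp [f]
  have h1 : Q.polarBilin.compl₁₂ (f : V →ₗ[ℚ] V) (f : V →ₗ[ℚ] V) = Q.polarBilin := by
    refine b.ext fun i => b.ext fun j => ?_
    change QuadraticMap.polar Q (f (b i)) (f (b j)) = QuadraticMap.polar Q (b i) (b j)
    rw [hf, hf]
    exact (congrFun (congrFun h i) j).symm
  refine ⟨⟨f, fun x => ?_⟩, hf⟩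
  have h2 := LinearMap.congr_fun (LinearMap.congr_fun h1 x) x
  change QuadraticMap.polar Q (f x) (f x) = QuadraticMap.polar Q x x at h2
  rw [QuadraticMap.polar_self, QuadraticMap.polar_self] at h2
  simpa using h2

/-- There are only finitely many spinor genera in a genus, as there are only finitely many
isometry classes. -/
theorem finite_spinorGenera (h3 : Module.finrank ℚ V = 3) {Q : QuadraticForm ℚ V} (hQ : Q.PosDef)
    {L : Submodule ℤ V} [hL : Submodule.IsLattice ℚ L] (hint : ∀ x ∈ L, ∃ k : ℤ, Q x = k) :
    (spinorGenera Q L).Finite := by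
  obtain ⟨d, hd⟩ := exists_isDiagonal_of_posDef h3 hQ
  obtain ⟨b₀, hb₀⟩ := exists_basis_of_isLattice h3 L
  set B : ℚ := 2 * (polarGram Q b₀).det with hB
  -- every spinor genus contains a lattice with a bounded integral Gram matrix
  have key : ∀ S : spinorGenera Q L, ∃ (L' : Submodule ℤ V) (a : LocalIsometries Q)
      (b : Module.Basis (Fin 3) ℚ V) (m : Fin 3 → Fin 3 → ℤ),
      spn Q L' = S.1 ∧ IsTranslate Q L a L' ∧ Submodule.span ℤ (Set.range b) = L' ∧
      (∀ i j, polarGram Q b i j = m i j) ∧ ∀ i j, m i j ∈ Set.Icc (-⌊B⌋) ⌊B⌋ := by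
    rintro ⟨_, L', hL', rfl⟩
    obtain ⟨a, ha⟩ := mem_gen_iff.1 hL'
    have hint' := integral_of_isTranslate hint ha
    have hlat := ha.1
    obtain ⟨b, hb, hbd⟩ := exists_bounded_basis h3 hQ hint'
    have hpol : ∀ i j, ∃ m : ℤ, QuadraticMap.polar Q (b i) (b j) = m := by
      intro i j
      have hm : ∀ i, b i ∈ L' := fun i => by
        rw [← hb]
        exact Submodule.subset_span (Set.mem_range_self i)
      obtain ⟨k₁, h₁⟩ := hint' _ (add_mem (hm i) (hm j))
      obtain ⟨k₂, h₂⟩ := hint' _ (hm i)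
      obtain ⟨k₃, h₃⟩ := hint' _ (hm j)
      exact ⟨k₁ - k₂ - k₃, by rw [QuadraticMap.polar, h₁, h₂, h₃]; push_cast; ring⟩
    choose m hm using hpol
    refine ⟨L', a, b, m, rfl, ha, hb, hm, fun i j => ?_⟩
    have h1 := hbd i j
    have h2 : (polarGram Q b).det = (polarGram Q b₀).det := by
      refine det_polarGram_eq_of_isTranslate h3 hQ (a := a) ?_
      rwa [hb, ← hb₀]
    rw [h2, hm, ← hB, abs_le] at h1
    refine ⟨?_, Int.le_floor.2 h1.2⟩
    rw [neg_le]
    refine Int.le_floor.2 ?_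
    push_cast
    linarith
  choose L' a b m hspn htr hb hm hmem using key
  have hinj : Function.Injective m := by
    intro S T hST
    obtain ⟨σ, hσ⟩ := exists_isometry_of_polarGram_eq (Q := Q) (b := b S) (b' := b T) (by
      ext i j
      rw [hm, hm, hST])
    have h1 : L' T ∈ spn Q (L' S) := by
      refine mem_spn_iff.2 ⟨σ, 1, fun p => one_mem _, (htr T).1, fun p => ?_⟩
      have h2 : L' T = mapLattice ((σ : V ≃ₗ[ℚ] V) : V →ₗ[ℚ] V) (L' S) := by
        rw [← hb S, ← hb T, mapLattice, Submodule.map_span, ← Set.range_comp]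
        congr 2
        funext i
        exact (hσ i).symm
      rw [h2, localization_mapLattice, mul_one]
      rfl
    rw [mem_spn_iff_mul_inv_mem hd (htr T) (htr S), ← spn_eq_iff hd (htr T) (htr S), hspn,
      hspn] at h1
    exact Subtype.ext h1.symm
  have hfin : (Set.range m).Finite := by
    refine Set.Finite.subset (Set.Finite.pi' fun _ : Fin 3 => Set.Finite.pi' fun _ : Fin 3 =>
      Set.finite_Icc (-⌊B⌋) ⌊B⌋) ?_
    rintro _ ⟨S, rfl⟩
    exact hmem S
  have := hfin.to_subtype
  exact Set.finite_coe_iff.1 (Finite.of_injective (Set.rangeFactorization m)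
    fun S T h => hinj (congrArg Subtype.val h))

end Reduction

/-! ### Local lattices: hyperbolic splittings -/

section PadicNorm

variable {p : ℕ} [hp : Fact p.Prime]

theorem norm_mul_le_one {x y : ℚ_[p]} (hx : ‖x‖ ≤ 1) (hy : ‖y‖ ≤ 1) : ‖x * y‖ ≤ 1 := by
  rw [norm_mul]
  exact mul_le_one₀ hx (norm_nonneg _) hy

theorem norm_add_lt_one {x y : ℚ_[p]} (hx : ‖x‖ < 1) (hy : ‖y‖ < 1) : ‖x + y‖ < 1 :=
  (IsUltrametricDist.norm_add_le_max x y).trans_lt (max_lt hx hy)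

theorem norm_sub_lt_one {x y : ℚ_[p]} (hx : ‖x‖ < 1) (hy : ‖y‖ < 1) : ‖x - y‖ < 1 :=
  (padic_norm_sub_le_max x y).trans_lt (max_lt hx hy)

theorem norm_mul_lt_one {x y : ℚ_[p]} (hx : ‖x‖ ≤ 1) (hy : ‖y‖ < 1) : ‖x * y‖ < 1 := by
  rw [norm_mul]
  exact mul_lt_one_of_nonneg_of_lt_one_right hx (norm_nonneg _) hy

theorem norm_lt_one_congr {x y : ℚ_[p]} (h : ‖x - y‖ < 1) : ‖x‖ < 1 ↔ ‖y‖ < 1 := by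
  constructor
  · intro hx
    have := norm_sub_lt_one hx h
    rwa [sub_sub_cancel] at this
  · intro hy
    have := norm_add_lt_one h hy
    rwa [sub_add_cancel] at this

theorem norm_add_eq_one {x y : ℚ_[p]} (hx : ‖x‖ = 1) (hy : ‖y‖ < 1) : ‖x + y‖ = 1 := by
  rw [IsUltrametricDist.norm_add_eq_max_of_norm_ne_norm (by rw [hx]; exact hy.ne'), hx,
    max_eq_left hy.le]

theorem norm_natCast_le_one (n : ℕ) : ‖(n : ℚ_[p])‖ ≤ 1 := by
  exact_mod_cast Padic.norm_int_le_one (p := p) n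

theorem norm_two_le_one : ‖(2 : ℚ_[p])‖ ≤ 1 := by
  exact_mod_cast norm_natCast_le_one (p := p) 2

theorem norm_le_inv_iff_lt_one {x : ℚ_[p]} : ‖x‖ ≤ (p : ℝ)⁻¹ ↔ ‖x‖ < 1 := by
  have := Padic.norm_le_pow_iff_norm_lt_pow_add_one x (-1)
  simpa using this

/-- A quadratic equation with a simple root at zero modulo `p` has a root divisible by `p`. -/
theorem exists_root_quadratic {a b c : ℚ_[p]} (ha : ‖a‖ ≤ 1) (hb : ‖b‖ = 1) (hc : ‖c‖ < 1) :
    ∃ t : ℚ_[p], ‖t‖ < 1 ∧ a * t ^ 2 + b * t + c = 0 := by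
  obtain ⟨a, rfl⟩ : ∃ z : ℤ_[p], (z : ℚ_[p]) = a := ⟨⟨a, ha⟩, rfl⟩
  obtain ⟨b, rfl⟩ : ∃ z : ℤ_[p], (z : ℚ_[p]) = b := ⟨⟨b, hb.le⟩, rfl⟩
  obtain ⟨c, rfl⟩ : ∃ z : ℤ_[p], (z : ℚ_[p]) = c := ⟨⟨c, hc.le⟩, rfl⟩
  rw [← PadicInt.norm_def] at hb hc
  let F : Polynomial ℤ_[p] := Polynomial.C a * Polynomial.X ^ 2 + Polynomial.C b * Polynomial.X +
    Polynomial.C c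
  have hF : ∀ t : ℤ_[p], Polynomial.aeval t F = a * t ^ 2 + b * t + c := fun t => by simp [F]
  have hF' : Polynomial.aeval (0 : ℤ_[p]) F.derivative = b := by simp [F]
  obtain ⟨z, hz, hz', -⟩ := hensels_lemma (F := F) (a := 0) (by
    rw [hF, hF', hb]
    simpa using hc)
  rw [hF', hb, sub_zero, PadicInt.norm_def] at hz'
  rw [hF] at hz
  refine ⟨z, hz', ?_⟩
  exact_mod_cast congrArg (fun w : ℤ_[p] => (w : ℚ_[p])) hz

/-- A `p`-adic number of even valuation is a square up to a unit. -/
theorem exists_unit_mul_isSquare {g : ℚ_[p]} (hg : g ≠ 0) (hv : Even g.valuation) :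
    ∃ u : ℚ_[p], ‖u‖ = 1 ∧ IsSquare (g * u) := by
  obtain ⟨k, hk⟩ := hv
  have hp0 : (p : ℚ_[p]) ≠ 0 := Nat.cast_ne_zero.2 hp.out.ne_zero
  refine ⟨(p : ℚ_[p]) ^ g.valuation * g⁻¹, ?_, (p : ℚ_[p]) ^ k, ?_⟩
  · rw [norm_mul, norm_inv, Padic.norm_eq_zpow_neg_valuation hg, Padic.norm_p_zpow]
    exact mul_inv_cancel₀ (zpow_ne_zero _ (Nat.cast_ne_zero.2 hp.out.ne_zero))
  · rw [mul_left_comm, mul_inv_cancel₀ hg, mul_one, hk, zpow_add₀ hp0]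

end PadicNorm

section HyperbolicBasis

variable {p : ℕ} [hp : Fact p.Prime] {X : Type*} [AddCommGroup X] [Module ℚ_[p] X]

theorem quadratic_smul_add_smul {K : Type*} [Field K] {Y : Type*} [AddCommGroup Y] [Module K Y]
    (q : QuadraticForm K Y) (a c : K) (u v : Y) :
    q (a • u + c • v) = a * a * q u + c * c * q v + a * c * QuadraticMap.polar q u v := by
  rw [QuadraticMap.map_add q, QuadraticMap.map_smul, QuadraticMap.map_smul,
    QuadraticMap.polar_smul_left, QuadraticMap.polar_smul_right]
  simp only [smul_eq_mul]
  ring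

/-- The basis `h` splits the space as a hyperbolic plane scaled by `r`, with isotropic vectors
`h 0`, `h 1`, and an orthogonal line spanned by `h 2`. -/
structure IsHyperbolicBasis (q : QuadraticForm ℚ_[p] X) (h : Module.Basis (Fin 3) ℚ_[p] X)
    (r : ℚ_[p]) : Prop where
  zero : q (h 0) = 0
  one : q (h 1) = 0
  polar_zero_one : QuadraticMap.polar q (h 0) (h 1) = r
  polar_zero_two : QuadraticMap.polar q (h 0) (h 2) = 0
  polar_one_two : QuadraticMap.polar q (h 1) (h 2) = 0

variable {q : QuadraticForm ℚ_[p] X} {h x : Module.Basis (Fin 3) ℚ_[p] X} {r : ℚ_[p]}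

theorem IsHyperbolicBasis.apply (hh : IsHyperbolicBasis q h r) (v : X) :
    q v = r * (h.repr v 0 * h.repr v 1) + q (h 2) * (h.repr v 2 * h.repr v 2) := by
  conv_lhs => rw [← h.sum_repr v, Fin.sum_univ_three, QuadraticMap.map_add q,
    quadratic_smul_add_smul, QuadraticMap.map_smul, QuadraticMap.polar_smul_right,
    QuadraticMap.polar_add_left, QuadraticMap.polar_smul_left, QuadraticMap.polar_smul_left,
    hh.zero, hh.one, hh.polar_zero_one, hh.polar_zero_two, hh.polar_one_two]
  simp only [smul_eq_mul]
  ring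

theorem IsHyperbolicBasis.det_polarGram (hh : IsHyperbolicBasis q h r) :
    (polarGram q h).det = -(2 * q (h 2) * r ^ 2) := by
  rw [det_polarGram_eq_explicit, hh.zero, hh.one, hh.polar_zero_one, hh.polar_zero_two,
    hh.polar_one_two]
  ring

/-- The reflections in the vectors `h 0 + u (h 1)` of a hyperbolic plane exchange the two isotropic
lines. -/
theorem IsHyperbolicBasis.reflection_apply (hh : IsHyperbolicBasis q h r) (hr : r ≠ 0)
    {u : ℚ_[p]} (hu : u ≠ 0) :
    q (h 0 + u • h 1) = r * u ∧ reflection q (h 0 + u • h 1) (h 0) = -(u • h 1) ∧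
      reflection q (h 0 + u • h 1) (h 1) = -(u⁻¹ • h 0) ∧
      reflection q (h 0 + u • h 1) (h 2) = h 2 := by
  have hq : q (h 0 + u • h 1) = r * u := by
    have := quadratic_smul_add_smul q 1 u (h 0) (h 1)
    rw [one_smul, hh.zero, hh.one, hh.polar_zero_one] at this
    rw [this]
    ring
  refine ⟨hq, ?_, ?_, ?_⟩
  · rw [TernaryLattice.reflection_apply, hq, QuadraticMap.polar_add_left,
      QuadraticMap.polar_smul_left, QuadraticMap.polar_self, hh.zero,
      QuadraticMap.polar_comm q (h 1), hh.polar_zero_one, smul_zero, zero_add, smul_eq_mul]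
    have : (r * u)⁻¹ * (u * r) = 1 := by field_simp
    rw [this]
    module
  · rw [TernaryLattice.reflection_apply, hq, QuadraticMap.polar_add_left,
      QuadraticMap.polar_smul_left, QuadraticMap.polar_self, hh.one,
      hh.polar_zero_one, smul_zero, smul_zero, add_zero]
    have : (r * u)⁻¹ * r = u⁻¹ := by field_simp
    rw [this, smul_add, smul_smul, inv_mul_cancel₀ hu]
    module
  · refine reflection_of_polar_eq_zero q ?_
    rw [QuadraticMap.polar_add_left, QuadraticMap.polar_smul_left, hh.polar_zero_two,
      hh.polar_one_two, smul_zero, add_zero]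

end HyperbolicBasis

section Hyperbolic

variable {p : ℕ} [hp : Fact p.Prime] {X : Type*} [AddCommGroup X] [Module ℚ_[p] X]
  [Module ℤ_[p] X] [IsScalarTower ℤ_[p] ℚ_[p] X]
  {q : QuadraticForm ℚ_[p] X} {x : Module.Basis (Fin 3) ℚ_[p] X}

theorem smul_mem_of_norm_le_one (S : Submodule ℤ_[p] X) {c : ℚ_[p]} (hc : ‖c‖ ≤ 1) {v : X}
    (hv : v ∈ S) : c • v ∈ S := by
  obtain ⟨c, rfl⟩ : ∃ z : ℤ_[p], algebraMap ℤ_[p] ℚ_[p] z = c := ⟨⟨c, hc⟩, rfl⟩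
  rw [algebraMap_smul]
  exact S.smul_mem _ hv

/-- A lattice on which the form is integral, and divisible by `p` on the sublattice
`x 2 ≡ 0 (mod p)`, either reduces to a multiple of the square of the third coordinate modulo `p`,
or splits a hyperbolic plane compatible with the sublattice. This is the second case. -/
theorem exists_isHyperbolicBasis_of_norm_eq_one
    (hN : ∀ v ∈ Submodule.span ℤ_[p] (Set.range x), ‖q v‖ ≤ 1)
    (hM : ∀ v ∈ Submodule.span ℤ_[p] (Set.range x), ‖x.repr v 2‖ < 1 → ‖q v‖ < 1)
    (h1 : ‖QuadraticMap.polar q (x 0) (x 2)‖ = 1) :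
    ∃ h : Module.Basis (Fin 3) ℚ_[p] X, IsHyperbolicBasis q h 1 ∧
      Submodule.span ℤ_[p] (Set.range h) = Submodule.span ℤ_[p] (Set.range x) ∧
      ‖q (h 2)‖ < 1 ∧ ∀ v ∈ Submodule.span ℤ_[p] (Set.range x),
        (‖x.repr v 2‖ < 1 ↔ ‖h.repr v 1‖ < 1) := by
  have hx : ∀ i, x i ∈ Submodule.span ℤ_[p] (Set.range x) :=
    fun i => Submodule.subset_span (Set.mem_range_self i)
  have hx2 : ∀ i j, x.repr (x i) j = if i = j then 1 else 0 := fun i j => by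
    rw [x.repr_self, Finsupp.single_apply]
  have hpol : ∀ v ∈ Submodule.span ℤ_[p] (Set.range x), ∀ w ∈ Submodule.span ℤ_[p] (Set.range x),
      ‖QuadraticMap.polar q v w‖ ≤ 1 := by
    intro v hv w hw
    exact (padic_norm_sub_le_max _ _).trans (max_le ((padic_norm_sub_le_max _ _).trans
      (max_le (hN _ (add_mem hv hw)) (hN v hv))) (hN w hw))
  have hpolM : ∀ v ∈ Submodule.span ℤ_[p] (Set.range x), ∀ w ∈ Submodule.span ℤ_[p] (Set.range x),
      ‖x.repr v 2‖ < 1 → ‖x.repr w 2‖ < 1 → ‖QuadraticMap.polar q v w‖ < 1 := by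
    intro v hv w hw hv' hw'
    exact norm_sub_lt_one (norm_sub_lt_one (hM _ (add_mem hv hw) (by
      rw [map_add, Finsupp.add_apply]
      exact norm_add_lt_one hv' hw')) (hM v hv hv')) (hM w hw hw')
  -- an isotropic vector `e` in the sublattice, by Hensel's lemma
  obtain ⟨t, ht, hroot⟩ := exists_root_quadratic (hN _ (hx 2)) h1 (hM _ (hx 0) (by
    rw [hx2]; simp))
  set a := q (x 2) with ha
  set e := x 0 + t • x 2 with he
  have hqe : q e = 0 := by
    have := quadratic_smul_add_smul q 1 t (x 0) (x 2)
    rw [one_smul] at this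
    rw [he, this, ← hroot]
    ring
  have hee : QuadraticMap.polar q e e = 0 := by rw [QuadraticMap.polar_self, hqe, smul_zero]
  set β := QuadraticMap.polar q e (x 2) with hβ
  have hβ1 : ‖β‖ = 1 := by
    have : β = QuadraticMap.polar q (x 0) (x 2) + t * (2 * a) := by
      rw [hβ, he, QuadraticMap.polar_add_left, QuadraticMap.polar_smul_left,
        QuadraticMap.polar_self, nsmul_eq_mul, smul_eq_mul, Nat.cast_ofNat]
    rw [this]
    refine norm_add_eq_one h1 ?_
    rw [mul_comm]
    exact norm_mul_lt_one (norm_mul_le_one norm_two_le_one (hN _ (hx 2))) ht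
  have hβ0 : β ≠ 0 := fun h0 => by rw [h0, norm_zero] at hβ1; exact zero_ne_one hβ1
  have hβi : ‖β⁻¹‖ = 1 := by rw [norm_inv, hβ1, inv_one]
  have heN : e ∈ Submodule.span ℤ_[p] (Set.range x) :=
    add_mem (hx 0) (smul_mem_of_norm_le_one _ ht.le (hx 2))
  have he2 : x.repr e 2 = t := by
    rw [he, map_add, map_smul, Finsupp.add_apply, Finsupp.smul_apply, hx2, hx2]
    simp
  have heM : ‖x.repr e 2‖ < 1 := by rw [he2]; exact ht
  -- its hyperbolic partner `f`
  set f := (-(a * β⁻¹ * β⁻¹)) • e + β⁻¹ • x 2 with hf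
  have hcf : ‖-(a * β⁻¹ * β⁻¹)‖ ≤ 1 := by
    rw [norm_neg]
    exact norm_mul_le_one (norm_mul_le_one (hN _ (hx 2)) hβi.le) hβi.le
  have hfN : f ∈ Submodule.span ℤ_[p] (Set.range x) :=
    add_mem (smul_mem_of_norm_le_one _ hcf heN) (smul_mem_of_norm_le_one _ hβi.le (hx 2))
  have hqf : q f = 0 := by
    rw [hf, quadratic_smul_add_smul, hqe, ← hβ, ← ha]
    field_simp
    ring
  have hef : QuadraticMap.polar q e f = 1 := by
    rw [hf, QuadraticMap.polar_add_right, QuadraticMap.polar_smul_right,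
      QuadraticMap.polar_smul_right, hee, ← hβ, smul_zero, zero_add, smul_eq_mul,
      inv_mul_cancel₀ hβ0]
  have hff : QuadraticMap.polar q f f = 0 := by rw [QuadraticMap.polar_self, hqf, smul_zero]
  have hf2 : ‖x.repr f 2‖ = 1 := by
    have : x.repr f 2 = β⁻¹ + (-(a * β⁻¹ * β⁻¹)) * x.repr e 2 := by
      rw [hf, map_add, map_smul, map_smul, Finsupp.add_apply, Finsupp.smul_apply,
        Finsupp.smul_apply, hx2]
      simp
      ring
    rw [this]
    exact norm_add_eq_one hβi (norm_mul_lt_one hcf heM)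
  -- the orthogonal projection `z` of `x 1`
  set μ := QuadraticMap.polar q (x 1) f with hμ
  set κ := QuadraticMap.polar q (x 1) e with hκ
  have hμ1 : ‖μ‖ ≤ 1 := hpol _ (hx 1) _ hfN
  have hκ1 : ‖κ‖ < 1 := hpolM _ (hx 1) _ heN (by rw [hx2]; simp) heM
  set z := x 1 - (μ • e + κ • f) with hz
  have hzN : z ∈ Submodule.span ℤ_[p] (Set.range x) :=
    sub_mem (hx 1) (add_mem (smul_mem_of_norm_le_one _ hμ1 heN)
      (smul_mem_of_norm_le_one _ hκ1.le hfN))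
  have hz2 : ‖x.repr z 2‖ < 1 := by
    have : x.repr z 2 = 0 - (μ * x.repr e 2 + x.repr f 2 * κ) := by
      rw [hz, map_sub, map_add, map_smul, map_smul, Finsupp.sub_apply, Finsupp.add_apply,
        Finsupp.smul_apply, Finsupp.smul_apply, hx2]
      simp [mul_comm]
    rw [this]
    exact norm_sub_lt_one (by simp) (norm_add_lt_one (norm_mul_lt_one hμ1 heM)
      (norm_mul_lt_one hf2.le hκ1))
  have hez : QuadraticMap.polar q e z = 0 := by
    rw [hz, QuadraticMap.polar_sub_right, QuadraticMap.polar_add_right,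
      QuadraticMap.polar_smul_right, QuadraticMap.polar_smul_right, hee, hef,
      QuadraticMap.polar_comm q e (x 1), ← hκ]
    simp
  have hfz : QuadraticMap.polar q f z = 0 := by
    rw [hz, QuadraticMap.polar_sub_right, QuadraticMap.polar_add_right,
      QuadraticMap.polar_smul_right, QuadraticMap.polar_smul_right, hff,
      QuadraticMap.polar_comm q f (x 1), QuadraticMap.polar_comm q f e, hef, ← hμ]
    simp
  have hx2' : x 2 = β • f + (a * β⁻¹) • e := by
    rw [hf, smul_add, smul_smul, smul_smul, mul_inv_cancel₀ hβ0, one_smul]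
    have : β * -(a * β⁻¹ * β⁻¹) = -(a * β⁻¹) := by field_simp
    rw [this]
    module
  have hx0' : x 0 = e - t • x 2 := by rw [he]; abel
  have hx1' : x 1 = z + (μ • e + κ • f) := by rw [hz]; abel
  -- the three vectors span the lattice
  have hspan : Submodule.span ℤ_[p] (Set.range ![e, f, z]) =
      Submodule.span ℤ_[p] (Set.range x) := by
    refine le_antisymm (Submodule.span_le.2 ?_) (Submodule.span_le.2 ?_)
    · rintro _ ⟨i, rfl⟩
      fin_cases i
      exacts [heN, hfN, hzN]
    · have hm : ∀ i, ![e, f, z] i ∈ Submodule.span ℤ_[p] (Set.range ![e, f, z]) :=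
        fun i => Submodule.subset_span (Set.mem_range_self i)
      have m2 : x 2 ∈ Submodule.span ℤ_[p] (Set.range ![e, f, z]) := by
        rw [hx2']
        exact add_mem (smul_mem_of_norm_le_one _ hβ1.le (hm 1))
          (smul_mem_of_norm_le_one _ (norm_mul_le_one (hN _ (hx 2)) hβi.le) (hm 0))
      rintro _ ⟨i, rfl⟩
      fin_cases i
      · change x 0 ∈ _
        rw [hx0']
        exact sub_mem (hm 0) (smul_mem_of_norm_le_one _ ht.le m2)
      · change x 1 ∈ _
        rw [hx1']
        exact add_mem (hm 2) (add_mem (smul_mem_of_norm_le_one _ hμ1 (hm 0))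
          (smul_mem_of_norm_le_one _ hκ1.le (hm 1)))
      · exact m2
  have htop : ⊤ ≤ Submodule.span ℚ_[p] (Set.range ![e, f, z]) := by
    rw [← x.span_eq]
    refine Submodule.span_le.2 ?_
    rintro _ ⟨i, rfl⟩
    exact Submodule.span_subset_span ℤ_[p] ℚ_[p] _ (hspan.ge (hx i))
  have hfin : Module.Finite ℚ_[p] X := Module.Finite.of_basis x
  let h := basisOfTopLeSpanOfCardEqFinrank ![e, f, z] htop
    (Module.finrank_eq_card_basis x).symm
  have hcoe : ⇑h = ![e, f, z] := coe_basisOfTopLeSpanOfCardEqFinrank ..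
  have h0 : h 0 = e := by rw [hcoe]; rfl
  have h1' : h 1 = f := by rw [hcoe]; rfl
  have h2' : h 2 = z := by rw [hcoe]; rfl
  refine ⟨h, ⟨by rw [h0, hqe], by rw [h1', hqf], by rw [h0, h1', hef], by rw [h0, h2', hez],
    by rw [h1', h2', hfz]⟩, by rw [hcoe, hspan], by rw [h2']; exact hM z hzN hz2, ?_⟩
  intro v hv
  have hv' : ∀ i, ‖h.repr v i‖ ≤ 1 := by
    rw [← hspan, ← hcoe] at hv
    exact mem_span_basis_padic.1 hv
  have e1 : x.repr v 2 = h.repr v 1 * x.repr f 2 + (h.repr v 0 * x.repr e 2 +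
      h.repr v 2 * x.repr z 2) := by
    conv_lhs => rw [← h.sum_repr v, Fin.sum_univ_three, h0, h1', h2', map_add, map_add, map_smul,
      map_smul, map_smul]
    simp only [Finsupp.add_apply, Finsupp.smul_apply, smul_eq_mul]
    ring
  have e2 : ‖x.repr v 2 - h.repr v 1 * x.repr f 2‖ < 1 := by
    rw [e1, add_sub_cancel_left]
    exact norm_add_lt_one (norm_mul_lt_one (hv' 0) heM) (norm_mul_lt_one (hv' 2) hz2)
  rw [norm_lt_one_congr e2, norm_mul, hf2, mul_one]

theorem exists_isHyperbolicBasis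
    (hN : ∀ v ∈ Submodule.span ℤ_[p] (Set.range x), ‖q v‖ ≤ 1)
    (hM : ∀ v ∈ Submodule.span ℤ_[p] (Set.range x), ‖x.repr v 2‖ < 1 → ‖q v‖ < 1)
    (h1 : ‖QuadraticMap.polar q (x 0) (x 2)‖ = 1 ∨ ‖QuadraticMap.polar q (x 1) (x 2)‖ = 1) :
    ∃ h : Module.Basis (Fin 3) ℚ_[p] X, IsHyperbolicBasis q h 1 ∧
      Submodule.span ℤ_[p] (Set.range h) = Submodule.span ℤ_[p] (Set.range x) ∧
      ‖q (h 2)‖ < 1 ∧ ∀ v ∈ Submodule.span ℤ_[p] (Set.range x),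
        (‖x.repr v 2‖ < 1 ↔ ‖h.repr v 1‖ < 1) := by
  rcases h1 with h1 | h1
  · exact exists_isHyperbolicBasis_of_norm_eq_one hN hM h1
  · let y := x.reindex (Equiv.swap 0 1)
    have hy : Set.range y = Set.range x := x.range_reindex _
    have hy2 : ∀ v, y.repr v 2 = x.repr v 2 := fun v => by
      rw [Module.Basis.repr_reindex_apply]
      rfl
    have := exists_isHyperbolicBasis_of_norm_eq_one (q := q) (x := y) (by rwa [hy])
      (by rw [hy]; intro v hv; rw [hy2]; exact hM v hv)
      (by rw [Module.Basis.reindex_apply, Module.Basis.reindex_apply]; exact h1)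
    rw [hy] at this
    simpa only [hy2] using this

section Degenerate

/-- Splitting off the third coordinate of a vector of the lattice. -/
theorem exists_eq_add_smul {v : X} (hv : v ∈ Submodule.span ℤ_[p] (Set.range x)) :
    ∃ v' ∈ Submodule.span ℤ_[p] (Set.range x), x.repr v' 2 = 0 ∧ v = v' + x.repr v 2 • x 2 ∧
      v' = x.repr v 0 • x 0 + x.repr v 1 • x 1 := by
  have hv' := mem_span_basis_padic.1 hv
  have hx : ∀ i, x i ∈ Submodule.span ℤ_[p] (Set.range x) :=
    fun i => Submodule.subset_span (Set.mem_range_self i)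
  refine ⟨x.repr v 0 • x 0 + x.repr v 1 • x 1, add_mem (smul_mem_of_norm_le_one _ (hv' 0) (hx 0))
    (smul_mem_of_norm_le_one _ (hv' 1) (hx 1)), ?_, ?_, rfl⟩
  · simp
  · conv_lhs => rw [← x.sum_repr v, Fin.sum_univ_three]

theorem norm_quadratic_sub_lt_one
    (hM : ∀ v ∈ Submodule.span ℤ_[p] (Set.range x), ‖x.repr v 2‖ < 1 → ‖q v‖ < 1)
    (h0 : ‖QuadraticMap.polar q (x 0) (x 2)‖ < 1) (h1 : ‖QuadraticMap.polar q (x 1) (x 2)‖ < 1)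
    {v : X} (hv : v ∈ Submodule.span ℤ_[p] (Set.range x)) :
    ‖q v - q (x 2) * (x.repr v 2 * x.repr v 2)‖ < 1 := by
  have hc := mem_span_basis_padic.1 hv
  obtain ⟨v', hv', h2, hvv, hv''⟩ := exists_eq_add_smul hv
  have e1 : q v = q v' + x.repr v 2 * x.repr v 2 * q (x 2) +
      x.repr v 2 * QuadraticMap.polar q v' (x 2) := by
    conv_lhs => rw [hvv]
    have := quadratic_smul_add_smul q 1 (x.repr v 2) v' (x 2)
    rw [one_smul] at this
    rw [this]
    ring
  have e2 : q v - q (x 2) * (x.repr v 2 * x.repr v 2) = q v' +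
      x.repr v 2 * QuadraticMap.polar q v' (x 2) := by
    rw [e1]
    ring
  rw [e2]
  refine norm_add_lt_one (hM v' hv' (by rw [h2, norm_zero]; exact one_pos))
    (norm_mul_lt_one (hc 2) ?_)
  rw [hv'', QuadraticMap.polar_add_left, QuadraticMap.polar_smul_left,
    QuadraticMap.polar_smul_left, smul_eq_mul, smul_eq_mul]
  exact norm_add_lt_one (norm_mul_lt_one (hc 0) h0) (norm_mul_lt_one (hc 1) h1)

theorem norm_polar_sub_lt_one
    (hM : ∀ v ∈ Submodule.span ℤ_[p] (Set.range x), ‖x.repr v 2‖ < 1 → ‖q v‖ < 1)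
    (h0 : ‖QuadraticMap.polar q (x 0) (x 2)‖ < 1) (h1 : ‖QuadraticMap.polar q (x 1) (x 2)‖ < 1)
    {v w : X} (hv : v ∈ Submodule.span ℤ_[p] (Set.range x))
    (hw : w ∈ Submodule.span ℤ_[p] (Set.range x)) :
    ‖QuadraticMap.polar q v w - 2 * q (x 2) * (x.repr v 2 * x.repr w 2)‖ < 1 := by
  have e1 := norm_quadratic_sub_lt_one hM h0 h1 (add_mem hv hw)
  have e2 := norm_quadratic_sub_lt_one hM h0 h1 hv
  have e3 := norm_quadratic_sub_lt_one hM h0 h1 hw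
  have e4 := norm_sub_lt_one (norm_sub_lt_one e1 e2) e3
  rw [map_add x.repr, Finsupp.add_apply] at e4
  convert e4 using 2
  rw [QuadraticMap.polar]
  ring

/-- In the degenerate case the sublattice consists of the vectors of length divisible by `p`. -/
theorem repr_two_lt_one_iff
    (hN : ∀ v ∈ Submodule.span ℤ_[p] (Set.range x), ‖q v‖ ≤ 1)
    (hM : ∀ v ∈ Submodule.span ℤ_[p] (Set.range x), ‖x.repr v 2‖ < 1 → ‖q v‖ < 1)
    (h0 : ‖QuadraticMap.polar q (x 0) (x 2)‖ < 1) (h1 : ‖QuadraticMap.polar q (x 1) (x 2)‖ < 1)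
    (hprim : ∃ v ∈ Submodule.span ℤ_[p] (Set.range x), ‖q v‖ = 1) {v : X}
    (hv : v ∈ Submodule.span ℤ_[p] (Set.range x)) : ‖x.repr v 2‖ < 1 ↔ ‖q v‖ < 1 := by
  have h2 : ‖q (x 2)‖ = 1 := by
    obtain ⟨w, hw, hw1⟩ := hprim
    refine le_antisymm (hN _ (Submodule.subset_span (Set.mem_range_self 2))) (not_lt.1 fun hlt => ?_)
    have e := (norm_lt_one_congr (norm_quadratic_sub_lt_one hM h0 h1 hw)).2 (by
      have hc := mem_span_basis_padic.1 hw 2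
      rw [mul_comm]
      exact norm_mul_lt_one (norm_mul_le_one hc hc) hlt)
    exact e.ne hw1
  rw [norm_lt_one_congr (norm_quadratic_sub_lt_one hM h0 h1 hv), norm_mul, h2, one_mul,
    norm_mul]
  constructor
  · intro h
    exact mul_lt_one_of_nonneg_of_lt_one_left (norm_nonneg _) h h.le
  · intro h
    by_contra hn
    have := not_lt.1 hn
    nlinarith

/-- In the degenerate case no binary sublattice is unimodular for the polar form. -/
theorem norm_det_lt_one
    (hN : ∀ v ∈ Submodule.span ℤ_[p] (Set.range x), ‖q v‖ ≤ 1)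
    (hM : ∀ v ∈ Submodule.span ℤ_[p] (Set.range x), ‖x.repr v 2‖ < 1 → ‖q v‖ < 1)
    (h0 : ‖QuadraticMap.polar q (x 0) (x 2)‖ < 1) (h1 : ‖QuadraticMap.polar q (x 1) (x 2)‖ < 1)
    {v w : X} (hv : v ∈ Submodule.span ℤ_[p] (Set.range x))
    (hw : w ∈ Submodule.span ℤ_[p] (Set.range x)) :
    ‖QuadraticMap.polar q v v * QuadraticMap.polar q w w -
      QuadraticMap.polar q v w * QuadraticMap.polar q w v‖ < 1 := by
  have hpol : ∀ v ∈ Submodule.span ℤ_[p] (Set.range x), ∀ w ∈ Submodule.span ℤ_[p] (Set.range x),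
      ‖QuadraticMap.polar q v w‖ ≤ 1 := by
    intro v hv w hw
    exact (padic_norm_sub_le_max _ _).trans (max_le ((padic_norm_sub_le_max _ _).trans
      (max_le (hN _ (add_mem hv hw)) (hN v hv))) (hN w hw))
  have key := fun {v w : X} hv hw => norm_polar_sub_lt_one hM h0 h1 (v := v) (w := w) hv hw
  have hb : ∀ v ∈ Submodule.span ℤ_[p] (Set.range x), ∀ w ∈ Submodule.span ℤ_[p] (Set.range x),
      ‖2 * q (x 2) * (x.repr v 2 * x.repr w 2)‖ ≤ 1 := by
    intro v hv w hw
    exact norm_mul_le_one (norm_mul_le_one norm_two_le_one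
      (hN _ (Submodule.subset_span (Set.mem_range_self 2))))
      (norm_mul_le_one (mem_span_basis_padic.1 hv 2) (mem_span_basis_padic.1 hw 2))
  have e : QuadraticMap.polar q v v * QuadraticMap.polar q w w -
      QuadraticMap.polar q v w * QuadraticMap.polar q w v =
      (QuadraticMap.polar q v v *
        (QuadraticMap.polar q w w - 2 * q (x 2) * (x.repr w 2 * x.repr w 2)) +
      2 * q (x 2) * (x.repr w 2 * x.repr w 2) *
        (QuadraticMap.polar q v v - 2 * q (x 2) * (x.repr v 2 * x.repr v 2))) -
      (QuadraticMap.polar q v w *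
        (QuadraticMap.polar q w v - 2 * q (x 2) * (x.repr w 2 * x.repr v 2)) +
      2 * q (x 2) * (x.repr w 2 * x.repr v 2) *
        (QuadraticMap.polar q v w - 2 * q (x 2) * (x.repr v 2 * x.repr w 2))) := by
    ring
  rw [e]
  exact norm_sub_lt_one
    (norm_add_lt_one (norm_mul_lt_one (hpol v hv v hv) (key hw hw))
      (norm_mul_lt_one (hb w hw w hw) (key hv hv)))
    (norm_add_lt_one (norm_mul_lt_one (hpol v hv w hw) (key hw hv))
      (norm_mul_lt_one (hb w hw v hv) (key hv hw)))

end Degenerate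

end Hyperbolic

/-! ### Local stabilisers -/

section LocalStabilizer

variable {V : Type*} [AddCommGroup V] [Module ℚ V] {Q : QuadraticForm ℚ V} {p : ℕ}
  [hp : Fact p.Prime]

theorem localAct_span (σ : localGroup p Q) (e : Module.Basis (Fin 3) ℚ_[p] (ℚ_[p] ⊗[ℚ] V)) :
    localAct σ (Submodule.span ℤ_[p] (Set.range e)) = Submodule.span ℤ_[p]
      (Set.range (e.map (σ : (ℚ_[p] ⊗[ℚ] V) ≃ₗ[ℚ_[p]] (ℚ_[p] ⊗[ℚ] V)))) := by
  rw [localAct, localImage, Submodule.map_span, ← Set.range_comp]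
  congr 2

theorem localAct_le_localAct_iff {σ τ : localGroup p Q}
    {K K' : Submodule ℤ_[p] (ℚ_[p] ⊗[ℚ] V)} :
    localAct σ K ≤ localAct τ K' ↔ localAct (τ⁻¹ * σ) K ≤ K' := by
  have hmono : ∀ (ρ : localGroup p Q) {K K' : Submodule ℤ_[p] (ℚ_[p] ⊗[ℚ] V)}, K ≤ K' →
      localAct ρ K ≤ localAct ρ K' := fun ρ K K' h => Submodule.map_mono h
  constructor
  · intro h
    have := hmono τ⁻¹ h
    rwa [← localAct_mul, ← localAct_mul, inv_mul_cancel, localAct_one] at this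
  · intro h
    have := hmono τ h
    rwa [← localAct_mul, mul_inv_cancel_left] at this

/-- An isometry that maps a lattice into itself maps it onto itself, since it preserves volumes. -/
theorem mem_stabilizer_of_le {d : Module.Basis (Fin 3) ℚ_[p] (ℚ_[p] ⊗[ℚ] V)}
    (hd : IsDiagonal (localForm p Q) d) {e : Module.Basis (Fin 3) ℚ_[p] (ℚ_[p] ⊗[ℚ] V)}
    {σ : localGroup p Q} (h : localAct σ (Submodule.span ℤ_[p] (Set.range e)) ≤
      Submodule.span ℤ_[p] (Set.range e)) :
    σ ∈ stabilizer Q (Submodule.span ℤ_[p] (Set.range e)) := by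
  rw [mem_stabilizer, localAct_span]
  rw [localAct_span] at h
  refine span_eq_of_le_of_norm_det h ?_
  have h1 := det_polarGram_eq (localForm p Q) e
    (e.map (σ : (ℚ_[p] ⊗[ℚ] V) ≃ₗ[ℚ_[p]] (ℚ_[p] ⊗[ℚ] V)))
  have h2 : polarGram (localForm p Q) (e.map (σ : (ℚ_[p] ⊗[ℚ] V) ≃ₗ[ℚ_[p]] (ℚ_[p] ⊗[ℚ] V))) =
      polarGram (localForm p Q) e := polarGram_map σ.2 e
  have h3 : (polarGram (localForm p Q) e).det ≠ 0 := by
    intro h0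
    have := det_polarGram_eq (localForm p Q) e d
    rw [h0, mul_zero, det_polarGram_of_isDiagonal hd] at this
    exact mul_ne_zero (by norm_num) (mul_ne_zero (mul_ne_zero (hd.2 0) (hd.2 1)) (hd.2 2)) this
  rw [h2] at h1
  have h4 := (mul_eq_right₀ h3).1 h1.symm
  have h5 := congrArg norm h4
  rw [norm_pow, norm_one] at h5
  exact (pow_eq_one_iff_of_nonneg (norm_nonneg _) two_ne_zero).1 h5

theorem mem_stabilizer_of_forall_mem {d : Module.Basis (Fin 3) ℚ_[p] (ℚ_[p] ⊗[ℚ] V)}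
    (hd : IsDiagonal (localForm p Q) d) {e : Module.Basis (Fin 3) ℚ_[p] (ℚ_[p] ⊗[ℚ] V)}
    {σ : localGroup p Q} (h : ∀ i, (σ : (ℚ_[p] ⊗[ℚ] V) ≃ₗ[ℚ_[p]] (ℚ_[p] ⊗[ℚ] V)) (e i) ∈
      Submodule.span ℤ_[p] (Set.range e)) :
    σ ∈ stabilizer Q (Submodule.span ℤ_[p] (Set.range e)) := by
  refine mem_stabilizer_of_le hd ?_
  rw [localAct_span, Submodule.span_le]
  rintro _ ⟨i, rfl⟩
  exact h i

theorem exists_mem_eq_reflection_prod (S : Subgroup (localGroup p Q)) {l : List (ℚ_[p] ⊗[ℚ] V)}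
    (hl : ∀ v ∈ l, ∃ hv : localForm p Q v ≠ 0, reflectionEquiv (localForm p Q) v hv ∈ S) :
    ∃ ε ∈ S, ((ε : (ℚ_[p] ⊗[ℚ] V) ≃ₗ[ℚ_[p]] (ℚ_[p] ⊗[ℚ] V)) :
      Module.End ℚ_[p] (ℚ_[p] ⊗[ℚ] V)) = (l.map (reflection (localForm p Q))).prod := by
  induction l with
  | nil => exact ⟨1, one_mem _, rfl⟩
  | cons a l ih =>
    obtain ⟨ε, hε, hε'⟩ := ih fun v hv => hl v (List.mem_cons_of_mem _ hv)
    obtain ⟨ha, ha'⟩ := hl a List.mem_cons_self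
    refine ⟨_, mul_mem ha' hε, ?_⟩
    rw [List.map_cons, List.prod_cons, ← hε']
    rfl

variable {h : Module.Basis (Fin 3) ℚ_[p] (ℚ_[p] ⊗[ℚ] V)} {r : ℚ_[p]}

theorem reflection_hyperbolic_mem_stabilizer
    {d : Module.Basis (Fin 3) ℚ_[p] (ℚ_[p] ⊗[ℚ] V)} (hd : IsDiagonal (localForm p Q) d)
    (hh : IsHyperbolicBasis (localForm p Q) h r) (hr : r ≠ 0) {u : ℚ_[p]} (hu : ‖u‖ = 1) :
    ∃ hv : localForm p Q (h 0 + u • h 1) ≠ 0, reflectionEquiv (localForm p Q) _ hv ∈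
      stabilizer Q (Submodule.span ℤ_[p] (Set.range h)) := by
  have hu0 : u ≠ 0 := fun h0 => by rw [h0, norm_zero] at hu; exact zero_ne_one hu
  obtain ⟨h1, h2, h3, h4⟩ := hh.reflection_apply hr hu0
  have hm : ∀ i, h i ∈ Submodule.span ℤ_[p] (Set.range h) :=
    fun i => Submodule.subset_span (Set.mem_range_self i)
  refine ⟨by rw [h1]; exact mul_ne_zero hr hu0, mem_stabilizer_of_forall_mem hd fun i => ?_⟩
  rw [reflectionEquiv_apply]
  fin_cases i
  · exact (congrArg (· ∈ Submodule.span ℤ_[p] (Set.range h)) h2).mpr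
      (neg_mem (smul_mem_of_norm_le_one _ hu.le (hm 1)))
  · exact (congrArg (· ∈ Submodule.span ℤ_[p] (Set.range h)) h3).mpr
      (neg_mem (smul_mem_of_norm_le_one _ (by rw [norm_inv, hu, inv_one]) (hm 0)))
  · exact (congrArg (· ∈ Submodule.span ℤ_[p] (Set.range h)) h4).mpr (hm 2)

theorem reflection_orthogonal_mem_stabilizer
    {d : Module.Basis (Fin 3) ℚ_[p] (ℚ_[p] ⊗[ℚ] V)} (hd : IsDiagonal (localForm p Q) d)
    (hh : IsHyperbolicBasis (localForm p Q) h r) (hc : localForm p Q (h 2) ≠ 0) :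
    reflectionEquiv (localForm p Q) (h 2) hc ∈
      stabilizer Q (Submodule.span ℤ_[p] (Set.range h)) := by
  have hm : ∀ i, h i ∈ Submodule.span ℤ_[p] (Set.range h) :=
    fun i => Submodule.subset_span (Set.mem_range_self i)
  refine mem_stabilizer_of_forall_mem hd fun i => ?_
  rw [reflectionEquiv_apply]
  fin_cases i
  · exact (congrArg (· ∈ Submodule.span ℤ_[p] (Set.range h)) (reflection_of_polar_eq_zero _
      (by rw [QuadraticMap.polar_comm, ← hh.polar_zero_two]; rfl))).mpr (hm 0)
  · exact (congrArg (· ∈ Submodule.span ℤ_[p] (Set.range h)) (reflection_of_polar_eq_zero _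
      (by rw [QuadraticMap.polar_comm, ← hh.polar_one_two]; rfl))).mpr (hm 1)
  · exact (congrArg (· ∈ Submodule.span ℤ_[p] (Set.range h)) (reflection_self _ hc)).mpr
      (neg_mem (hm 2))

/-- If the valuations of `r` and `Q (h 2)` have different parities, then the spinor norms of the
stabiliser of the lattice cover all of `ℚ_p^×`: up to squares and units, `r` and `Q (h 2)` are the
lengths of its reflections. -/
theorem spinorStabilizer_eq_top {d : Module.Basis (Fin 3) ℚ_[p] (ℚ_[p] ⊗[ℚ] V)}
    (hd : IsDiagonal (localForm p Q) d) (hh : IsHyperbolicBasis (localForm p Q) h r) (hr : r ≠ 0)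
    (hc : localForm p Q (h 2) ≠ 0) (hodd : Odd (r * localForm p Q (h 2)).valuation) :
    spinorStabilizer Q (Submodule.span ℤ_[p] (Set.range h)) = ⊤ := by
  set S := stabilizer Q (Submodule.span ℤ_[p] (Set.range h)) with hS
  set c := localForm p Q (h 2) with hcdef
  have hW := fun {u : ℚ_[p]} (hu : ‖u‖ = 1) => reflection_hyperbolic_mem_stabilizer hd hh hr hu
  have hZ : ∃ hv : localForm p Q (h 2) ≠ 0, reflectionEquiv (localForm p Q) _ hv ∈ S :=
    ⟨hc, reflection_orthogonal_mem_stabilizer hd hh hc⟩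
  have hqW : ∀ {u : ℚ_[p]}, ‖u‖ = 1 → localForm p Q (h 0 + u • h 1) = r * u := by
    intro u hu
    refine (hh.reflection_apply hr fun h0 => ?_).1
    rw [h0, norm_zero] at hu
    exact zero_ne_one hu
  rw [Padic.valuation_mul hr hc] at hodd
  have h1 : ‖(1 : ℚ_[p])‖ = 1 := norm_one
  have key : ∀ (g : ℚ_[p]) (k : ℕ), g ≠ 0 → ∃ m : List (ℚ_[p] ⊗[ℚ] V),
      (∀ v ∈ m, ∃ hv : localForm p Q v ≠ 0, reflectionEquiv (localForm p Q) v hv ∈ S) ∧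
      Even (k + m.length) ∧ IsSquare (g * (m.map (localForm p Q)).prod) := by
    intro g k hg
    rcases Nat.even_or_odd k with hk | hk
    · rcases Int.even_or_odd g.valuation with hv | hv
      · obtain ⟨u, hu, s, hs⟩ := exists_unit_mul_isSquare hg hv
        refine ⟨[h 0 + u • h 1, h 0 + (1 : ℚ_[p]) • h 1], ?_, by simpa using hk.add even_two, r * s,
          ?_⟩
        · intro v hv
          simp only [List.mem_cons, List.not_mem_nil, or_false] at hv
          rcases hv with rfl | rfl
          exacts [hW hu, hW h1]
        · simp only [List.map_cons, List.map_nil, List.prod_cons, List.prod_nil, mul_one, hqW hu,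
            hqW h1]
          linear_combination r * r * hs
      · obtain ⟨u, hu, s, hs⟩ := exists_unit_mul_isSquare (mul_ne_zero hg (mul_ne_zero hr hc)) (by
          rw [Padic.valuation_mul hg (mul_ne_zero hr hc), Padic.valuation_mul hr hc]
          exact hv.add_odd hodd)
        refine ⟨[h 0 + u • h 1, h 2], ?_, by simpa using hk.add even_two, s, ?_⟩
        · intro v hv
          simp only [List.mem_cons, List.not_mem_nil, or_false] at hv
          rcases hv with rfl | rfl
          exacts [hW hu, hZ]
        · simp only [List.map_cons, List.map_nil, List.prod_cons, List.prod_nil, mul_one, hqW hu]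
          linear_combination hs
    · rcases Int.even_or_odd (g.valuation + r.valuation) with hv | hv
      · obtain ⟨u, hu, s, hs⟩ := exists_unit_mul_isSquare (mul_ne_zero hg hr) (by
          rwa [Padic.valuation_mul hg hr])
        refine ⟨[h 0 + u • h 1], ?_, by simpa using hk.add_odd odd_one, s, ?_⟩
        · intro v hv
          simp only [List.mem_cons, List.not_mem_nil, or_false] at hv
          rcases hv with rfl
          exact hW hu
        · simp only [List.map_cons, List.map_nil, List.prod_cons, List.prod_nil, mul_one, hqW hu]
          linear_combination hs
      · obtain ⟨u, hu, s, hs⟩ := exists_unit_mul_isSquare (mul_ne_zero hg hc) (by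
          rw [Padic.valuation_mul hg hc]
          have h2 := hv.add_odd hodd
          have h3 : g.valuation + r.valuation + (r.valuation + c.valuation) =
              (g.valuation + c.valuation) + 2 * r.valuation := by ring
          rw [h3, Int.even_add] at h2
          exact h2.2 (even_two_mul _))
        refine ⟨[h 2, h 0 + u • h 1, h 0 + (1 : ℚ_[p]) • h 1], ?_,
          by simpa using hk.add_odd (by decide : Odd 3), r * s, ?_⟩
        · intro v hv
          simp only [List.mem_cons, List.not_mem_nil, or_false] at hv
          rcases hv with rfl | rfl | rfl
          exacts [hZ, hW hu, hW h1]
        · simp only [List.map_cons, List.map_nil, List.prod_cons, List.prod_nil, mul_one, hqW hu,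
            hqW h1]
          linear_combination r * r * hs
  rw [eq_top_iff]
  intro σ _
  obtain ⟨l, hl, hσ⟩ := exists_eq_reflection_prod two_ne_zero hd σ
  obtain ⟨m, hm, hlen, hsq⟩ := key (l.map (localForm p Q)).prod l.length (by
    refine List.prod_ne_zero fun h0 => ?_
    obtain ⟨v, hv, hv0⟩ := List.mem_map.1 h0
    exact hl v hv hv0)
  obtain ⟨ε, hε, hε'⟩ := exists_mem_eq_reflection_prod S hm
  have hmem : σ * ε ∈ spinorSubgroup (localForm p Q) := by
    refine ⟨l ++ m, by rwa [List.length_append], ?_, ?_, ?_⟩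
    · intro v hv
      rcases List.mem_append.1 hv with hv | hv
      exacts [hl v hv, (hm v hv).1]
    · rwa [List.map_append, List.prod_append]
    · rw [List.map_append, List.prod_append, ← hσ, ← hε']
      rfl
  have hdec : σ = σ * ε * ε⁻¹ := by rw [mul_inv_cancel_right]
  rw [hdec]
  exact mul_mem (Subgroup.mem_sup_right hmem) (inv_mem (Subgroup.mem_sup_left hε))

end LocalStabilizer

/-! ### Scaling one vector of a basis -/

section Scaled

variable {V : Type*} [AddCommGroup V] [Module ℚ V]

/-- The sublattice spanned by `b 0`, `b 1` and `m (b 2)`. -/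
def scaledLattice (b : Fin 3 → V) (m : ℕ) : Submodule ℤ V :=
  Submodule.span ℤ {b 0, b 1, m • b 2}

/-- The basis `b 0`, `b 1`, `m (b 2)`. -/
def scaledBasis (b : Module.Basis (Fin 3) ℚ V) {m : ℕ} (hm : m ≠ 0) : Module.Basis (Fin 3) ℚ V :=
  b.unitsSMul ![1, 1, Units.mk0 (m : ℚ) (Nat.cast_ne_zero.2 hm)]

theorem scaledLattice_eq_span (b : Module.Basis (Fin 3) ℚ V) {m : ℕ} (hm : m ≠ 0) :
    scaledLattice b m = Submodule.span ℤ (Set.range (scaledBasis b hm)) := by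
  have h : ⇑(scaledBasis b hm) = ![b 0, b 1, m • b 2] := by
    funext i
    rw [scaledBasis, Module.Basis.unitsSMul_apply]
    fin_cases i
    · simp
    · simp
    · simp [Units.smul_def, Nat.cast_smul_eq_nsmul]
  rw [scaledLattice, h]
  congr 1
  ext v
  simp only [Matrix.range_cons, Matrix.range_empty, Set.mem_insert_iff, Set.mem_singleton_iff,
    Set.mem_union, Set.mem_empty_iff_false, or_false]

theorem isLattice_scaledLattice (b : Module.Basis (Fin 3) ℚ V) {m : ℕ} (hm : m ≠ 0) :
    Submodule.IsLattice ℚ (scaledLattice b m) := by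
  rw [scaledLattice_eq_span b hm]
  exact isLattice_span_basis _

theorem mem_localization_scaledLattice_iff {p : ℕ} [Fact p.Prime]
    (b : Module.Basis (Fin 3) ℚ V) {m : ℕ} (hm : m ≠ 0) {v : ℚ_[p] ⊗[ℚ] V} :
    v ∈ localization p (scaledLattice b m) ↔ (‖(localBasis p b).repr v 0‖ ≤ 1 ∧
      ‖(localBasis p b).repr v 1‖ ≤ 1) ∧ ‖(localBasis p b).repr v 2‖ ≤ ‖(m : ℚ_[p])‖ := by
  have hm' : (m : ℚ_[p]) ≠ 0 := Nat.cast_ne_zero.2 hm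
  let w : Fin 3 → ℚ_[p]ˣ := ![1, 1, Units.mk0 (m : ℚ_[p]) hm']
  have h : localBasis p (scaledBasis b hm) = (localBasis p b).unitsSMul w := by
    refine Module.Basis.eq_of_apply_eq fun i => ?_
    rw [Module.Basis.unitsSMul_apply, Module.Basis.baseChange_apply, Module.Basis.baseChange_apply,
      scaledBasis, Module.Basis.unitsSMul_apply]
    fin_cases i
    · simp [w]
    · simp [w]
    · simp only [w, Units.smul_def, Fin.reduceFinMk, Matrix.cons_val, Units.val_mk0]
      rw [Nat.cast_smul_eq_nsmul, Nat.cast_smul_eq_nsmul, TensorProduct.tmul_smul]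
  rw [scaledLattice_eq_span b hm, mem_localization_iff, h, Fin.forall_fin_succ,
    Fin.forall_fin_two, and_assoc]
  simp only [Module.Basis.repr_unitsSMul, w, Units.smul_def, smul_eq_mul]
  refine and_congr (by simp) (and_congr (by simp) ?_)
  change ‖((Units.mk0 (m : ℚ_[p]) hm')⁻¹ : ℚ_[p]ˣ).val * (localBasis p b).repr v 2‖ ≤ 1 ↔ _
  rw [Units.val_inv_eq_inv_val, Units.val_mk0, norm_mul, norm_inv,
    inv_mul_le_one₀ (norm_pos_iff.2 hm')]

theorem localization_scaledLattice_of_not_dvd {p : ℕ} [hp : Fact p.Prime]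
    (b : Module.Basis (Fin 3) ℚ V) {m : ℕ} (hm : m ≠ 0) (hpm : ¬ p ∣ m) :
    localization p (scaledLattice b m) = localization p (Submodule.span ℤ (Set.range b)) := by
  ext v
  have h1 : ‖(m : ℚ_[p])‖ = 1 :=
    Padic.norm_natCast_eq_one_iff.2 ((Nat.Prime.coprime_iff_not_dvd hp.out).2 hpm)
  rw [mem_localization_scaledLattice_iff b hm, mem_localization_iff, Fin.forall_fin_succ,
    Fin.forall_fin_two, h1, and_assoc]
  rfl

theorem norm_natCast_eq_inv_of_squarefree {p : ℕ} [hp : Fact p.Prime] {m : ℕ} (hm : Squarefree m)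
    (hpm : p ∣ m) : ‖(m : ℚ_[p])‖ = (p : ℝ)⁻¹ := by
  obtain ⟨c, rfl⟩ := hpm
  have hc : ¬ p ∣ c := by
    rintro ⟨e, rfl⟩
    exact hp.out.not_isUnit (hm p ⟨e, by ring⟩)
  rw [Nat.cast_mul, norm_mul, Padic.norm_p,
    Padic.norm_natCast_eq_one_iff.2 ((Nat.Prime.coprime_iff_not_dvd hp.out).2 hc), mul_one]

theorem mem_localization_scaledLattice_iff_of_dvd {p : ℕ} [hp : Fact p.Prime]
    (b : Module.Basis (Fin 3) ℚ V) {m : ℕ} (hm : Squarefree m) (hpm : p ∣ m)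
    {v : ℚ_[p] ⊗[ℚ] V} :
    v ∈ localization p (scaledLattice b m) ↔
      v ∈ localization p (Submodule.span ℤ (Set.range b)) ∧ ‖(localBasis p b).repr v 2‖ < 1 := by
  rw [mem_localization_scaledLattice_iff b hm.ne_zero, mem_localization_iff,
    norm_natCast_eq_inv_of_squarefree hm hpm, norm_le_inv_iff_lt_one, Fin.forall_fin_succ,
    Fin.forall_fin_two]
  constructor
  · rintro ⟨⟨h0, h1⟩, h2⟩
    exact ⟨⟨h0, h1, h2.le⟩, h2⟩
  · rintro ⟨⟨h0, h1, -⟩, h2⟩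
    exact ⟨⟨h0, h1⟩, h2⟩

theorem localization_scaledLattice_congr {p : ℕ} [hp : Fact p.Prime]
    (b : Module.Basis (Fin 3) ℚ V) {m n : ℕ} (hm : Squarefree m) (hn : Squarefree n)
    (hpm : p ∣ m) (hpn : p ∣ n) :
    localization p (scaledLattice b m) = localization p (scaledLattice b n) := by
  ext v
  rw [mem_localization_scaledLattice_iff_of_dvd b hm hpm,
    mem_localization_scaledLattice_iff_of_dvd b hn hpn]

theorem scaledLattice_le (b : Module.Basis (Fin 3) ℚ V) (m : ℕ) :
    scaledLattice b m ≤ Submodule.span ℤ (Set.range b) := by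
  have hb : ∀ i, b i ∈ Submodule.span ℤ (Set.range b) :=
    fun i => Submodule.subset_span (Set.mem_range_self i)
  refine Submodule.span_le.2 ?_
  rintro v (rfl | rfl | rfl)
  exacts [hb 0, hb 1, nsmul_mem (hb 2) m]

end Scaled

/-! ### The primes dividing the scaling factor -/

section LocalPair

variable {V : Type*} [AddCommGroup V] [Module ℚ V] {Q : QuadraticForm ℚ V} {p : ℕ}
  [hp : Fact p.Prime] {b : Module.Basis (Fin 3) ℚ V} {n : ℕ}

theorem norm_localForm_le_one (hN : ∀ v ∈ Submodule.span ℤ (Set.range b), ∃ k : ℤ, Q v = k) :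
    ∀ v ∈ Submodule.span ℤ_[p] (Set.range (localBasis p b)), ‖localForm p Q v‖ ≤ 1 := by
  intro v hv
  rw [← localization_span_basis] at hv
  refine norm_localForm_le_of_forall_norm_le (fun x hx => ?_) hv
  obtain ⟨k, hk⟩ := hN x hx
  rw [hk, Rat.cast_intCast]
  exact Padic.norm_int_le_one k

theorem norm_localForm_lt_one (hn : Squarefree n) (hpn : p ∣ n)
    (hM : ∀ v ∈ scaledLattice b n, ∃ k : ℤ, Q v = n * k) :
    ∀ v ∈ Submodule.span ℤ_[p] (Set.range (localBasis p b)),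
      ‖(localBasis p b).repr v 2‖ < 1 → ‖localForm p Q v‖ < 1 := by
  intro v hv h2
  rw [← localization_span_basis] at hv
  rw [← norm_le_inv_iff_lt_one]
  refine norm_localForm_le_of_forall_norm_le (fun x hx => ?_)
    ((mem_localization_scaledLattice_iff_of_dvd b hn hpn).2 ⟨hv, h2⟩)
  obtain ⟨k, hk⟩ := hM x hx
  rw [hk]
  push_cast
  rw [norm_mul, norm_natCast_eq_inv_of_squarefree hn hpn]
  exact mul_le_of_le_one_right (by positivity) (Padic.norm_int_le_one k)

theorem exists_norm_localForm_eq_one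
    (hN : ∀ v ∈ Submodule.span ℤ (Set.range b), ∃ k : ℤ, Q v = k)
    (hprim : PrimitiveAt p Q (Submodule.span ℤ (Set.range b))) :
    ∃ v ∈ Submodule.span ℤ_[p] (Set.range (localBasis p b)), ‖localForm p Q v‖ = 1 := by
  obtain ⟨x, hx, h⟩ := hprim
  refine ⟨(1 : ℚ_[p]) ⊗ₜ[ℚ] x, by rw [← localization_span_basis]; exact tmul_mem_localization hx,
    ?_⟩
  obtain ⟨k, hk⟩ := hN x hx
  rw [localForm_tmul, hk, Rat.cast_intCast]
  refine le_antisymm (Padic.norm_int_le_one k) (not_lt.1 fun hlt => ?_)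
  obtain ⟨c, hc⟩ := Padic.norm_intCast_lt_one_iff.1 hlt
  refine h c ?_
  rw [hk, hc]
  push_cast
  rfl

/-- At a prime dividing `n` there is a hyperbolic splitting as soon as one of the two polar values
with the last basis vector is a unit. -/
theorem exists_isHyperbolicBasis_localForm (hn : Squarefree n) (hpn : p ∣ n)
    (hN : ∀ v ∈ Submodule.span ℤ (Set.range b), ∃ k : ℤ, Q v = k)
    (hM : ∀ v ∈ scaledLattice b n, ∃ k : ℤ, Q v = n * k)
    (h1 : ‖QuadraticMap.polar (localForm p Q) (localBasis p b 0) (localBasis p b 2)‖ = 1 ∨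
      ‖QuadraticMap.polar (localForm p Q) (localBasis p b 1) (localBasis p b 2)‖ = 1) :
    ∃ h : Module.Basis (Fin 3) ℚ_[p] (ℚ_[p] ⊗[ℚ] V), IsHyperbolicBasis (localForm p Q) h 1 ∧
      Submodule.span ℤ_[p] (Set.range h) = localization p (Submodule.span ℤ (Set.range b)) ∧
      ‖localForm p Q (h 2)‖ < 1 ∧ ∀ v, v ∈ localization p (scaledLattice b n) ↔
        v ∈ Submodule.span ℤ_[p] (Set.range h) ∧ ‖h.repr v 1‖ < 1 := by
  obtain ⟨h, hh, hspan, h2, hiff⟩ := exists_isHyperbolicBasis (norm_localForm_le_one hN)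
    (norm_localForm_lt_one hn hpn hM) h1
  refine ⟨h, hh, by rw [hspan, localization_span_basis], h2, fun v => ?_⟩
  rw [mem_localization_scaledLattice_iff_of_dvd b hn hpn, localization_span_basis, hspan]
  exact and_congr_right fun hv => hiff v hv

/-- The case of a hyperbolic splitting is the one in which the `½ℤ_p`-modular component has rank
two. Modulo `p`, integrality of the form on `N_p` and its divisibility by `p` on `M_p` make the polar
values of the first two basis vectors vanish. -/
theorem halfModularRankTwo_iff (hn : Squarefree n) (hpn : p ∣ n)
    (hN : ∀ v ∈ Submodule.span ℤ (Set.range b), ∃ k : ℤ, Q v = k)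
    (hM : ∀ v ∈ scaledLattice b n, ∃ k : ℤ, Q v = n * k) :
    HalfModularRankTwo p Q (Submodule.span ℤ (Set.range b)) ↔
      ‖QuadraticMap.polar (localForm p Q) (localBasis p b 0) (localBasis p b 2)‖ = 1 ∨
      ‖QuadraticMap.polar (localForm p Q) (localBasis p b 1) (localBasis p b 2)‖ = 1 := by
  constructor
  · rintro ⟨z, G, -, hG, hdet, -⟩
    by_contra hcon
    rw [not_or] at hcon
    have hle : ∀ i, ‖QuadraticMap.polar (localForm p Q) (localBasis p b i) (localBasis p b 2)‖ ≤ 1 := by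
      intro i
      refine norm_polar_le_of_forall_norm_le (L := Submodule.span ℤ (Set.range b))
        (fun x hx => ?_) ?_ ?_
      · obtain ⟨k, hk⟩ := hN x hx
        rw [hk, Rat.cast_intCast]
        exact Padic.norm_int_le_one k
      all_goals
        rw [localization_span_basis]
        exact Submodule.subset_span (Set.mem_range_self _)
    have hmem : ∀ i, (z i : ℚ_[p] ⊗[ℚ] V) ∈ Submodule.span ℤ_[p] (Set.range (localBasis p b)) := by
      intro i
      rw [← localization_span_basis]
      exact (z i).2
    have hlt := norm_det_lt_one (norm_localForm_le_one hN) (norm_localForm_lt_one hn hpn hM)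
      (lt_of_le_of_ne (hle 0) hcon.1) (lt_of_le_of_ne (hle 1) hcon.2) (hmem 0) (hmem 1)
    have e00 := hG 0 0
    have e01 := hG 0 1
    have e10 := hG 1 0
    have e11 := hG 1 1
    simp only [Fin.castSucc_zero, Fin.castSucc_one] at e00 e01 e10 e11
    rw [e00, e01, e10, e11] at hlt
    rw [PadicInt.isUnit_iff, Matrix.det_fin_two, PadicInt.norm_def] at hdet
    push_cast at hdet
    exact hlt.ne hdet
  · intro h1
    obtain ⟨h, hh, hspan, h2, -⟩ := exists_isHyperbolicBasis_localForm hn hpn hN hM h1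
    let z : Module.Basis (Fin 3) ℤ_[p] (localization p (Submodule.span ℤ (Set.range b))) :=
      (h.restrictScalars ℤ_[p]).map (LinearEquiv.ofEq _ _ hspan)
    have hz : ∀ i, (z i : ℚ_[p] ⊗[ℚ] V) = h i := fun i => by
      simp only [z, Module.Basis.map_apply, LinearEquiv.coe_ofEq_apply,
        Module.Basis.restrictScalars_apply]
    refine ⟨z, !![0, 1; 1, 0], ?_, ?_, ?_, ?_⟩
    · intro i
      rw [hz, hz]
      fin_cases i
      exacts [hh.polar_zero_two, hh.polar_one_two]
    · intro i j
      rw [hz, hz]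
      fin_cases i <;> fin_cases j
      · simp [hh.zero]
      · simpa using hh.polar_zero_one
      · simpa [QuadraticMap.polar_comm] using hh.polar_zero_one
      · simp [hh.one]
    · rw [Matrix.det_fin_two_of]
      simp
    · rw [hz, QuadraticMap.polar_self, nsmul_eq_mul]
      exact (norm_mul_lt_one (norm_natCast_le_one 2) h2).ne

theorem valuation_eq_of_norm_eq {x y : ℚ_[p]} (hx : x ≠ 0) (hy : y ≠ 0) (h : ‖x‖ = ‖y‖) :
    x.valuation = y.valuation := by
  rw [Padic.norm_eq_zpow_neg_valuation hx, Padic.norm_eq_zpow_neg_valuation hy] at h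
  have := zpow_right_injective₀ (Nat.cast_pos.2 hp.out.pos) (by
    exact_mod_cast hp.out.one_lt.ne') h
  exact neg_injective this

/-- Every sublattice of `N_p` that is isometric to `M_p` is the image of `M_p` under an isometry of
`N_p`: either `M_p` is the only one, or there are two, exchanged by a reflection. -/
theorem exists_stabilizer_localAct_eq (hn : Squarefree n)
    {d : Module.Basis (Fin 3) ℚ V} (hd : IsDiagonal Q d)
    (hN : ∀ v ∈ Submodule.span ℤ (Set.range b), ∃ k : ℤ, Q v = k)
    (hM : ∀ v ∈ scaledLattice b n, ∃ k : ℤ, Q v = n * k)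
    (hprim : p ∣ n → PrimitiveAt p Q (Submodule.span ℤ (Set.range b))) {ρ : localGroup p Q}
    (hρ : localAct ρ (localization p (scaledLattice b n)) ≤
      localization p (Submodule.span ℤ (Set.range b))) :
    ∃ s ∈ stabilizer Q (localization p (Submodule.span ℤ (Set.range b))),
      localAct ρ (localization p (scaledLattice b n)) =
        localAct s (localization p (scaledLattice b n)) := by
  have hdp := hd.localBasis p
  by_cases hpn : p ∣ n
  · -- an isometry mapping `M_p` into `M_p` maps it onto `M_p`
    have hstab : ∀ s : localGroup p Q, localAct ρ (localization p (scaledLattice b n)) ≤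
        localAct s (localization p (scaledLattice b n)) →
        localAct ρ (localization p (scaledLattice b n)) =
        localAct s (localization p (scaledLattice b n)) := by
      intro s hle
      rw [localAct_le_localAct_iff] at hle
      rw [localAct_eq_iff]
      rw [scaledLattice_eq_span b hn.ne_zero, localization_span_basis] at hle ⊢
      exact mem_stabilizer_of_le hdp hle
    have hval : ∀ v ∈ localAct ρ (localization p (scaledLattice b n)),
        v ∈ localization p (Submodule.span ℤ (Set.range b)) ∧ ‖localForm p Q v‖ < 1 := by
      intro v hv
      refine ⟨hρ hv, ?_⟩
      obtain ⟨w, hw, rfl⟩ := mem_localAct.1 hv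
      rw [mem_localization_scaledLattice_iff_of_dvd b hn hpn, localization_span_basis] at hw
      rw [ρ.2]
      exact norm_localForm_lt_one hn hpn hM w hw.1 hw.2
    by_cases hhalf : ‖QuadraticMap.polar (localForm p Q) (localBasis p b 0) (localBasis p b 2)‖ = 1 ∨
      ‖QuadraticMap.polar (localForm p Q) (localBasis p b 1) (localBasis p b 2)‖ = 1
    · obtain ⟨h, hh, hspan, h2, hiff⟩ := exists_isHyperbolicBasis_localForm hn hpn hN hM hhalf
      have hcoord : ∀ v ∈ localAct ρ (localization p (scaledLattice b n)),
          (∀ i, ‖h.repr v i‖ ≤ 1) ∧ (‖h.repr v 0‖ < 1 ∨ ‖h.repr v 1‖ < 1) := by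
        intro v hv
        obtain ⟨hvN, hq⟩ := hval v hv
        rw [← hspan, mem_span_basis_padic] at hvN
        refine ⟨hvN, ?_⟩
        rw [hh.apply, one_mul, norm_lt_one_congr (y := h.repr v 0 * h.repr v 1)] at hq
        · by_contra hcon
          rw [not_or, not_lt, not_lt] at hcon
          rw [norm_mul] at hq
          nlinarith
        · rw [add_sub_cancel_left, mul_comm]
          exact norm_mul_lt_one (norm_mul_le_one (hvN 2) (hvN 2)) h2
      by_cases hall : ∀ v ∈ localAct ρ (localization p (scaledLattice b n)), ‖h.repr v 1‖ < 1
      · refine ⟨1, one_mem _, hstab 1 ?_⟩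
        intro v hv
        rw [localAct_one, hiff, mem_span_basis_padic]
        exact ⟨(hcoord v hv).1, hall v hv⟩
      · push Not at hall
        obtain ⟨v₁, hv₁, h₁⟩ := hall
        have h₁' : ‖h.repr v₁ 0‖ < 1 := ((hcoord v₁ hv₁).2).resolve_right (not_lt.2 h₁)
        -- a module is not the union of two proper submodules
        have hall' : ∀ v ∈ localAct ρ (localization p (scaledLattice b n)), ‖h.repr v 0‖ < 1 := by
          intro v hv
          by_contra hcon
          have h3 : ‖h.repr v 1‖ < 1 := ((hcoord v hv).2).resolve_left hcon
          have h4 := (hcoord _ (add_mem hv hv₁)).2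
          rw [map_add, Finsupp.add_apply, Finsupp.add_apply] at h4
          have h5 : ‖h.repr v 0‖ = 1 := le_antisymm ((hcoord v hv).1 0) (not_lt.1 hcon)
          have h6 : ‖h.repr v₁ 1‖ = 1 := le_antisymm ((hcoord v₁ hv₁).1 1) h₁
          rcases h4 with h4 | h4
          · exact h4.ne (norm_add_eq_one h5 h₁')
          · rw [add_comm] at h4
            exact h4.ne (norm_add_eq_one h6 h3)
        have hu : ‖(-1 : ℚ_[p])‖ = 1 := by rw [norm_neg, norm_one]
        obtain ⟨hne, hs⟩ := reflection_hyperbolic_mem_stabilizer hdp hh one_ne_zero hu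
        obtain ⟨-, r0, r1, r2⟩ := hh.reflection_apply one_ne_zero (u := -1) (by norm_num)
        have r0' : reflection (localForm p Q) (h 0 + (-1 : ℚ_[p]) • h 1) (h 0) = h 1 := by
          rw [r0]; module
        have r1' : reflection (localForm p Q) (h 0 + (-1 : ℚ_[p]) • h 1) (h 1) = h 0 := by
          rw [r1, inv_neg, inv_one]; module
        refine ⟨reflectionEquiv _ _ hne, by rwa [← hspan], hstab _ ?_⟩
        intro v hv
        have hrefl : reflection (localForm p Q) (h 0 + (-1 : ℚ_[p]) • h 1) v =
            h.repr v 1 • h 0 + h.repr v 0 • h 1 + h.repr v 2 • h 2 := by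
          conv_lhs => rw [← h.sum_repr v, Fin.sum_univ_three, map_add, map_add, map_smul, map_smul,
            map_smul, r0', r1', r2]
          abel
        refine mem_localAct.2 ⟨reflection (localForm p Q) (h 0 + (-1 : ℚ_[p]) • h 1) v, ?_,
          reflection_reflection _ hne v⟩
        obtain ⟨hc, -⟩ := hcoord v hv
        rw [hiff, mem_span_basis_padic, Fin.forall_fin_succ, Fin.forall_fin_two, hrefl]
        refine ⟨⟨?_, ?_, ?_⟩, ?_⟩
        · simpa using hc 1
        · simpa using hc 0
        · simpa using hc 2
        · simpa using hall' v hv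
    · -- `M_p` consists of the vectors of `N_p` of length divisible by `p`
      have hle : ∀ i, ‖QuadraticMap.polar (localForm p Q) (localBasis p b i) (localBasis p b 2)‖ ≤ 1 := by
        intro i
        refine norm_polar_le_of_forall_norm_le (L := Submodule.span ℤ (Set.range b))
          (fun x hx => ?_) ?_ ?_
        · obtain ⟨k, hk⟩ := hN x hx
          rw [hk, Rat.cast_intCast]
          exact Padic.norm_int_le_one k
        all_goals
          rw [localization_span_basis]
          exact Submodule.subset_span (Set.mem_range_self _)
      rw [not_or] at hhalf
      refine ⟨1, one_mem _, hstab 1 ?_⟩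
      intro v hv
      obtain ⟨hvN, hq⟩ := hval v hv
      rw [localAct_one, mem_localization_scaledLattice_iff_of_dvd b hn hpn]
      refine ⟨hvN, ?_⟩
      rw [localization_span_basis] at hvN
      exact (repr_two_lt_one_iff (norm_localForm_le_one hN) (norm_localForm_lt_one hn hpn hM)
        (lt_of_le_of_ne (hle 0) hhalf.1) (lt_of_le_of_ne (hle 1) hhalf.2)
        (exists_norm_localForm_eq_one hN (hprim hpn)) hvN).2 hq
  · rw [localization_scaledLattice_of_not_dvd b hn.ne_zero hpn] at hρ ⊢
    refine ⟨ρ, ?_, rfl⟩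
    rw [localization_span_basis] at hρ ⊢
    exact mem_stabilizer_of_le hdp hρ

/-- The comparison of the stabilisers of `N_p` and `M_p` with that of `L_p`, where `L` is obtained by
scaling the last basis vector by a divisor `m` of `n`. The parity condition makes all of `ℚ_p^×`
spinor norms of the stabiliser of `L_p` when there is a hyperbolic splitting. -/
theorem spinorStabilizer_le (hn : Squarefree n) {d : Module.Basis (Fin 3) ℚ V}
    (hd : IsDiagonal Q d)
    (hN : ∀ v ∈ Submodule.span ℤ (Set.range b), ∃ k : ℤ, Q v = k)
    (hM : ∀ v ∈ scaledLattice b n, ∃ k : ℤ, Q v = n * k)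
    (hprim : p ∣ n → PrimitiveAt p Q (Submodule.span ℤ (Set.range b))) {m : ℕ} (hmn : m ∣ n)
    (hm : p ∣ n → (p ∣ m ↔ (HalfModularRankTwo p Q (Submodule.span ℤ (Set.range b)) →
      Even (padicValRat p ((polarGram Q b).det / 2))))) :
    spinorStabilizer Q (localization p (Submodule.span ℤ (Set.range b))) ≤
      spinorStabilizer Q (localization p (scaledLattice b m)) ∧
    spinorStabilizer Q (localization p (scaledLattice b n)) ≤
      spinorStabilizer Q (localization p (scaledLattice b m)) := by
  have hdp := hd.localBasis p
  have hms : Squarefree m := hn.squarefree_of_dvd hmn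
  by_cases hpn : p ∣ n
  · have hm := hm hpn
    rw [halfModularRankTwo_iff hn hpn hN hM] at hm
    by_cases hhalf : ‖QuadraticMap.polar (localForm p Q) (localBasis p b 0) (localBasis p b 2)‖ = 1 ∨
      ‖QuadraticMap.polar (localForm p Q) (localBasis p b 1) (localBasis p b 2)‖ = 1
    · suffices htop : spinorStabilizer Q (localization p (scaledLattice b m)) = ⊤ by
        rw [htop]
        exact ⟨le_top, le_top⟩
      obtain ⟨h, hh, hspan, h2, hiff⟩ := exists_isHyperbolicBasis_localForm hn hpn hN hM hhalf
      have hD0 : (polarGram Q b).det ≠ 0 := det_polarGram_ne_zero hd b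
      have hdet : ‖(((polarGram Q b).det / 2 : ℚ) : ℚ_[p])‖ = ‖localForm p Q (h 2)‖ := by
        have e := norm_det_polarGram_eq (localForm p Q) (e := localBasis p b) (e' := h)
          (by rw [hspan, localization_span_basis])
        rw [hh.det_polarGram, det_polarGram_localBasis, norm_neg, one_pow, mul_one, norm_mul] at e
        rw [Rat.cast_div, Rat.cast_ofNat, norm_div, ← e, mul_div_cancel_left₀]
        exact norm_ne_zero_iff.2 two_ne_zero
      have hD0' : (((polarGram Q b).det / 2 : ℚ) : ℚ_[p]) ≠ 0 :=
        Rat.cast_ne_zero.2 (div_ne_zero hD0 two_ne_zero)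
      have hc : localForm p Q (h 2) ≠ 0 := by
        rw [← norm_ne_zero_iff, ← hdet, norm_ne_zero_iff]
        exact hD0'
      have hv := valuation_eq_of_norm_eq hD0' hc hdet
      rw [Padic.valuation_ratCast] at hv
      rw [hv] at hm
      by_cases heven : Even (localForm p Q (h 2)).valuation
      · -- here `L_p = M_p` is a hyperbolic plane scaled by `p` and an orthogonal line
        have hpm : p ∣ m := hm.2 fun _ => heven
        have hp0 : (p : ℚ_[p]) ≠ 0 := Nat.cast_ne_zero.2 hp.out.ne_zero
        let w : Fin 3 → ℚ_[p]ˣ := ![1, Units.mk0 (p : ℚ_[p]) hp0, 1]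
        let h' := h.unitsSMul w
        have h0' : h' 0 = h 0 := by simp [h', w, Module.Basis.unitsSMul_apply]
        have h1' : h' 1 = (p : ℚ_[p]) • h 1 := by
          simp [h', w, Module.Basis.unitsSMul_apply, Units.smul_def]
        have h2' : h' 2 = h 2 := by simp [h', w, Module.Basis.unitsSMul_apply]
        have hh' : IsHyperbolicBasis (localForm p Q) h' p := by
          refine ⟨by rw [h0', hh.zero], ?_, ?_, by rw [h0', h2', hh.polar_zero_two], ?_⟩
          · rw [h1', QuadraticMap.map_smul, hh.one, smul_zero]
          · rw [h0', h1', QuadraticMap.polar_smul_right, hh.polar_zero_one, smul_eq_mul, mul_one]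
          · rw [h1', h2', QuadraticMap.polar_smul_left, hh.polar_one_two, smul_zero]
        have hspan' : localization p (scaledLattice b m) = Submodule.span ℤ_[p] (Set.range h') := by
          rw [localization_scaledLattice_congr b hms hn hpm hpn]
          ext v
          rw [hiff, mem_span_basis_padic, mem_span_basis_padic, Fin.forall_fin_succ,
            Fin.forall_fin_two, Fin.forall_fin_succ, Fin.forall_fin_two]
          simp only [h', Module.Basis.repr_unitsSMul, w, Units.smul_def]
          have e : ‖(p : ℚ_[p])⁻¹ * h.repr v 1‖ ≤ 1 ↔ ‖h.repr v 1‖ < 1 := by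
            rw [norm_mul, norm_inv, inv_mul_le_one₀ (norm_pos_iff.2 hp0), Padic.norm_p,
              norm_le_inv_iff_lt_one]
          constructor
          · rintro ⟨⟨a0, a1, a2⟩, a3⟩
            refine ⟨by simpa using a0, ?_, by simpa using a2⟩
            simpa [Units.val_inv_eq_inv_val] using e.2 a3
          · rintro ⟨a0, a1, a2⟩
            have a3 : ‖h.repr v 1‖ < 1 := e.1 (by simpa [Units.val_inv_eq_inv_val] using a1)
            exact ⟨⟨by simpa using a0, a3.le, by simpa using a2⟩, a3⟩
        rw [hspan']
        refine spinorStabilizer_eq_top hdp hh' hp0 (by rwa [h2']) ?_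
        rw [h2', Padic.valuation_mul hp0 hc, Padic.valuation_p]
        exact odd_one.add_even heven
      · have hpm : ¬ p ∣ m := fun hpm => heven (hm.1 hpm hhalf)
        rw [localization_scaledLattice_of_not_dvd b hms.ne_zero hpm, ← hspan]
        refine spinorStabilizer_eq_top hdp hh one_ne_zero hc ?_
        rw [one_mul]
        exact Int.not_even_iff_odd.1 heven
    · -- here `L_p = M_p` is determined by `N_p`
      have hpm : p ∣ m := hm.2 fun h => absurd h hhalf
      rw [localization_scaledLattice_congr b hms hn hpm hpn]
      refine ⟨sup_le_sup_right (fun σ hσ => ?_) _, le_rfl⟩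
      have hle : ∀ i, ‖QuadraticMap.polar (localForm p Q) (localBasis p b i) (localBasis p b 2)‖ ≤ 1 := by
        intro i
        refine norm_polar_le_of_forall_norm_le (L := Submodule.span ℤ (Set.range b))
          (fun x hx => ?_) ?_ ?_
        · obtain ⟨k, hk⟩ := hN x hx
          rw [hk, Rat.cast_intCast]
          exact Padic.norm_int_le_one k
        all_goals
          rw [localization_span_basis]
          exact Submodule.subset_span (Set.mem_range_self _)
      rw [not_or] at hhalf
      have hmem : ∀ v, v ∈ localization p (scaledLattice b n) ↔
          v ∈ localization p (Submodule.span ℤ (Set.range b)) ∧ ‖localForm p Q v‖ < 1 := by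
        intro v
        rw [mem_localization_scaledLattice_iff_of_dvd b hn hpn]
        refine and_congr_right fun hvN => ?_
        rw [localization_span_basis] at hvN
        exact repr_two_lt_one_iff (norm_localForm_le_one hN) (norm_localForm_lt_one hn hpn hM)
          (lt_of_le_of_ne (hle 0) hhalf.1) (lt_of_le_of_ne (hle 1) hhalf.2)
          (exists_norm_localForm_eq_one hN (hprim hpn)) hvN
      have hsub : localAct σ (localization p (scaledLattice b n)) ≤
          localization p (scaledLattice b n) := by
        intro v hv
        obtain ⟨w, hw, rfl⟩ := mem_localAct.1 hv
        rw [hmem] at hw ⊢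
        refine ⟨?_, by rw [σ.2]; exact hw.2⟩
        rw [mem_stabilizer] at hσ
        rw [← hσ]
        exact mem_localAct.2 ⟨w, hw.1, rfl⟩
      rw [scaledLattice_eq_span b hn.ne_zero, localization_span_basis] at hsub ⊢
      exact mem_stabilizer_of_le hdp hsub
  · have hpm : ¬ p ∣ m := fun h => hpn (h.trans hmn)
    rw [localization_scaledLattice_of_not_dvd b hn.ne_zero hpn,
      localization_scaledLattice_of_not_dvd b hms.ne_zero hpm]
    exact ⟨le_rfl, le_rfl⟩

end LocalPair

/-! ### Comparison of the groups of `N`, `M` and `L_{N,M}` -/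

theorem relIndex_eq_iff_inf_eq {G : Type*} [Group G] {H K L A : Subgroup G} (hHL : H ≤ L)
    (hKL : K ≤ L) (hL : ∀ S : Subgroup G, H ⊓ A ≤ S → K ⊓ A ≤ S → L ⊓ A ≤ S)
    (hHK : H.relIndex A = K.relIndex A) (h0 : H.relIndex A ≠ 0) :
    H.relIndex A = L.relIndex A ↔ H ⊓ A = K ⊓ A := by
  -- subgroups of equal finite index in `A`, one containing the other, coincide on `A`
  have key : ∀ {H L : Subgroup G}, H ≤ L → H.relIndex A = L.relIndex A → H.relIndex A ≠ 0 →
      L ⊓ A ≤ H ⊓ A := by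
    intro H L hHL h h0
    have hm := Subgroup.relIndex_mul_relIndex (H ⊓ A) (L ⊓ A) A (inf_le_inf_right A hHL) inf_le_right
    rw [Subgroup.inf_relIndex_right, Subgroup.inf_relIndex_right, ← h] at hm
    exact Subgroup.relIndex_eq_one.1 ((Nat.mul_eq_right h0).1 hm)
  constructor
  · intro h
    refine le_antisymm ?_ ?_
    · exact (inf_le_inf_right A hHL).trans (key hKL (hHK ▸ h) (hHK ▸ h0))
    · exact (inf_le_inf_right A hKL).trans (key hHL h h0)
  · intro h
    have h1 : L ⊓ A = H ⊓ A :=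
      le_antisymm (hL _ le_rfl h.ge) (inf_le_inf_right A hHL)
    rw [← Subgroup.inf_relIndex_right H, ← Subgroup.inf_relIndex_right L, h1]

section Groups

variable {V : Type*} [AddCommGroup V] [Module ℚ V] {Q : QuadraticForm ℚ V}

theorem isTranslate_one (Q : QuadraticForm ℚ V) (L : Submodule ℤ V) [hL : Submodule.IsLattice ℚ L] :
    IsTranslate Q L 1 L :=
  ⟨hL, fun _ => (localAct_one _).symm⟩

theorem IsTranslate.mapLattice {L L' : Submodule ℤ V} {a : LocalIsometries Q}
    (h : IsTranslate Q L a L') (γ : orthogonalGroup Q) :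
    IsTranslate Q L (principal Q γ * a)
      (TernaryLattice.mapLattice ((γ : V ≃ₗ[ℚ] V) : V →ₗ[ℚ] V) L') := by
  have := h.1
  refine ⟨isLattice_mapLattice _ _, fun p => ?_⟩
  rw [localization_mapLattice, Pi.mul_apply, localAct_mul, ← h.2]
  rfl

theorem principal_mem_adelicSubgroup (h3 : Module.finrank ℚ V = 3) (L : Submodule ℤ V)
    [Submodule.IsLattice ℚ L] (γ : orthogonalGroup Q) : principal Q γ ∈ adelicSubgroup Q L := by
  have h := ((isTranslate_one Q L).mapLattice γ).mem_adelicSubgroup h3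
  rwa [mul_one] at h

theorem spinorGenusSubgroup_mono {L L' : Submodule ℤ V} (h : ∀ p : Nat.Primes,
    spinorStabilizer Q (localization p L) ≤ spinorStabilizer Q (localization p L')) :
    spinorGenusSubgroup Q L ≤ spinorGenusSubgroup Q L' :=
  sup_le_sup_left (fun _ ha => (Subgroup.mem_pi _).2 fun p hp =>
    h p ((Subgroup.mem_pi _).1 ha p hp)) _

theorem numSpinorGenera_ne_zero (h3 : Module.finrank ℚ V = 3) (hQ : Q.PosDef)
    {L : Submodule ℤ V} [Submodule.IsLattice ℚ L] (hint : ∀ x ∈ L, ∃ k : ℤ, Q x = k) :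
    numSpinorGenera Q L ≠ 0 :=
  Set.ncard_ne_zero_of_mem (Set.mem_image_of_mem _ (mem_gen_iff.2 ⟨1, isTranslate_one Q L⟩))
    (finite_spinorGenera h3 hQ hint)

/-- A local isometry in the group of `ℤ b₀ + ℤ b₁ + ℤ (m b₂)` is in that of `M` if `p ∣ m` and in
that of `N` otherwise; the first kind contributes only finitely many primes, so the factorisation
stays inside the group of adelic isometries. -/
theorem spinorGenusSubgroup_scaledLattice_inf_le (h3 : Module.finrank ℚ V = 3)
    {d : Module.Basis (Fin 3) ℚ V} (hd : IsDiagonal Q d) {b : Module.Basis (Fin 3) ℚ V}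
    {m n : ℕ} (hn : Squarefree n) (hmn : m ∣ n)
    (S : Subgroup (LocalIsometries Q))
    (hN : spinorGenusSubgroup Q (Submodule.span ℤ (Set.range b)) ⊓
      adelicSubgroup Q (Submodule.span ℤ (Set.range b)) ≤ S)
    (hM : spinorGenusSubgroup Q (scaledLattice b n) ⊓
      adelicSubgroup Q (Submodule.span ℤ (Set.range b)) ≤ S) :
    spinorGenusSubgroup Q (scaledLattice b m) ⊓
      adelicSubgroup Q (Submodule.span ℤ (Set.range b)) ≤ S := by
  classical
  have hLat := isLattice_span_basis b
  have hnorm := integralSubgroup_normal hd (scaledLattice b m)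
  have hm : Squarefree m := hn.squarefree_of_dvd hmn
  rintro _ ⟨ha, haA⟩
  obtain ⟨_, ⟨γ, rfl⟩, c, hc, rfl⟩ := Subgroup.mem_sup_of_normal_right.1 ha
  rw [SetLike.mem_coe] at haA
  have hc' := fun p => (Subgroup.mem_pi _).1 hc p (Set.mem_univ p)
  have hγA := principal_mem_adelicSubgroup h3 (Submodule.span ℤ (Set.range b)) γ
  have hcA := (Subgroup.mul_mem_cancel_left _ hγA).1 haA
  let c₁ : LocalIsometries Q := fun p => if (p : ℕ) ∣ m then c p else 1
  let c₂ : LocalIsometries Q := fun p => if (p : ℕ) ∣ m then 1 else c p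
  have hc₁₂ : c = c₁ * c₂ := by
    funext p
    rw [Pi.mul_apply]
    by_cases hp : (p : ℕ) ∣ m
    · rw [show c₁ p = c p from if_pos hp, show c₂ p = 1 from if_pos hp, mul_one]
    · rw [show c₁ p = 1 from if_neg hp, show c₂ p = c p from if_neg hp, one_mul]
  have hc₁A : c₁ ∈ adelicSubgroup Q (Submodule.span ℤ (Set.range b)) := by
    refine (finite_setOf_prime_dvd hm.ne_zero).subset fun p hp => ?_
    by_contra hpm
    refine hp ?_
    rw [show c₁ p = 1 from if_neg hpm]
    exact one_mem _
  have hc₂A : c₂ ∈ adelicSubgroup Q (Submodule.span ℤ (Set.range b)) := by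
    rw [hc₁₂] at hcA
    exact (Subgroup.mul_mem_cancel_left _ hc₁A).1 hcA
  have hc₁ : c₁ ∈ integralSubgroup Q (scaledLattice b n) := by
    refine (Subgroup.mem_pi _).2 fun p _ => ?_
    by_cases hp : (p : ℕ) ∣ m
    · rw [show c₁ p = c p from if_pos hp,
        localization_scaledLattice_congr b hn hm (hp.trans hmn) hp]
      exact hc' p
    · rw [show c₁ p = 1 from if_neg hp]
      exact one_mem _
  have hc₂ : c₂ ∈ integralSubgroup Q (Submodule.span ℤ (Set.range b)) := by
    refine (Subgroup.mem_pi _).2 fun p _ => ?_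
    by_cases hp : (p : ℕ) ∣ m
    · rw [show c₂ p = 1 from if_pos hp]
      exact one_mem _
    · rw [show c₂ p = c p from if_neg hp,
        ← localization_scaledLattice_of_not_dvd b hm.ne_zero hp]
      exact hc' p
  rw [hc₁₂]
  exact mul_mem (hN ⟨Subgroup.mem_sup_left ⟨γ, rfl⟩, hγA⟩)
    (mul_mem (hM ⟨Subgroup.mem_sup_right hc₁, hc₁A⟩) (hN ⟨Subgroup.mem_sup_right hc₂, hc₂A⟩))

/-- When `g(N) = g(M)`, the number `g(L_{N,M})` equals `g(N)` exactly when the groups of `N` and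
`M` agree. -/
theorem numSpinorGenera_eq_scaledLattice_iff (h3 : Module.finrank ℚ V = 3) (hQ : Q.PosDef)
    {d : Module.Basis (Fin 3) ℚ V} (hd : IsDiagonal Q d) {b : Module.Basis (Fin 3) ℚ V}
    {m n : ℕ} (hn : Squarefree n)
    (hN : ∀ v ∈ Submodule.span ℤ (Set.range b), ∃ k : ℤ, Q v = k)
    (hM : ∀ v ∈ scaledLattice b n, ∃ k : ℤ, Q v = n * k)
    (hprim : ∀ p : ℕ, p.Prime → p ∣ n → PrimitiveAt p Q (Submodule.span ℤ (Set.range b)))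
    (hmn : m ∣ n)
    (hm : ∀ (p : ℕ) [Fact p.Prime], p ∣ n →
      (p ∣ m ↔ (HalfModularRankTwo p Q (Submodule.span ℤ (Set.range b)) →
        Even (padicValRat p ((polarGram Q b).det / 2)))))
    (hg : numSpinorGenera Q (Submodule.span ℤ (Set.range b)) =
      numSpinorGenera Q (scaledLattice b n)) :
    numSpinorGenera Q (Submodule.span ℤ (Set.range b)) = numSpinorGenera Q (scaledLattice b m) ↔
      spinorGenusSubgroup Q (Submodule.span ℤ (Set.range b)) ⊓
        adelicSubgroup Q (Submodule.span ℤ (Set.range b)) =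
      spinorGenusSubgroup Q (scaledLattice b n) ⊓
        adelicSubgroup Q (Submodule.span ℤ (Set.range b)) := by
  have hLN := isLattice_span_basis b
  have hLM := isLattice_scaledLattice b hn.ne_zero
  have hLL := isLattice_scaledLattice b (hn.squarefree_of_dvd hmn).ne_zero
  have h0 := numSpinorGenera_ne_zero h3 hQ hN
  have hle := fun p : Nat.Primes => spinorStabilizer_le (p := p) hn hd hN hM (hprim p p.2) hmn
    (hm p)
  rw [numSpinorGenera_eq_relIndex h3 hd, numSpinorGenera_eq_relIndex h3 hd,
    adelicSubgroup_eq h3 Q (scaledLattice b n) (Submodule.span ℤ (Set.range b))] at hg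
  rw [numSpinorGenera_eq_relIndex h3 hd] at h0
  rw [numSpinorGenera_eq_relIndex h3 hd, numSpinorGenera_eq_relIndex h3 hd,
    adelicSubgroup_eq h3 Q (scaledLattice b m) (Submodule.span ℤ (Set.range b))]
  exact relIndex_eq_iff_inf_eq (spinorGenusSubgroup_mono fun p => (hle p).1)
    (spinorGenusSubgroup_mono fun p => (hle p).2)
    (spinorGenusSubgroup_scaledLattice_inf_le h3 hd hn hmn) hg h0

/-! ### Pairs of lattices in the two genera -/

/-- A lattice in the genus of `N` containing a lattice in the genus of `M` is the image of `N`
under an adelic isometry that maps `M` to the sublattice. -/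
theorem exists_isTranslate_pair
    {d : Module.Basis (Fin 3) ℚ V} (hd : IsDiagonal Q d) {b : Module.Basis (Fin 3) ℚ V}
    {n : ℕ} (hn : Squarefree n)
    (hN : ∀ v ∈ Submodule.span ℤ (Set.range b), ∃ k : ℤ, Q v = k)
    (hM : ∀ v ∈ scaledLattice b n, ∃ k : ℤ, Q v = n * k)
    (hprim : ∀ p : ℕ, p.Prime → p ∣ n → PrimitiveAt p Q (Submodule.span ℤ (Set.range b)))
    {N₁ M₁ : Submodule ℤ V} {a c : LocalIsometries Q}
    (h₁ : IsTranslate Q (Submodule.span ℤ (Set.range b)) a N₁)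
    (h₂ : IsTranslate Q (scaledLattice b n) c M₁) (hle : M₁ ≤ N₁) :
    ∃ s : LocalIsometries Q, IsTranslate Q (Submodule.span ℤ (Set.range b)) s N₁ ∧
      IsTranslate Q (scaledLattice b n) s M₁ := by
  have key : ∀ p : Nat.Primes, ∃ s ∈ stabilizer Q (localization p (Submodule.span ℤ (Set.range b))),
      localAct ((a p)⁻¹ * c p) (localization p (scaledLattice b n)) =
        localAct s (localization p (scaledLattice b n)) := by
    intro p
    refine exists_stabilizer_localAct_eq hn hd hN hM (hprim p p.2) ?_
    rw [← localAct_le_localAct_iff, ← h₁.2, ← h₂.2]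
    exact localization_mono _ hle
  choose s hs hs' using key
  refine ⟨a * s, ⟨h₁.1, fun p => ?_⟩, h₂.1, fun p => ?_⟩
  · rw [h₁.2, Pi.mul_apply, localAct_mul, mem_stabilizer.1 (hs p)]
  · rw [h₂.2, Pi.mul_apply, localAct_mul, ← hs', ← localAct_mul, mul_inv_cancel_left]

/-- The square of the index of a sublattice is the quotient of the discriminants. -/
theorem relIndex_eq_of_det_polarGram (hQ : Q.PosDef) (h3 : Module.finrank ℚ V = 3)
    {b c : Module.Basis (Fin 3) ℚ V} {n : ℕ}
    (hle : Submodule.span ℤ (Set.range c) ≤ Submodule.span ℤ (Set.range b))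
    (hdet : (polarGram Q c).det = (n : ℚ) ^ 2 * (polarGram Q b).det) :
    (Submodule.span ℤ (Set.range c)).toAddSubgroup.relIndex
      (Submodule.span ℤ (Set.range b)).toAddSubgroup = n := by
  have h := AddSubgroup.relIndex_eq_abs_det (Submodule.span ℤ (Set.range c)).toAddSubgroup
    (Submodule.span ℤ (Set.range b)).toAddSubgroup hle c b
    (Submodule.span_int_eq_addSubgroupClosure _) (Submodule.span_int_eq_addSubgroupClosure _)
  rw [det_polarGram_eq Q b c, mul_left_inj' (det_polarGram_pos h3 hQ b).ne', sq_eq_sq_iff_abs_eq_abs,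
    Nat.abs_cast] at hdet
  rw [Module.Basis.det_apply, hdet] at h
  exact_mod_cast h

theorem det_polarGram_scaledBasis (b : Module.Basis (Fin 3) ℚ V) {n : ℕ} (hn : n ≠ 0) :
    (polarGram Q (scaledBasis b hn)).det = (n : ℚ) ^ 2 * (polarGram Q b).det := by
  rw [det_polarGram_eq Q b (scaledBasis b hn), scaledBasis]
  congr 2
  rw [Module.Basis.toMatrix_unitsSMul, Matrix.det_diagonal]
  simp [Fin.prod_univ_three]

/-- An adelic isometry maps `N` and `M` to lattices in the same relative position. -/
theorem exists_isTranslate_isTranslate (h3 : Module.finrank ℚ V = 3) (hQ : Q.PosDef)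
    {b : Module.Basis (Fin 3) ℚ V} {n : ℕ} (hn : n ≠ 0) {a : LocalIsometries Q}
    (ha : a ∈ adelicSubgroup Q (Submodule.span ℤ (Set.range b))) :
    ∃ N₁ M₁ : Submodule ℤ V, IsTranslate Q (Submodule.span ℤ (Set.range b)) a N₁ ∧
      IsTranslate Q (scaledLattice b n) a M₁ ∧ M₁ ≤ N₁ ∧
      M₁.toAddSubgroup.relIndex N₁.toAddSubgroup = n := by
  have hLN := isLattice_span_basis b
  have hLM := isLattice_scaledLattice b hn
  obtain ⟨N₁, hN₁⟩ := exists_isTranslate h3 ha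
  rw [adelicSubgroup_eq h3 Q _ (scaledLattice b n)] at ha
  obtain ⟨M₁, hM₁⟩ := exists_isTranslate h3 ha
  have hLN₁ := hN₁.1
  have hLM₁ := hM₁.1
  have hle : M₁ ≤ N₁ := le_of_forall_localization_le h3 fun p hp => by
    have e₁ := hN₁.2 ⟨p, hp.out⟩
    have e₂ := hM₁.2 ⟨p, hp.out⟩
    exact e₂.le.trans (((localAct_le_localAct_iff (σ := a ⟨p, hp.out⟩) (τ := a ⟨p, hp.out⟩)).2 (by
      rw [inv_mul_cancel, localAct_one]
      exact localization_mono p (scaledLattice_le b n))).trans e₁.ge)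
  refine ⟨N₁, M₁, hN₁, hM₁, hle, ?_⟩
  obtain ⟨e, rfl⟩ := exists_basis_of_isLattice h3 N₁
  obtain ⟨f, rfl⟩ := exists_basis_of_isLattice h3 M₁
  refine relIndex_eq_of_det_polarGram hQ h3 hle ?_
  rw [scaledLattice_eq_span b hn] at hM₁
  rw [det_polarGram_eq_of_isTranslate h3 hQ hN₁, det_polarGram_eq_of_isTranslate h3 hQ hM₁,
    det_polarGram_scaledBasis]

end Groups

/-! ### Sublattices of square-free index -/

section Adapted

variable {E : Type*} [AddCommGroup E]

/-- Three divisibility conditions with pairwise coprime moduli combine to one condition on a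
single coordinate: the functional `bc ℓ₀ + ac ℓ₁ + ab ℓ₂` is primitive, so it is a coordinate of a
suitable basis. -/
theorem exists_basis_dvd_repr_iff (x : Module.Basis (Fin 3) ℤ E) {a b c : ℤ} (hab : IsCoprime a b)
    (habc : IsCoprime (a * b) c) : ∃ y : Module.Basis (Fin 3) ℤ E, ∀ v,
      (a ∣ x.repr v 0 ∧ b ∣ x.repr v 1 ∧ c ∣ x.repr v 2) ↔ a * b * c ∣ y.repr v 2 := by
  have h₁ := hab
  have h₂ := habc
  obtain ⟨p, q, hpq⟩ := hab
  obtain ⟨r, s, hrs⟩ := habc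
  -- the last row is the functional; the other two complete it to a matrix of determinant one
  let f : (Fin 3 → ℤ) ≃ₗ[ℤ] (Fin 3 → ℤ) := LinearEquiv.ofLinearMap
    (Matrix.toLin' !![p, -q, 0; r * b, r * a, -s; c * b, c * a, a * b])
    (Matrix.toLin' !![a, q * (a * b), q * s; -b, p * (a * b), p * s; 0, -c, r])
    (by
      rw [← Matrix.toLin'_mul, ← Matrix.toLin'_one]
      congr 1
      ext i j
      fin_cases i <;> fin_cases j <;>
        simp [Matrix.mul_apply, Fin.sum_univ_three] <;> grind)
    (by
      rw [← Matrix.toLin'_mul, ← Matrix.toLin'_one]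
      congr 1
      ext i j
      fin_cases i <;> fin_cases j <;>
        simp [Matrix.mul_apply, Fin.sum_univ_three] <;> grind)
  refine ⟨Module.Basis.ofEquivFun (x.equivFun.trans f), fun v => ?_⟩
  have hv : (Module.Basis.ofEquivFun (x.equivFun.trans f)).repr v 2 =
      c * (b * x.repr v 0 + a * x.repr v 1) + a * b * x.repr v 2 := by
    change f (x.equivFun v) 2 = _
    change Matrix.toLin' _ _ _ = _
    simp [Matrix.mulVec, dotProduct, Fin.sum_univ_three]
    ring
  rw [hv]
  constructor
  · rintro ⟨⟨k, hk⟩, ⟨l, hl⟩, m, hm⟩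
    exact ⟨k + l + m, by rw [hk, hl, hm]; ring⟩
  · intro h
    have hc : c ∣ x.repr v 2 := by
      refine h₂.symm.dvd_of_dvd_mul_left ((dvd_add_right (dvd_mul_right c _)).1
        ((dvd_mul_left c _).trans h))
    have h' : a * b ∣ b * x.repr v 0 + a * x.repr v 1 :=
      h₂.dvd_of_dvd_mul_left ((dvd_add_left (dvd_mul_right (a * b) _)).1
        ((dvd_mul_right _ c).trans h))
    refine ⟨?_, ?_, hc⟩
    · exact h₁.dvd_of_dvd_mul_left ((dvd_add_left (dvd_mul_right a _)).1
        ((dvd_mul_right a b).trans h'))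
    · exact h₁.symm.dvd_of_dvd_mul_left ((dvd_add_right (dvd_mul_right b _)).1
        ((dvd_mul_left b a).trans h'))

/-- A sublattice of square-free index is cut out by one congruence on a coordinate of a suitable
basis: its elementary divisors are pairwise coprime. -/
theorem exists_basis_mem_iff_dvd_repr (x : Module.Basis (Fin 3) ℤ E) {P : Submodule ℤ E} {n : ℕ}
    (hn : Squarefree n) (hP : P.toAddSubgroup.index = n) :
    ∃ y : Module.Basis (Fin 3) ℤ E, ∀ v, v ∈ P ↔ (n : ℤ) ∣ y.repr v 2 := by
  have : Module.Free ℤ E := Module.Free.of_basis x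
  have : Module.Finite ℤ E := Module.Finite.of_basis x
  have hcard : Nat.card (E ⧸ P) = n := hP
  have hr : Module.finrank ℤ P = Module.finrank ℤ E :=
    (Submodule.finiteQuotient_iff P).1 (Nat.finite_of_card_ne_zero (hcard.trans_ne hn.ne_zero))
  obtain ⟨e, a, f, hf⟩ := Submodule.exists_smith_normal_form_of_rank_eq x hr
  have hdet := Submodule.natAbs_det_basis_change e P f
  have hmem : ∀ v, v ∈ P ↔ a 0 ∣ e.repr v 0 ∧ a 1 ∣ e.repr v 1 ∧ a 2 ∣ e.repr v 2 := by
    intro v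
    constructor
    · intro hv
      have h : v = ∑ i, f.repr ⟨v, hv⟩ i • (f i : E) := by
        have h := congrArg P.subtype (f.sum_repr ⟨v, hv⟩)
        rw [map_sum] at h
        exact h.symm
      have h' : ∀ i, a i ∣ e.repr v i := by
        intro i
        rw [h]
        simp only [hf, map_sum, map_smul, Module.Basis.repr_self, Finsupp.coe_finsetSum,
          Finset.sum_apply, Finsupp.smul_apply]
        rw [Finset.sum_eq_single i (fun j _ hj => by simp [hj]) (by simp)]
        exact ⟨f.repr ⟨v, hv⟩ i, by simp [mul_comm]⟩
      exact ⟨h' 0, h' 1, h' 2⟩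
    · rintro ⟨⟨k, hk⟩, ⟨l, hl⟩, m, hm⟩
      rw [← e.sum_repr v, Fin.sum_univ_three, hk, hl, hm, mul_comm (a 0), mul_comm (a 1),
        mul_comm (a 2), mul_smul, mul_smul, mul_smul, ← hf, ← hf, ← hf]
      exact add_mem (add_mem (P.smul_mem _ (f 0).2) (P.smul_mem _ (f 1).2)) (P.smul_mem _ (f 2).2)
  have hprod : (a 0 * a 1 * a 2).natAbs = n := by
    rw [← hcard, ← hdet]
    have h : ((↑) ∘ f : Fin 3 → E) = fun i => a i • e i := funext hf
    rw [h, Module.Basis.det_apply, Matrix.det_fin_three]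
    simp [Module.Basis.toMatrix_apply]
  have hsq : Squarefree (a 0 * a 1 * a 2) := Int.squarefree_natAbs.1 (hprod.symm ▸ hn)
  have hcop : ∀ {s t : ℤ}, Squarefree (s * t) → IsCoprime s t := fun h =>
    ((squarefree_mul_iff.1 h).1).isCoprime
  obtain ⟨y, hy⟩ := exists_basis_dvd_repr_iff e
    (hcop (hsq.squarefree_of_dvd (dvd_mul_right _ _))) (hcop hsq)
  refine ⟨y, fun v => ?_⟩
  rw [hmem, hy, ← hprod, Int.natAbs_dvd]

theorem exists_isAdaptedBasis {V W : Type*} [AddCommGroup V] [Module ℚ V] [AddCommGroup W]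
    [Module ℚ W] (h3 : Module.finrank ℚ V = 3) {N : Submodule ℤ V} [Submodule.IsLattice ℚ N]
    {M : Submodule ℤ W} {φ : W →ₗ[ℚ] V} {n : ℕ} (hn : Squarefree n)
    (hle : M.map (φ.restrictScalars ℤ) ≤ N)
    (hind : (M.map (φ.restrictScalars ℤ)).toAddSubgroup.relIndex N.toAddSubgroup = n) :
    ∃ x : Module.Basis (Fin 3) ℤ N, IsAdaptedBasis n M φ x := by
  have hV : Module.Finite ℚ V := Module.finite_of_finrank_pos (by omega)
  have hT : Module.IsTorsionFree ℤ V := Module.IsTorsionFree.trans ℚ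
  have hr : Module.finrank ℤ N = 3 := by
    rw [Module.finrank, Submodule.IsLattice.rank' ℚ N, ← h3, Module.finrank]
  obtain ⟨y, hy⟩ := exists_basis_mem_iff_dvd_repr (Module.finBasisOfFinrankEq ℤ N hr)
    (P := (M.map (φ.restrictScalars ℤ)).comap N.subtype) hn hind
  have hy' : ∀ v : N, (v : V) ∈ M.map (φ.restrictScalars ℤ) ↔ (n : ℤ) ∣ y.repr v 2 := hy
  refine ⟨y, le_antisymm (fun v hv => ?_) (Submodule.span_le.2 ?_)⟩
  · obtain ⟨k, hk⟩ := (hy' ⟨v, hle hv⟩).1 hv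
    have h := congrArg N.subtype (y.sum_repr ⟨v, hle hv⟩)
    simp only [Fin.sum_univ_three, map_add, map_smul, Submodule.subtype_apply, hk] at h
    rw [← h, mul_comm, mul_smul, natCast_zsmul]
    exact add_mem (add_mem (Submodule.smul_mem _ _ (Submodule.subset_span (by simp)))
      (Submodule.smul_mem _ _ (Submodule.subset_span (by simp))))
      (Submodule.smul_mem _ _ (Submodule.subset_span (by simp)))
  · rintro v (rfl | rfl | rfl)
    · exact (hy' _).2 (by simp)
    · exact (hy' _).2 (by simp)
    · exact (hy' (n • y 2)).2 (by simp)

end Adapted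

/-! ### The integer `n₁ n₂(e)` -/

section Divisors

variable {V : Type*} [AddCommGroup V] [Module ℚ V] {Q : QuadraticForm ℚ V} {N : Submodule ℤ V}
  {n : ℕ}

theorem n₂_dvd (hn : Squarefree n) : n₂ n Q N ∣ n := by
  classical
  conv_rhs => rw [← Nat.prod_primeFactors_of_squarefree hn]
  exact Finset.prod_dvd_prod_of_subset _ _ _ (Finset.filter_subset _ _)

theorem prime_dvd_n₂_iff {p : ℕ} [hp : Fact p.Prime] (hn : n ≠ 0) :
    p ∣ n₂ n Q N ↔ p ∣ n ∧ HalfModularRankTwo p Q N := by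
  classical
  rw [n₂, hp.out.prime.dvd_finsetProd_iff]
  constructor
  · rintro ⟨q, hq, hpq⟩
    obtain ⟨hq, h, hm⟩ := Finset.mem_filter.1 hq
    obtain rfl := (Nat.prime_dvd_prime_iff_eq hp.out h).1 hpq
    exact ⟨Nat.dvd_of_mem_primeFactors hq, hm⟩
  · rintro ⟨h, hm⟩
    exact ⟨p, Finset.mem_filter.2 ⟨Nat.mem_primeFactors.2 ⟨hp.out, h, hn⟩, hp.out, hm⟩, dvd_rfl⟩

theorem n₂e_dvd_n₂ (hn : Squarefree n) (x : Module.Basis (Fin 3) ℤ N) :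
    n₂e n Q x ∣ n₂ n Q N := by
  conv_rhs => rw [← Nat.prod_primeFactors_of_squarefree (hn.squarefree_of_dvd (n₂_dvd hn))]
  exact Finset.prod_dvd_prod_of_subset _ _ _ (Finset.filter_subset _ _)

theorem prime_dvd_n₂e_iff {p : ℕ} [hp : Fact p.Prime] (hn : Squarefree n)
    (x : Module.Basis (Fin 3) ℤ N) :
    p ∣ n₂e n Q x ↔ p ∣ n₂ n Q N ∧ Even (padicValRat p (4 * discr Q x)) := by
  rw [n₂e, hp.out.prime.dvd_finsetProd_iff]
  constructor
  · rintro ⟨q, hq, hpq⟩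
    obtain ⟨hq, h⟩ := Finset.mem_filter.1 hq
    obtain rfl := (Nat.prime_dvd_prime_iff_eq hp.out (Nat.prime_of_mem_primeFactors hq)).1 hpq
    exact ⟨Nat.dvd_of_mem_primeFactors hq, h⟩
  · rintro ⟨h, hm⟩
    exact ⟨p, Finset.mem_filter.2 ⟨Nat.mem_primeFactors.2 ⟨hp.out, h,
      (hn.squarefree_of_dvd (n₂_dvd hn)).ne_zero⟩, hm⟩, dvd_rfl⟩

theorem n₁_mul_n₂ (hn : Squarefree n) : n₁ n Q N * n₂ n Q N = n :=
  Nat.div_mul_cancel (n₂_dvd hn)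

theorem n₁_mul_n₂e_dvd (hn : Squarefree n) (x : Module.Basis (Fin 3) ℤ N) :
    n₁ n Q N * n₂e n Q x ∣ n :=
  (mul_dvd_mul_left _ (n₂e_dvd_n₂ hn x)).trans (n₁_mul_n₂ hn).dvd

theorem prime_dvd_n₁_mul_n₂e_iff {p : ℕ} [hp : Fact p.Prime] (hn : Squarefree n)
    (x : Module.Basis (Fin 3) ℤ N) (hpn : p ∣ n) :
    p ∣ n₁ n Q N * n₂e n Q x ↔
      (HalfModularRankTwo p Q N → Even (padicValRat p (4 * discr Q x))) := by
  have h₂ := prime_dvd_n₂_iff (p := p) (Q := Q) (N := N) hn.ne_zero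
  have h₁ : p ∣ n₁ n Q N ↔ ¬ p ∣ n₂ n Q N := by
    constructor
    · intro h h'
      have := mul_dvd_mul h h'
      rw [n₁_mul_n₂ hn] at this
      exact hp.out.not_isUnit (hn p this)
    · intro h
      rw [← n₁_mul_n₂ (Q := Q) (N := N) hn] at hpn
      exact (hp.out.dvd_mul.1 hpn).resolve_right h
  rw [hp.out.dvd_mul, h₁, prime_dvd_n₂e_iff hn x, h₂]
  tauto

/-- The Gram matrix of the polar form is twice that of `B`, so its determinant is `8 dN`. -/
theorem four_mul_discr (x : Module.Basis (Fin 3) ℤ N) :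
    4 * discr Q x = (polarGram Q fun i => (x i : V)).det / 2 := by
  have h : polarGram Q (fun i => (x i : V)) =
      (2 : ℚ) • Matrix.of fun i j => QuadraticMap.associated Q (x i : V) (x j : V) := by
    ext i j
    exact polar_eq_two_mul_associated Q _ _
  rw [h, Matrix.det_smul, Fintype.card_fin, discr]
  ring

end Divisors

/-! ### The genus-correspondence and the groups of `N` and `M` -/

section Correspondence

variable {V W : Type*} [AddCommGroup V] [Module ℚ V] [AddCommGroup W] [Module ℚ W]
  {QN : QuadraticForm ℚ V} {QM : QuadraticForm ℚ W} {n : ℕ}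

/-- A map multiplying the quadratic form by `n` between positive definite spaces of dimension
three is bijective. -/
theorem exists_linearEquiv_of_similitude (hV : Module.finrank ℚ V = 3)
    (hW : Module.finrank ℚ W = 3) (hQM : QM.PosDef) (hn : n ≠ 0) {φ : W →ₗ[ℚ] V}
    (hφ : ∀ x, QN (φ x) = n * QM x) : ∃ e : W ≃ₗ[ℚ] V, (e : W →ₗ[ℚ] V) = φ := by
  have := Module.finite_of_finrank_pos (R := ℚ) (M := V) (by omega)
  have := Module.finite_of_finrank_pos (R := ℚ) (M := W) (by omega)
  have hinj : Function.Injective φ := by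
    refine (injective_iff_map_eq_zero φ).2 fun x hx => ?_
    by_contra h0
    have h := hφ x
    rw [hx, map_zero] at h
    exact mul_ne_zero (Nat.cast_ne_zero.2 hn) (hQM x h0).ne' h.symm
  exact ⟨LinearEquiv.ofInjectiveOfFinrankEq φ hinj (hW.trans hV.symm), rfl⟩

/-- The pairs of the correspondence are, up to global isometries, the pairs `(s N, s M)` with `s`
an adelic isometry. Hence the correspondence respects spinor genus if and only if the groups of
`N` and `M` have the same adelic elements. -/
theorem respectsSpinorGenus_iff (hV : Module.finrank ℚ V = 3) (hW : Module.finrank ℚ W = 3)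
    (hQN : QN.PosDef) (hQM : QM.PosDef) (hn : Squarefree n) {b : Module.Basis (Fin 3) ℚ V}
    {M : Submodule ℤ W} [Submodule.IsLattice ℚ M] {φ : W ≃ₗ[ℚ] V}
    (hφ : ∀ x, QN (φ x) = n * QM x)
    (hφM : mapLattice (φ : W →ₗ[ℚ] V) M = scaledLattice b n)
    (hN : ∀ v ∈ Submodule.span ℤ (Set.range b), ∃ k : ℤ, QN v = k)
    (hM : ∀ v ∈ scaledLattice b n, ∃ k : ℤ, QN v = n * k)
    (hprim : ∀ p : ℕ, p.Prime → p ∣ n → PrimitiveAt p QN (Submodule.span ℤ (Set.range b)))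
    (hNM : IsRepresentablePair n QN (Submodule.span ℤ (Set.range b)) QM M) :
    RespectsSpinorGenus QN QM
        (fullCorrespondence n QN (Submodule.span ℤ (Set.range b)) QM M) ↔
      spinorGenusSubgroup QN (Submodule.span ℤ (Set.range b)) ⊓
        adelicSubgroup QN (Submodule.span ℤ (Set.range b)) =
      spinorGenusSubgroup QN (scaledLattice b n) ⊓
        adelicSubgroup QN (Submodule.span ℤ (Set.range b)) := by
  obtain ⟨d, hd⟩ := exists_isDiagonal_of_posDef hV hQN
  have hLN := isLattice_span_basis b
  have hLM := isLattice_scaledLattice b hn.ne_zero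
  have hn0 : (n : ℚ) ≠ 0 := Nat.cast_ne_zero.2 hn.ne_zero
  constructor
  · intro h
    have key : ∀ a ∈ adelicSubgroup QN (Submodule.span ℤ (Set.range b)),
        (a ∈ spinorGenusSubgroup QN (Submodule.span ℤ (Set.range b)) ↔
          a ∈ spinorGenusSubgroup QN (scaledLattice b n)) := by
      intro a ha
      obtain ⟨N₁, M₁, hN₁, hM₁, hle, hind⟩ :=
        exists_isTranslate_isTranslate hV hQN hn.ne_zero ha
      have hM₁' : mapLattice (φ : W →ₗ[ℚ] V) (mapLattice (φ.symm : V →ₗ[ℚ] W) M₁) = M₁ :=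
        mapLattice_symm' φ M₁
      have h₁ : (N₁, mapLattice (φ.symm : V →ₗ[ℚ] W) M₁) ∈
          fullCorrespondence n QN (Submodule.span ℤ (Set.range b)) QM M := by
        refine ⟨mem_gen_iff.2 ⟨a, hN₁⟩, ?_, (φ : W →ₗ[ℚ] V), ⟨hφ, ?_⟩, ?_⟩
        · rw [← mapLattice_mem_gen_iff hn0 hφ, hM₁', hφM]
          exact mem_gen_iff.2 ⟨a, hM₁⟩
        · exact hM₁'.le.trans hle
        · change (mapLattice (φ : W →ₗ[ℚ] V) _).toAddSubgroup.relIndex _ = n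
          rw [hM₁']
          exact hind
      have h₂ : (Submodule.span ℤ (Set.range b), M) ∈
          fullCorrespondence n QN (Submodule.span ℤ (Set.range b)) QM M :=
        ⟨mem_gen_iff.2 ⟨1, isTranslate_one _ _⟩, mem_gen_iff.2 ⟨1, isTranslate_one _ _⟩, hNM⟩
      have h₃ := h _ h₁ _ h₂
      change N₁ ∈ spn QN (Submodule.span ℤ (Set.range b)) ↔
        mapLattice (φ.symm : V →ₗ[ℚ] W) M₁ ∈ spn QM M at h₃
      rwa [← mapLattice_mem_spn_iff hn0 hφ, hM₁', hφM,
        mem_spn_iff_mul_inv_mem hd hN₁ (isTranslate_one _ _),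
        mem_spn_iff_mul_inv_mem hd hM₁ (isTranslate_one _ _), inv_one, mul_one] at h₃
    ext a
    exact and_congr_left (key a)
  · intro h
    -- after composition with a global isometry of `V` both lattices are moved by the same `s`
    have key : ∀ P ∈ fullCorrespondence n QN (Submodule.span ℤ (Set.range b)) QM M,
        ∃ (γ : orthogonalGroup QN) (s : LocalIsometries QN),
          IsTranslate QN (Submodule.span ℤ (Set.range b)) s P.1 ∧
          IsTranslate QN (scaledLattice b n) (principal QN γ * s)
            (mapLattice (φ : W →ₗ[ℚ] V) P.2) := by
      rintro ⟨N₁, M₁⟩ ⟨hN₁, hM₁, ψ, ⟨hψ, hle⟩, -⟩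
      obtain ⟨ψ, rfl⟩ := exists_linearEquiv_of_similitude hV hW hQM hn.ne_zero hψ
      obtain ⟨a, ha⟩ := mem_gen_iff.1 hN₁
      rw [← mapLattice_mem_gen_iff hn0 hφ, hφM] at hM₁
      obtain ⟨c, hc⟩ := mem_gen_iff.1 hM₁
      have hisom : ∀ v, QN ((φ.symm.trans ψ) v) = QN v := fun v => by
        change QN (ψ (φ.symm v)) = QN v
        conv_rhs => rw [← φ.apply_symm_apply v, hφ]
        exact hψ _
      let γ : orthogonalGroup QN := ⟨φ.symm.trans ψ, hisom⟩
      have hc' := hc.mapLattice γ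
      have e : mapLattice ((γ : V ≃ₗ[ℚ] V) : V →ₗ[ℚ] V) (mapLattice (φ : W →ₗ[ℚ] V) M₁) =
          mapLattice (ψ : W →ₗ[ℚ] V) M₁ := by
        rw [mapLattice, mapLattice, mapLattice, ← Submodule.map_comp]
        congr 1
        ext w
        change ψ (φ.symm (φ w)) = ψ w
        rw [φ.symm_apply_apply]
      rw [e] at hc'
      obtain ⟨s, hs, hs'⟩ := exists_isTranslate_pair hd hn hN hM hprim ha hc' hle
      refine ⟨γ⁻¹, s, hs, ?_⟩
      have := hs'.mapLattice γ⁻¹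
      rw [← e] at this
      have e' : mapLattice ((γ⁻¹ : V ≃ₗ[ℚ] V) : V →ₗ[ℚ] V)
          (mapLattice ((γ : V ≃ₗ[ℚ] V) : V →ₗ[ℚ] V) (mapLattice (φ : W →ₗ[ℚ] V) M₁)) =
          mapLattice (φ : W →ₗ[ℚ] V) M₁ := mapLattice_symm (γ : V ≃ₗ[ℚ] V) _
      exact e' ▸ this
    intro P₁ h₁ P₂ h₂
    obtain ⟨γ₁, s₁, hs₁, ht₁⟩ := key P₁ h₁
    obtain ⟨γ₂, s₂, hs₂, ht₂⟩ := key P₂ h₂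
    have hA : s₁ * s₂⁻¹ ∈ adelicSubgroup QN (Submodule.span ℤ (Set.range b)) :=
      mul_mem (hs₁.mem_adelicSubgroup hV) (inv_mem (hs₂.mem_adelicSubgroup hV))
    have hγ : ∀ γ : orthogonalGroup QN,
        principal QN γ ∈ spinorGenusSubgroup QN (scaledLattice b n) :=
      fun γ => Subgroup.mem_sup_left ⟨γ, rfl⟩
    have hiff := SetLike.ext_iff.1 h (s₁ * s₂⁻¹)
    rw [Subgroup.mem_inf, Subgroup.mem_inf, and_iff_left hA, and_iff_left hA] at hiff
    rw [← mapLattice_mem_spn_iff hn0 hφ, mem_spn_iff_mul_inv_mem hd hs₁ hs₂,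
      mem_spn_iff_mul_inv_mem hd ht₁ ht₂, hiff, mul_inv_rev, ← mul_assoc,
      Subgroup.mul_mem_cancel_right _ (inv_mem (hγ γ₂)), mul_assoc,
      Subgroup.mul_mem_cancel_left _ (hγ γ₁)]

/-- Scaling the form does not change the number of spinor genera. -/
theorem numSpinorGenera_smul {c : ℚ} (hc : c ≠ 0) (L : Submodule ℤ V) :
    numSpinorGenera (c • QN) L = numSpinorGenera QN L := by
  have h := numSpinorGenera_mapLattice (QV := c • QN) (QW := QN)
    (e := LinearEquiv.refl ℚ V) hc (fun _ => rfl) L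
  rwa [show mapLattice ((LinearEquiv.refl ℚ V : V ≃ₗ[ℚ] V) : V →ₗ[ℚ] V) L = L from
    Submodule.map_id _] at h

end Correspondence

end TernaryLattice

end

theorem corollary5p5 {V W : Type*} [AddCommGroup V] [Module ℚ V] [AddCommGroup W] [Module ℚ W]
    (n : ℕ) (hn : Squarefree n)
    (QN : QuadraticForm ℚ V) (N : Submodule ℤ V) (hN : TernaryLattice.IsTernaryLattice QN N)
    (QM : QuadraticForm ℚ W) (M : Submodule ℤ W) (hM : TernaryLattice.IsTernaryLattice QM M)
    (hprim : ∀ p : ℕ, p.Prime → p ∣ n → TernaryLattice.PrimitiveAt p QN N)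
    (hNM : TernaryLattice.IsRepresentablePair n QN N QM M)
    (hg : TernaryLattice.numSpinorGenera QN N = TernaryLattice.numSpinorGenera QM M) :
    (∃ (φ : W →ₗ[ℚ] V) (x : Module.Basis (Fin 3) ℤ N),
      TernaryLattice.IsRepresentation n QN N QM M φ ∧ TernaryLattice.IsAdaptedBasis n M φ x) ∧
    ∀ (φ : W →ₗ[ℚ] V) (x : Module.Basis (Fin 3) ℤ N),
      TernaryLattice.IsRepresentation n QN N QM M φ → TernaryLattice.IsAdaptedBasis n M φ x →
        (TernaryLattice.numSpinorGenera QN N = TernaryLattice.gNM n QN x ↔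
          TernaryLattice.RespectsSpinorGenus QN QM
            (TernaryLattice.fullCorrespondence n QN N QM M)) := by
  have hLN := hN.isLattice
  have hLM := hM.isLattice
  have hn0 : (n : ℚ) ≠ 0 := Nat.cast_ne_zero.2 hn.ne_zero
  refine ⟨?_, ?_⟩
  · obtain ⟨φ, hφ, hind⟩ := hNM
    obtain ⟨x, hx⟩ := TernaryLattice.exists_isAdaptedBasis hN.finrank_eq hn hφ.2 hind
    exact ⟨φ, x, hφ, hx⟩
  · intro φ x hφ hx
    obtain ⟨φ, rfl⟩ := TernaryLattice.exists_linearEquiv_of_similitude hN.finrank_eq hM.finrank_eq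
      hM.posDef hn.ne_zero hφ.1
    have hsim : ∀ w, QN (φ w) = n * QM w := hφ.1
    set b : Module.Basis (Fin 3) ℚ V := x.extendOfIsLattice ℚ with hb
    have hbx : ⇑b = fun i => (x i : V) := funext fun i => x.extendOfIsLattice_apply ℚ i
    have hNb : N = Submodule.span ℤ (Set.range b) := by
      have h : Set.range b = N.subtype '' Set.range x := by
        rw [hbx, ← Set.range_comp]
        rfl
      rw [h, Submodule.span_image, x.span_eq, Submodule.map_top, Submodule.range_subtype]
    have hφM : TernaryLattice.mapLattice (φ : W →ₗ[ℚ] V) M = TernaryLattice.scaledLattice b n := by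
      rw [hbx]
      exact hx
    have hMint : ∀ v ∈ TernaryLattice.scaledLattice b n, ∃ k : ℤ, QN v = n * k := by
      rw [← hφM]
      rintro _ ⟨w, hw, rfl⟩
      obtain ⟨k, hk⟩ := hM.integral w hw
      exact ⟨k, (hsim w).trans (by rw [hk])⟩
    obtain ⟨d, hd⟩ := TernaryLattice.exists_isDiagonal_of_posDef hN.finrank_eq hN.posDef
    set m : ℕ := TernaryLattice.n₁ n QN N * TernaryLattice.n₂e n QN x with hm
    have hmn : m ∣ n := TernaryLattice.n₁_mul_n₂e_dvd hn x
    have hm0 : (m : ℚ)⁻¹ ≠ 0 :=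
      inv_ne_zero (Nat.cast_ne_zero.2 (hn.squarefree_of_dvd hmn).ne_zero)
    have hgNM : TernaryLattice.gNM n QN x =
        TernaryLattice.numSpinorGenera QN (TernaryLattice.scaledLattice b m) := by
      rw [hbx]
      exact TernaryLattice.numSpinorGenera_smul hm0 _
    have hmp : ∀ (p : ℕ) [Fact p.Prime], p ∣ n → (p ∣ m ↔
        (TernaryLattice.HalfModularRankTwo p QN (Submodule.span ℤ (Set.range b)) →
          Even (padicValRat p ((TernaryLattice.polarGram QN b).det / 2)))) := by
      intro p _ hpn
      rw [hm, TernaryLattice.prime_dvd_n₁_mul_n₂e_iff hn x hpn, TernaryLattice.four_mul_discr,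
        ← hNb, hbx]
    have hgM := TernaryLattice.numSpinorGenera_mapLattice hn0 hsim M
    rw [hgNM]
    have hint := hN.integral
    clear_value m b
    rw [hφM] at hgM
    rw [← hgM] at hg
    rw [hNb] at hg hprim hNM hint ⊢
    rw [TernaryLattice.numSpinorGenera_eq_scaledLattice_iff hN.finrank_eq hN.posDef hd hn hint
      hMint hprim hmn hmp hg, TernaryLattice.respectsSpinorGenus_iff hN.finrank_eq hM.finrank_eq
      hN.posDef hM.posDef hn hsim hφM hint hMint hprim hNM]
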